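/- Let $d\ge 1$, $\delta\in[0,1)$, $p=\frac{1-\delta}{2}$, $\beta=\frac12\log\frac{1-p}{p}$. View $\mathbb{Z}^d$ as a graph in which $u\sim v$ iff $|u-v|=1$ (Euclidean distance). For a finite non-empty $B\subset\mathbb{Z}^d$ let $(\theta_{0u})_{u\in B}$ be i.i.d. uniform on $\{\pm1\}$ and, for every undirected edge $\{u,v\}$ of $\mathbb{Z}^d$ with $u,v\in B$, let $Y^{\delta}_{uv}=\theta_{0u}\theta_{0v}$ with probability $1-p$ and $Y^{\delta}_{uv}=-\theta_{0u}\theta_{0v}$ with probability $p$, independently over edges given $\theta_0$. Put $H^{\delta}_B(\theta)=\beta\sum_{\{u,v\}\subset B,\,u\sim v}Y^{\delta}_{uv}\theta_u\theta_v$ for $\theta\in\{\pm1\}^B$. Scalar side information: for $\lambda\ge0$ let $y_u=\sqrt{\lambda}\,\theta_{0u}+z_u$ with $(z_u)_{u\in B}$ i.i.d. $N(0,1)$ independent of everything else, and $$f^{\mathrm{sc}}_B(\delta,\lambda)=\frac1{|B|}\,\mathbb{E}\log\Big\{2^{-|B|}\sum_{\theta\in\{\pm1\}^B}\exp\Big(H^{\delta}_B(\theta)+\sum_{u\in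 B}\big(\sqrt{\lambda}\,y_u\theta_u-\tfrac{\lambda}{2}\big)\Big)\Big\}.$$ Spiked GOE side information: for $\eta\ge0$ let $Y^{\eta}_{uv}=\sqrt{\eta/|B|}\,\theta_{0u}\theta_{0v}+Z_{uv}$ for the unordered pairs $\{u,v\}\subset B$, $u\ne v$, with $Z_{uv}$ i.i.d. $N(0,1)$ independent of everything else, and $$f_B(\delta,\eta)=\frac1{|B|}\,\mathbb{E}\log\Big\{2^{-|B|}\sum_{\theta\in\{\pm1\}^B}\exp\Big(H^{\delta}_B(\theta)+\sum_{\{u,v\}\subset B,\,u\neq v}\Big(\sqrt{\tfrac{\eta}{|B|}}\,Y^{\eta}_{uv}\theta_u\theta_v-\tfrac{\eta}{2|B|}\Big)\Big)\Big\}.$$ A van Hove sequence is a sequence $(B_n)$ of finite non-empty connected subsets of $\mathbb{Z}^d$ with $B_n\subseteq B_{n+1}$, $\bigcup_nB_n=\mathbb{Z}^d$ and $|\partial B_n|/|B_n|\to0$, where $\partial B$ is the set of vertices of $B$ that have a neighbour outside $B$. Proposition. There are functions $f^{\mathrm{sc}}$ and $\phi$ such that, for all $\delta\in[0,1)$, $\lambda\ge0$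 and $\eta\ge0$ and for every van Hove sequence $(B_n)$, $f^{\mathrm{sc}}_{B_n}(\delta,\lambda)\to f^{\mathrm{sc}}(\delta,\lambda)$ and $f_{B_n}(\delta,\eta)\to\phi(\delta,\eta)$ as $n\to\infty$ (in particular the limits do not depend on the sequence), and for all $\delta\in[0,1)$, $\eta\ge0$, $$\phi(\delta,\eta)=\sup_{q\ge0}\Big\{f^{\mathrm{sc}}(\delta,\eta q)-\frac{\eta q^2}{4}\Big\},$$ the supremum being finite. -/

import Mathlib

open MeasureTheory ProbabilityTheory Filter Topology

noncomputable section

namespace LatticeSync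

/-! ### The lattice and van Hove sequences -/

/-- The nearest-neighbour graph on `ℤ^d`: `u` and `v` are adjacent when their Euclidean distance
is `1`. -/
def latticeGraph (d : ℕ) : SimpleGraph (Fin d → ℤ) where
  Adj u v := ∑ i, (u i - v i) ^ 2 = 1
  symm := ⟨fun u v h => by
    rw [← h]
    exact Finset.sum_congr rfl fun i _ => by ring⟩
  loopless := ⟨fun u h => by simp at h⟩

/-- The subgraph of `ℤ^d` induced on a finite set `B` of vertices. -/
def regionGraph {d : ℕ} (B : Finset (Fin d → ℤ)) : SimpleGraph B :=
  (latticeGraph d).comap Subtype.val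

open Classical in
/-- The (inner vertex) boundary of `B`: the vertices of `B` with a neighbour outside of `B`. -/
def boundary {d : ℕ} (B : Finset (Fin d → ℤ)) : Finset (Fin d → ℤ) :=
  B.filter fun u => ∃ v, (latticeGraph d).Adj u v ∧ v ∉ B

/-- A van Hove sequence: an increasing sequence of finite connected subsets of `ℤ^d` which invades
the lattice and has vanishing isoperimetry. (`SimpleGraph.Connected` includes non-emptiness.) -/
structure IsVanHove {d : ℕ} (B : ℕ → Finset (Fin d → ℤ)) : Prop where
  connected : ∀ n, (regionGraph (B n)).Connected
  increasing : ∀ n, B n ⊆ B (n + 1)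
  invades : ∀ u, ∃ n, u ∈ B n
  isoperimetry : Tendsto (fun n => ((boundary (B n)).card : ℝ) / ((B n).card : ℝ)) atTop (𝓝 0)

/-- The quantity `F B`, a function of a finite region `B` of `ℤ^d`, tends to `l` along every
van Hove sequence. -/
def VanHoveLimit {d : ℕ} (F : Finset (Fin d → ℤ) → ℝ) (l : ℝ) : Prop :=
  ∀ B : ℕ → Finset (Fin d → ℤ), IsVanHove B → Tendsto (fun n => F (B n)) atTop (𝓝 l)

/-! ### Observations and Hamiltonians on a finite graph

Spins take values in `ℤˣ = {1, -1}`. -/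

section Model

variable {V : Type} [Fintype V]

/-- The product `θ_u θ_v` over an unordered pair `e = {u, v}`. -/
def pairSpin (θ : V → ℤˣ) (e : Sym2 V) : ℝ :=
  Sym2.lift ⟨fun u v => ((θ u : ℤ) : ℝ) * ((θ v : ℤ) : ℝ), fun _ _ => mul_comm _ _⟩ e

/-- The flip probability `p`, for which `δ = 1 - 2p`. -/
def flipProb (δ : ℝ) : ℝ := (1 - δ) / 2

/-- The inverse temperature `β = (1/2) log ((1 - p) / p)`. -/
def invTemp (δ : ℝ) : ℝ := 1 / 2 * Real.log ((1 - flipProb δ) / flipProb δ)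

/-- The law of the sign `ξ` of an edge: `1` with probability `1 - p`, `-1` with probability `p`. -/
def flipWeight (δ : ℝ) (ξ : ℤˣ) : ℝ := if ξ = 1 then 1 - flipProb δ else flipProb δ

/-- The lattice observations `Y_e = ξ_e θ_u θ_v`, for the edges `e = {u, v}`. -/
def edgeObs (G : SimpleGraph V) (θ₀ : V → ℤˣ) (ξ : G.edgeSet → ℤˣ) (e : G.edgeSet) : ℝ :=
  ((ξ e : ℤ) : ℝ) * pairSpin θ₀ e.1

open Classical in
/-- The lattice Hamiltonian `β ∑ Y_{uv} θ_u θ_v`, the sum running over the (undirected) edges. -/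
def edgeHamiltonian (G : SimpleGraph V) (δ : ℝ) (Y : G.edgeSet → ℝ) (θ : V → ℤˣ) : ℝ :=
  invTemp δ * ∑ e : G.edgeSet, Y e * pairSpin θ e.1

/-- The scalar observations `y_u = √lam θ_u + z_u`. -/
def scalarObs (lam : ℝ) (θ₀ : V → ℤˣ) (z : V → ℝ) (u : V) : ℝ :=
  √lam * ((θ₀ u : ℤ) : ℝ) + z u

/-- The Hamiltonian of the scalar side information. -/
def scalarHamiltonian (lam : ℝ) (y : V → ℝ) (θ : V → ℤˣ) : ℝ :=
  ∑ u, (√lam * y u * ((θ u : ℤ) : ℝ) - lam / 2)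

variable (V) in
/-- The unordered pairs of distinct elements of `V`. -/
abbrev DistinctPair : Type := {e : Sym2 V // ¬ e.IsDiag}

/-- The spiked GOE observations `Y_{uv} = √(η / |V|) θ_u θ_v + Z_{uv}`. -/
def goeObs (η : ℝ) (θ₀ : V → ℤˣ) (Z : DistinctPair V → ℝ) (e : DistinctPair V) : ℝ :=
  √(η / Fintype.card V) * pairSpin θ₀ e.1 + Z e

open Classical in
/-- The Hamiltonian of the spiked GOE side information, the sum running over unordered pairs. -/
def goeHamiltonian (η : ℝ) (Y : DistinctPair V → ℝ) (θ : V → ℤˣ) : ℝ :=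
  ∑ e : DistinctPair V, (√(η / Fintype.card V) * Y e * pairSpin θ e.1 - η / (2 * Fintype.card V))

/-- The log-partition function `log (2^{-|V|} ∑_θ e^{H θ})`. -/
def logPartition (H : (V → ℤˣ) → ℝ) : ℝ :=
  open Classical in Real.log ((2 ^ Fintype.card V)⁻¹ * ∑ θ : V → ℤˣ, Real.exp (H θ))

open Classical in
/-- Expectation of `F (θ₀, ξ, z)` when `θ₀` is uniform on `{1, -1}^V`, the edge signs `ξ` are
i.i.d. with law `flipWeight δ`, `z` is a family of i.i.d. `N(0, 1)` variables indexed by `ι`, and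
`θ₀`, `ξ`, `z` are independent. -/
def expect (G : SimpleGraph V) (δ : ℝ) {ι : Type} [Fintype ι]
    (F : (V → ℤˣ) → (G.edgeSet → ℤˣ) → (ι → ℝ) → ℝ) : ℝ :=
  ∑ θ₀ : V → ℤˣ, (2 ^ Fintype.card V)⁻¹ * ∑ ξ : G.edgeSet → ℤˣ, (∏ e, flipWeight δ (ξ e)) *
    ∫ z, F θ₀ ξ z ∂(Measure.pi fun _ : ι => gaussianReal 0 1)

end Model

/-! ### Free energies of finite regions -/

/-- The free energy of the posterior on `B` with scalar side information of SNR `lam`. -/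
def scalarFreeEnergy {d : ℕ} (δ lam : ℝ) (B : Finset (Fin d → ℤ)) : ℝ :=
  1 / (B.card : ℝ) * expect (ι := B) (regionGraph B) δ fun θ₀ ξ z =>
    logPartition fun θ => edgeHamiltonian (regionGraph B) δ (edgeObs (regionGraph B) θ₀ ξ) θ
      + scalarHamiltonian lam (scalarObs lam θ₀ z) θ

open Classical in
/-- The free energy of the posterior on `B` with spiked GOE side information of SNR `η`. -/
def goeFreeEnergy {d : ℕ} (δ η : ℝ) (B : Finset (Fin d → ℤ)) : ℝ :=
  1 / (B.card : ℝ) * expect (ι := DistinctPair B) (regionGraph B) δ fun θ₀ ξ Z =>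
    logPartition fun θ => edgeHamiltonian (regionGraph B) δ (edgeObs (regionGraph B) θ₀ ξ) θ
      + goeHamiltonian η (goeObs η θ₀ Z) θ

end LatticeSync

end

noncomputable section

namespace LatticeSync

/-! ### Finite Gibbs measures -/

section Gibbs

variable {Ω : Type*}

/-! Write n for the number of sites and M(θ) for the sum of the spins. Multiplying configurations by
θ₀ moves the true signs to 1 (`expect_eq_modelEnergy`); each observation is then a random field c x
+ b acting on a character s of the sign group. The two kinds of side information are joined by a
path with gains √(η/n) sin t on pairs and √(ηq) cos t on sites. Gaussian integration by parts
(`integral_mul_gibbs`, `hasDerivAt_meanLogSum`) shows that the free energy has derivative sin t cos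
t times the mean of (η/n) Σ_e (2⟨s_e⟩ - ⟨s_e⟩²) - ηq Σ_u (2⟨s_u⟩ - ⟨s_u⟩²).

Lower bound: for uniform a priori weights the Nishimori identity E⟨s⟩² = E⟨s⟩ (`integral_gibbs_sq`)
reduces this to the mean of (η/n)(M² - n)/2 - ηqM, which is η/(2n) (M - nq)² - ηnq²/2 - η/2.
Dropping the square gives `scalarEnergy_le`, for every q ≥ 0.

Upper bound: for weights restricted to |M - nq| ≤ nε the identity is lost, but the linear terms
complete to a square of size at most ηnε², and the replica terms -⟨s⟩² to minus a square
(`overlap_upper`, `goeEnergy_le`). The windows around q = k/K, together with their images under θ ↦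
-θ, cover all configurations, and the Hamiltonian is even. By the Efron–Stein inequality each
window's log-partition function is within O(√n) of its mean in L¹, so their maximum costs only
lower-order terms (`goeEnergy_uniform_le`).

Thermodynamic limit: cutting a pair of neighbours changes the mean scalar log-partition function by
at most |β|, so it is almost additive (`almostAdditive_scalarEnergy`), and tiling by cubes gives a
density (`AlmostAdditive.exists_tendsto`). After division by n the lower bound gives each q, and the
upper bound gives the maximum over the grid plus η/(2K²); then K → ∞. The supremum is finite because
all lower bounds lie below the upper bound for K = 1. -/

/-- Nonnegative weights which do not all vanish. -/
structure IsWeight (W : Ω → ℝ) : Prop where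
  nonneg : ∀ θ, 0 ≤ W θ
  exists_pos : ∃ θ, 0 < W θ

theorem isWeight_const [Nonempty Ω] {c : ℝ} (hc : 0 < c) : IsWeight (fun _ : Ω => c) :=
  ⟨fun _ => hc.le, ⟨Classical.arbitrary Ω, hc⟩⟩

variable [Fintype Ω]

/-- The partition function of the Hamiltonian `H` and the a priori weights `W`. -/
def partitionSum (W H : Ω → ℝ) : ℝ := ∑ θ, W θ * Real.exp (H θ)

/-- The logarithm of the partition function. -/
def logSum (W H : Ω → ℝ) : ℝ := Real.log (partitionSum W H)

/-- The Gibbs average of `g`. -/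
def gibbs (W H g : Ω → ℝ) : ℝ := (∑ θ, W θ * Real.exp (H θ) * g θ) / partitionSum W H

variable {W W' H H' g g' : Ω → ℝ}

theorem IsWeight.partitionSum_pos (hW : IsWeight W) (H : Ω → ℝ) : 0 < partitionSum W H := by
  obtain ⟨θ, hθ⟩ := hW.exists_pos
  exact Finset.sum_pos' (fun θ _ => mul_nonneg (hW.nonneg θ) (Real.exp_pos _).le)
    ⟨θ, Finset.mem_univ _, mul_pos hθ (Real.exp_pos _)⟩

theorem logSum_le_add (hW : IsWeight W) {C : ℝ} (h : ∀ θ, H θ ≤ H' θ + C) :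
    logSum W H ≤ logSum W H' + C := by
  have : partitionSum W H ≤ partitionSum W H' * Real.exp C := by
    unfold partitionSum
    rw [Finset.sum_mul]
    refine Finset.sum_le_sum fun θ _ => ?_
    rw [mul_assoc, ← Real.exp_add]
    exact mul_le_mul_of_nonneg_left (Real.exp_le_exp.2 (h θ)) (hW.nonneg θ)
  calc logSum W H ≤ Real.log (partitionSum W H' * Real.exp C) :=
        Real.log_le_log (hW.partitionSum_pos H) this
    _ = _ := by
        rw [Real.log_mul (hW.partitionSum_pos H').ne' (Real.exp_pos _).ne', Real.log_exp]; rfl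

theorem abs_logSum_sub_le (hW : IsWeight W) {C : ℝ} (h : ∀ θ, |H θ - H' θ| ≤ C) :
    |logSum W H - logSum W H'| ≤ C := by
  rw [abs_sub_le_iff]
  constructor
  · linarith [logSum_le_add hW (H := H) (H' := H') (C := C)
      fun θ => by linarith [(abs_le.1 (h θ)).2]]
  · linarith [logSum_le_add hW (H := H') (H' := H) (C := C)
      fun θ => by linarith [(abs_le.1 (h θ)).1]]

theorem logSum_add_const (hW : IsWeight W) (H : Ω → ℝ) (C : ℝ) :
    logSum W (fun θ => H θ + C) = logSum W H + C := by
  apply le_antisymm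
  · exact logSum_le_add hW fun _ => le_rfl
  · have := logSum_le_add hW (H := H) (H' := fun θ => H θ + C) (C := -C) fun θ => by simp
    linarith

theorem partitionSum_mono (h : ∀ θ, W θ ≤ W' θ) : partitionSum W H ≤ partitionSum W' H :=
  Finset.sum_le_sum fun θ _ => mul_le_mul_of_nonneg_right (h θ) (Real.exp_pos _).le

theorem logSum_mono (hW : IsWeight W) (h : ∀ θ, W θ ≤ W' θ) : logSum W H ≤ logSum W' H :=
  Real.log_le_log (hW.partitionSum_pos H) (partitionSum_mono h)

theorem IsWeight.abs_gibbs_le (hW : IsWeight W) {C : ℝ} (h : ∀ θ, |g θ| ≤ C) :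
    |gibbs W H g| ≤ C := by
  rw [gibbs, abs_div, abs_of_pos (hW.partitionSum_pos H), div_le_iff₀ (hW.partitionSum_pos H),
    partitionSum, Finset.mul_sum]
  refine (Finset.abs_sum_le_sum_abs _ _).trans (Finset.sum_le_sum fun θ _ => ?_)
  have : 0 ≤ W θ * Real.exp (H θ) := mul_nonneg (hW.nonneg θ) (Real.exp_pos _).le
  rw [abs_mul, abs_of_nonneg this, mul_comm]
  exact mul_le_mul_of_nonneg_right (h θ) this

theorem gibbs_sum {ι : Type*} (t : Finset ι) (a : ι → ℝ) (f : ι → Ω → ℝ) :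
    gibbs W H (fun θ => ∑ i ∈ t, a i * f i θ) = ∑ i ∈ t, a i * gibbs W H (f i) := by
  simp only [gibbs, Finset.mul_sum, mul_div_assoc', ← Finset.sum_div]
  rw [Finset.sum_comm]
  congr 1
  refine Finset.sum_congr rfl fun i _ => Finset.sum_congr rfl fun θ _ => by ring

theorem IsWeight.gibbs_const (hW : IsWeight W) (c : ℝ) : gibbs W H (fun _ => c) = c := by
  rw [gibbs, ← Finset.sum_mul, div_eq_iff (hW.partitionSum_pos H).ne', mul_comm]
  rfl

/-- The Gibbs weights. -/
def gibbsWeight (W H : Ω → ℝ) (θ : Ω) : ℝ := W θ * Real.exp (H θ) / partitionSum W H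

theorem gibbs_eq_sum : gibbs W H g = ∑ θ, gibbsWeight W H θ * g θ := by
  rw [gibbs, Finset.sum_div]
  exact Finset.sum_congr rfl fun θ _ => by rw [gibbsWeight]; ring

theorem IsWeight.gibbsWeight_nonneg (hW : IsWeight W) (θ : Ω) : 0 ≤ gibbsWeight W H θ :=
  div_nonneg (mul_nonneg (hW.nonneg θ) (Real.exp_pos _).le) (hW.partitionSum_pos H).le

theorem IsWeight.sum_gibbsWeight (hW : IsWeight W) : ∑ θ, gibbsWeight W H θ = 1 := by
  have := hW.gibbs_const (H := H) 1
  rw [gibbs_eq_sum] at this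
  simpa using this

theorem hasDerivAt_partitionSum_mul {H : ℝ → Ω → ℝ} {t : ℝ}
    (hH : ∀ θ, HasDerivAt (fun t => H t θ) (H' θ) t) (g : Ω → ℝ) :
    HasDerivAt (fun t => ∑ θ, W θ * Real.exp (H t θ) * g θ)
      (∑ θ, W θ * Real.exp (H t θ) * (H' θ * g θ)) t := by
  refine HasDerivAt.fun_sum fun θ _ => ?_
  exact (((hH θ).exp.const_mul (W θ)).mul_const (g θ)).congr_deriv (by ring)

theorem hasDerivAt_partitionSum {H : ℝ → Ω → ℝ} {t : ℝ}
    (hH : ∀ θ, HasDerivAt (fun t => H t θ) (H' θ) t) :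
    HasDerivAt (fun t => partitionSum W (H t)) (∑ θ, W θ * Real.exp (H t θ) * H' θ) t := by
  simpa [partitionSum] using hasDerivAt_partitionSum_mul (W := W) hH (fun _ => 1)

theorem IsWeight.hasDerivAt_logSum (hW : IsWeight W) {H : ℝ → Ω → ℝ} {t : ℝ}
    (hH : ∀ θ, HasDerivAt (fun t => H t θ) (H' θ) t) :
    HasDerivAt (fun t => logSum W (H t)) (gibbs W (H t) H') t :=
  (hasDerivAt_partitionSum hH).log (hW.partitionSum_pos _).ne'

theorem IsWeight.hasDerivAt_gibbs (hW : IsWeight W) {H : ℝ → Ω → ℝ} {t : ℝ}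
    (hH : ∀ θ, HasDerivAt (fun t => H t θ) (H' θ) t) (g : Ω → ℝ) :
    HasDerivAt (fun t => gibbs W (H t) g)
      (gibbs W (H t) (fun θ => H' θ * g θ) - gibbs W (H t) H' * gibbs W (H t) g) t := by
  refine ((hasDerivAt_partitionSum_mul hH g).div (hasDerivAt_partitionSum (W := W) hH)
    (hW.partitionSum_pos _).ne').congr_deriv ?_
  have := (hW.partitionSum_pos (H t)).ne'
  simp only [gibbs]
  field_simp

theorem IsWeight.continuous_logSum (hW : IsWeight W) {X : Type*} [TopologicalSpace X]
    {H : X → Ω → ℝ} (hH : ∀ θ, Continuous fun x => H x θ) : Continuous fun x => logSum W (H x) := by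
  refine Continuous.log ?_ fun x => (hW.partitionSum_pos _).ne'
  unfold partitionSum
  fun_prop

theorem IsWeight.continuous_gibbs (hW : IsWeight W) {X : Type*} [TopologicalSpace X]
    {H : X → Ω → ℝ} (hH : ∀ θ, Continuous fun x => H x θ) (g : Ω → ℝ) :
    Continuous fun x => gibbs W (H x) g := by
  refine Continuous.div ?_ ?_ fun x => (hW.partitionSum_pos _).ne'
  · fun_prop
  · unfold partitionSum
    fun_prop

end Gibbs

end LatticeSync
end

noncomputable section

namespace LatticeSync

/-! ### Product measures: resampling one coordinate -/

section Product

variable {ι : Type*} [Fintype ι]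

theorem memLp_eval {μ : ι → Measure ℝ} [∀ i, IsProbabilityMeasure (μ i)]
    (hμ : ∀ i, MemLp id 2 (μ i)) (j : ι) : MemLp (fun x : ι → ℝ => x j) 2 (Measure.pi μ) := by
  have h : MemLp (id ∘ Function.eval j) 2 (Measure.pi μ) :=
    (hμ j).comp_measurePreserving (measurePreserving_eval μ j)
  exact h

variable [DecidableEq ι]

/-- Replacing coordinate `i` by an independent copy does not change the product law, as is checked
on boxes. This allows integration over a single coordinate without splitting the index type. -/
theorem measurePreserving_update (μ : ι → Measure ℝ) [∀ i, IsProbabilityMeasure (μ i)] (i : ι) :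
    MeasurePreserving (fun p : (ι → ℝ) × ℝ => Function.update p.1 i p.2)
      ((Measure.pi μ).prod (μ i)) (Measure.pi μ) := by
  have hm : Measurable (fun p : (ι → ℝ) × ℝ => Function.update p.1 i p.2) := by
    refine measurable_pi_iff.2 fun j => ?_
    by_cases h : j = i
    · subst h; simpa using measurable_snd
    · simp only [Function.update_of_ne h]
      fun_prop
  refine ⟨hm, (Measure.pi_eq fun s hs => ?_).symm⟩
  rw [Measure.map_apply hm (MeasurableSet.univ_pi hs)]
  have : (fun p : (ι → ℝ) × ℝ => Function.update p.1 i p.2) ⁻¹' (Set.univ.pi s)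
      = (Set.univ.pi (Function.update s i Set.univ)) ×ˢ s i := by
    ext p
    simp only [Set.mem_preimage, Set.mem_univ_pi, Set.mem_prod]
    constructor
    · intro h
      refine ⟨fun j => ?_, by simpa using h i⟩
      by_cases hj : j = i
      · subst hj; simp
      · simpa [hj] using h j
    · rintro ⟨h1, h2⟩ j
      by_cases hj : j = i
      · subst hj; simpa using h2
      · simpa [hj] using h1 j
  rw [this, Measure.prod_prod, Measure.pi_pi, ← Finset.prod_erase_mul _ _ (Finset.mem_univ i),
    ← Finset.prod_erase_mul (a := i) _ _ (Finset.mem_univ i)]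
  simp only [Function.update_self, measure_univ, mul_one]
  congr 1
  refine Finset.prod_congr rfl fun j hj => ?_
  rw [Function.update_of_ne (Finset.ne_of_mem_erase hj)]

theorem integral_integral_update (μ : ι → Measure ℝ) [∀ i, IsProbabilityMeasure (μ i)] (i : ι)
    {f : (ι → ℝ) → ℝ} (hf : Integrable f (Measure.pi μ)) :
    ∫ x, ∫ y, f (Function.update x i y) ∂μ i ∂Measure.pi μ = ∫ x, f x ∂Measure.pi μ := by
  have hp := measurePreserving_update μ i
  have hi : Integrable (fun p : (ι → ℝ) × ℝ => f (Function.update p.1 i p.2))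
      ((Measure.pi μ).prod (μ i)) := hp.integrable_comp_of_integrable hf
  have h := integral_prod _ hi
  rw [← h]
  conv_rhs => rw [← hp.map_eq]
  rw [integral_map hp.measurable.aemeasurable (by rw [hp.map_eq]; exact hf.1)]

/-- `f` is Lipschitz in each coordinate, with constants `c`. -/
def CoordLip (c : ι → ℝ) (f : (ι → ℝ) → ℝ) : Prop :=
  ∀ j x y, |f (Function.update x j y) - f x| ≤ c j * |y - x j|

variable {c c' : ι → ℝ} {f g : (ι → ℝ) → ℝ}

theorem CoordLip.nonneg (hf : CoordLip c f) (j : ι) : 0 ≤ c j := by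
  have := hf j 0 1
  simp only [Pi.zero_apply, sub_zero, abs_one, mul_one] at this
  exact (abs_nonneg _).trans this

theorem CoordLip.abs_sub_le (hf : CoordLip c f) (x x' : ι → ℝ) :
    |f x - f x'| ≤ ∑ j, c j * |x j - x' j| := by
  -- Telescoping: pass from `x'` to `x` by changing the coordinates in `S` one at a time.
  have key : ∀ S : Finset ι, |f (S.piecewise x x') - f x'| ≤ ∑ j ∈ S, c j * |x j - x' j| := by
    intro S
    induction S using Finset.induction_on with
    | empty => simp
    | insert j S hj ih =>
      rw [Finset.piecewise_insert, Finset.sum_insert hj]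
      have h := hf j (S.piecewise x x') (x j)
      rw [Finset.piecewise_eq_of_notMem _ _ _ hj] at h
      calc _ = |(f (Function.update (S.piecewise x x') j (x j)) - f (S.piecewise x x'))
            + (f (S.piecewise x x') - f x')| := by ring_nf
        _ ≤ _ := (abs_add_le _ _).trans (add_le_add h ih)
  simpa using key Finset.univ

theorem CoordLip.continuous (hf : CoordLip c f) : Continuous f := by
  rw [continuous_iff_continuousAt]
  intro x'
  rw [ContinuousAt, tendsto_iff_norm_sub_tendsto_zero]
  refine squeeze_zero (fun _ => norm_nonneg _) (fun x => hf.abs_sub_le x x') ?_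
  have : Continuous fun x : ι → ℝ => ∑ j, c j * |x j - x' j| := by fun_prop
  simpa using this.tendsto x'

theorem CoordLip.sub (hf : CoordLip c f) (hg : CoordLip c' g) :
    CoordLip (fun j => c j + c' j) (fun x => f x - g x) := by
  intro j x y
  calc _ = |(f (Function.update x j y) - f x) - (g (Function.update x j y) - g x)| := by ring_nf
    _ ≤ c j * |y - x j| + c' j * |y - x j| := (abs_sub _ _).trans (add_le_add (hf j x y) (hg j x y))
    _ = _ := by ring

theorem CoordLip.abs_le (hf : CoordLip c f) (x : ι → ℝ) : |f x| ≤ |f 0| + ∑ j, c j * |x j| := by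
  have := hf.abs_sub_le x 0
  simp only [Pi.zero_apply, sub_zero] at this
  have h2 := abs_sub_abs_le_abs_sub (f x) (f 0)
  linarith

theorem CoordLip.memLp (hf : CoordLip c f) {μ : ι → Measure ℝ} [∀ i, IsProbabilityMeasure (μ i)]
    (hμ : ∀ i, MemLp id 2 (μ i)) : MemLp f 2 (Measure.pi μ) := by
  have h : MemLp (fun x : ι → ℝ => |f 0| + ∑ j, c j * |x j|) 2 (Measure.pi μ) := by
    have hj : ∀ j, MemLp (fun x : ι → ℝ => c j * |x j|) 2 (Measure.pi μ) := fun j =>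
      MemLp.const_mul (f := fun x : ι → ℝ => |x j|) (memLp_eval hμ j).norm (c j)
    exact (memLp_const |f 0|).add (memLp_finsetSum Finset.univ fun j _ => hj j)
  exact h.mono' hf.continuous.aestronglyMeasurable (ae_of_all _ hf.abs_le)

theorem CoordLip.integrable (hf : CoordLip c f) {μ : ι → Measure ℝ}
    [∀ i, IsProbabilityMeasure (μ i)] (hμ : ∀ i, MemLp id 2 (μ i)) :
    Integrable f (Measure.pi μ) := (hf.memLp hμ).integrable one_le_two

theorem CoordLip.integrable_update (hf : CoordLip c f) {ν : Measure ℝ} [IsProbabilityMeasure ν]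
    (hν : MemLp id 2 ν) (i : ι) (x : ι → ℝ) : Integrable (fun y => f (Function.update x i y)) ν := by
  have h : Integrable (fun y : ℝ => |f x| + c i * |y - x i|) ν :=
    (integrable_const _).add ((((hν.integrable one_le_two).sub (integrable_const _)).norm).const_mul _)
  refine h.mono' ?_ (ae_of_all _ fun y => ?_)
  · exact (hf.continuous.comp (continuous_const.update i continuous_id)).aestronglyMeasurable
  · have := hf i x y
    have h2 := abs_sub_abs_le_abs_sub (f (Function.update x i y)) (f x)
    rw [Real.norm_eq_abs]
    linarith

/-- Averaging over one coordinate. -/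
def avgCoord (μ : ι → Measure ℝ) (i : ι) (f : (ι → ℝ) → ℝ) (x : ι → ℝ) : ℝ :=
  ∫ y, f (Function.update x i y) ∂μ i

variable {μ : ι → Measure ℝ}

theorem avgCoord_update (i : ι) (x : ι → ℝ) (y : ℝ) :
    avgCoord μ i f (Function.update x i y) = avgCoord μ i f x := by
  simp [avgCoord]

variable [∀ i, IsProbabilityMeasure (μ i)]

theorem avgCoord_update_of_invariant {j : ι} (h : ∀ x y, f (Function.update x j y) = f x) (i : ι)
    (x : ι → ℝ) (y : ℝ) : avgCoord μ i f (Function.update x j y) = avgCoord μ i f x := by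
  by_cases hij : j = i
  · subst hij; exact avgCoord_update _ _ _
  · simp only [avgCoord]
    congr 1
    ext t
    rw [Function.update_comm hij, h]

/-- For `j ≠ i` the Lipschitz bound survives averaging, and in direction `i` the average is
constant. Hence all partial averages of `f` keep the constants `c`. -/
theorem CoordLip.avgCoord (hf : CoordLip c f) (hμ : ∀ i, MemLp id 2 (μ i)) (i : ι) :
    CoordLip c (avgCoord μ i f) := by
  intro j x y
  by_cases hij : j = i
  · subst hij
    rw [avgCoord_update, sub_self, abs_zero]
    exact mul_nonneg (hf.nonneg j) (abs_nonneg _)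
  · simp only [LatticeSync.avgCoord]
    rw [← integral_sub (hf.integrable_update (hμ i) i _) (hf.integrable_update (hμ i) i _)]
    have := norm_integral_le_of_norm_le_const (μ := μ i) (C := c j * |y - x j|)
      (f := fun t => f (Function.update (Function.update x j y) i t) - f (Function.update x i t))
      (ae_of_all _ fun t => by
        have := hf j (Function.update x i t) y
        rwa [Function.update_of_ne hij, Function.update_comm (Ne.symm hij)] at this)
    simpa using this

theorem CoordLip.integral_avgCoord (hf : CoordLip c f) (hμ : ∀ i, MemLp id 2 (μ i)) (i : ι) :
    ∫ x, LatticeSync.avgCoord μ i f x ∂Measure.pi μ = ∫ x, f x ∂Measure.pi μ :=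
  integral_integral_update μ i (hf.integrable hμ)

theorem sq_integral_le_integral_sq {α : Type*} [MeasurableSpace α] {ν : Measure α}
    [IsProbabilityMeasure ν] {h : α → ℝ} (hh : MemLp h 2 ν) :
    (∫ x, h x ∂ν) ^ 2 ≤ ∫ x, h x ^ 2 ∂ν := by
  have := variance_nonneg h ν
  rw [variance_eq_sub hh] at this
  simpa using this

/-- One step of the martingale decomposition. -/
theorem integral_sq_sub_avgCoord_le (hf : CoordLip c f) (hg : CoordLip c g)
    (hμ : ∀ i, MemLp id 2 (μ i)) (h1 : ∀ i, ∫ y, |y| ∂μ i ≤ 1) (h2 : ∀ i, ∫ y, y ^ 2 ∂μ i ≤ 1)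
    (i : ι) :
    ∫ x, (f x - avgCoord μ i g x) ^ 2 ∂Measure.pi μ
      ≤ 4 * c i ^ 2 + ∫ x, (f x - g x) ^ 2 ∂Measure.pi μ := by
  have hEf := hf.avgCoord hμ i
  have hEg := hg.avgCoord hμ i
  have ha := hf.sub hEf
  have hb := hEf.sub hEg
  have hh := hf.sub hg
  set a := fun x => f x - avgCoord μ i f x with ha_def
  set b := fun x => avgCoord μ i f x - avgCoord μ i g x with hb_def
  set h := fun x => f x - g x with hh_def
  have ia := (ha.memLp hμ).integrable_sq
  have ib := (hb.memLp hμ).integrable_sq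
  have iab : Integrable (fun x => a x * b x) (Measure.pi μ) :=
    (ha.memLp hμ).integrable_mul (hb.memLp hμ)
  have hbE : ∀ x, b x = avgCoord μ i h x := fun x =>
    (integral_sub (hf.integrable_update (hμ i) i x) (hg.integrable_update (hμ i) i x)).symm
  -- `b` does not depend on coordinate `i` and `a` has mean zero in it, so the two are orthogonal.
  have hab : ∫ x, a x * b x ∂Measure.pi μ = 0 := by
    rw [← integral_integral_update μ i iab]
    refine integral_eq_zero_of_ae (ae_of_all _ fun x => ?_)
    simp only [hbE, avgCoord_update, Pi.zero_apply]
    rw [integral_mul_const]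
    simp only [ha_def, avgCoord_update]
    rw [integral_sub (hf.integrable_update (hμ i) i x) (integrable_const _)]
    simp [avgCoord]
  -- Jensen: `b` is the average of `h` over one coordinate.
  have hb2 : ∫ x, b x ^ 2 ∂Measure.pi μ ≤ ∫ x, h x ^ 2 ∂Measure.pi μ := by
    rw [← integral_integral_update μ i (hh.memLp hμ).integrable_sq]
    refine integral_mono ib ?_ fun x => ?_
    · exact ((measurePreserving_update μ i).integrable_comp_of_integrable
        (hh.memLp hμ).integrable_sq).integral_prod_left
    · simp only [hbE, avgCoord]
      refine sq_integral_le_integral_sq ?_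
      have hy : MemLp (fun y : ℝ => y - x i) 2 (μ i) := (hμ i).sub (memLp_const (x i))
      have hc : MemLp (fun y : ℝ => |h x| + (c i + c i) * |y - x i|) 2 (μ i) :=
        (memLp_const |h x|).add (MemLp.const_mul (f := fun y : ℝ => |y - x i|) hy.norm (c i + c i))
      refine hc.mono' (hh.continuous.comp
        (continuous_const.update i continuous_id)).aestronglyMeasurable (ae_of_all _ fun y => ?_)
      have := hh i x y
      have h2 := abs_sub_abs_le_abs_sub (h (Function.update x i y)) (h x)
      rw [Real.norm_eq_abs]
      linarith
  -- `|a| ≤ c_i (|x_i| + 1)` because `E|y| ≤ 1`. With `(s + 1)² ≤ 2 (s² + 1)` and `E x_i² ≤ 1` this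
  -- gives the constant 4.
  have ha2 : ∫ x, a x ^ 2 ∂Measure.pi μ ≤ 4 * c i ^ 2 := by
    have hpt : ∀ x, a x ^ 2 ≤ 2 * c i ^ 2 * (x i ^ 2 + 1) := by
      intro x
      have e : a x = ∫ y, (f x - f (Function.update x i y)) ∂μ i := by
        rw [integral_sub (integrable_const _) (hf.integrable_update (hμ i) i x)]
        simp [ha_def, avgCoord]
      have hi1 : Integrable (fun y : ℝ => |y|) (μ i) := ((hμ i).integrable one_le_two).norm
      have hbd : |a x| ≤ c i * (|x i| + 1) := by
        rw [e]
        calc _ ≤ ∫ y, c i * (|x i| + |y|) ∂μ i := by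
              rw [← Real.norm_eq_abs]
              refine norm_integral_le_of_norm_le
                (((integrable_const _).add hi1).const_mul _) (ae_of_all _ fun y => ?_)
              rw [Real.norm_eq_abs, abs_sub_comm]
              refine (hf i x y).trans (mul_le_mul_of_nonneg_left ?_ (hf.nonneg i))
              rw [add_comm]
              exact abs_sub _ _
          _ = c i * (|x i| + ∫ y, |y| ∂μ i) := by
              rw [integral_const_mul, integral_add (integrable_const _) hi1]
              simp
          _ ≤ _ := mul_le_mul_of_nonneg_left (by linarith [h1 i]) (hf.nonneg i)
      calc a x ^ 2 = |a x| ^ 2 := (sq_abs _).symm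
        _ ≤ (c i * (|x i| + 1)) ^ 2 := pow_le_pow_left₀ (abs_nonneg _) hbd 2
        _ = c i ^ 2 * (|x i| + 1) ^ 2 := by ring
        _ ≤ c i ^ 2 * (2 * (x i ^ 2 + 1)) := by
            refine mul_le_mul_of_nonneg_left ?_ (sq_nonneg _)
            nlinarith [sq_nonneg (|x i| - 1), sq_abs (x i)]
        _ = _ := by ring
    have hi2 : Integrable (fun x : ι → ℝ => x i ^ 2) (Measure.pi μ) :=
      (memLp_eval hμ i).integrable_sq
    calc _ ≤ ∫ x, 2 * c i ^ 2 * (x i ^ 2 + 1) ∂Measure.pi μ :=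
          integral_mono ia ((hi2.add (integrable_const _)).const_mul _) hpt
      _ = 2 * c i ^ 2 * (∫ x, x i ^ 2 ∂Measure.pi μ + 1) := by
          rw [integral_const_mul, integral_add hi2 (integrable_const _)]
          simp
      _ ≤ 2 * c i ^ 2 * (1 + 1) := by
          have : ∫ x : ι → ℝ, x i ^ 2 ∂Measure.pi μ = ∫ y, y ^ 2 ∂μ i := by
            conv_rhs => rw [← (measurePreserving_eval μ i).map_eq]
            rw [integral_map (measurePreserving_eval μ i).measurable.aemeasurable
              (by fun_prop)]
          rw [this]
          exact mul_le_mul_of_nonneg_left (by linarith [h2 i]) (by positivity)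
      _ = _ := by ring
  have : ∫ x, (f x - avgCoord μ i g x) ^ 2 ∂Measure.pi μ
      = ∫ x, a x ^ 2 ∂Measure.pi μ + 2 * ∫ x, a x * b x ∂Measure.pi μ
        + ∫ x, b x ^ 2 ∂Measure.pi μ := by
    have iab2 : Integrable (fun x => a x ^ 2 + 2 * (a x * b x)) (Measure.pi μ) :=
      ia.add (iab.const_mul 2)
    rw [← integral_const_mul, ← integral_add ia (iab.const_mul 2), ← integral_add iab2 ib]
    refine integral_congr_ae (ae_of_all _ fun x => ?_)
    simp only [ha_def, hb_def]
    ring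
  rw [this, hab]
  linarith

/-- The Efron–Stein inequality, for functions that are Lipschitz in each coordinate. -/
theorem CoordLip.integral_sq_sub_integral_le (hf : CoordLip c f) (hμ : ∀ i, MemLp id 2 (μ i))
    (h1 : ∀ i, ∫ y, |y| ∂μ i ≤ 1) (h2 : ∀ i, ∫ y, y ^ 2 ∂μ i ≤ 1) :
    ∫ x, (f x - ∫ x', f x' ∂Measure.pi μ) ^ 2 ∂Measure.pi μ ≤ ∑ i, 4 * c i ^ 2 := by
  -- `g` is `f` averaged over the coordinates in `S`; each new coordinate adds at most `4 c_i²` to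
  -- the squared distance. For `S = univ` only a constant remains, the mean of `f`.
  have key : ∀ S : Finset ι, ∃ g, CoordLip c g ∧ ∫ x, g x ∂Measure.pi μ = ∫ x, f x ∂Measure.pi μ ∧
      (∀ i ∈ S, ∀ x y, g (Function.update x i y) = g x) ∧
      ∫ x, (f x - g x) ^ 2 ∂Measure.pi μ ≤ ∑ i ∈ S, 4 * c i ^ 2 := by
    intro S
    induction S using Finset.induction_on with
    | empty => exact ⟨f, hf, rfl, by simp, by simp⟩
    | insert i S hi ih =>
      obtain ⟨g, hg, hint, hinv, hle⟩ := ih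
      refine ⟨LatticeSync.avgCoord μ i g, hg.avgCoord hμ i,
        (hg.integral_avgCoord hμ i).trans hint, fun j hj x y => ?_, ?_⟩
      · rcases Finset.mem_insert.1 hj with rfl | hj
        · exact avgCoord_update _ _ _
        · exact avgCoord_update_of_invariant (hinv j hj) i x y
      · rw [Finset.sum_insert hi]
        linarith [integral_sq_sub_avgCoord_le hf hg hμ h1 h2 i]
  obtain ⟨g, hg, hint, hinv, hle⟩ := key Finset.univ
  have hg0 : CoordLip (fun _ => 0) g := fun j x y => by simp [hinv j (Finset.mem_univ _)]
  have hconst : ∀ x, g x = g 0 := fun x => by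
    have := hg0.abs_sub_le x 0
    simp only [zero_mul, Finset.sum_const_zero] at this
    exact sub_eq_zero.1 (abs_nonpos_iff.1 this)
  have hg1 : ∫ x, f x ∂Measure.pi μ = g 0 := by
    rw [← hint]
    simp [hconst]
  rw [hg1]
  simpa [hconst] using hle

/-- Cauchy–Schwarz. An L¹ bound suffices for the windows, where finitely many deviations are simply
added. -/
theorem CoordLip.integral_abs_sub_integral_le (hf : CoordLip c f) (hμ : ∀ i, MemLp id 2 (μ i))
    (h1 : ∀ i, ∫ y, |y| ∂μ i ≤ 1) (h2 : ∀ i, ∫ y, y ^ 2 ∂μ i ≤ 1) :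
    ∫ x, |f x - ∫ x', f x' ∂Measure.pi μ| ∂Measure.pi μ ≤ √(∑ i, 4 * c i ^ 2) := by
  refine Real.le_sqrt_of_sq_le ?_
  refine (sq_integral_le_integral_sq ((hf.memLp hμ).sub (memLp_const _)).norm).trans ?_
  simpa using hf.integral_sq_sub_integral_le hμ h1 h2

end Product

/-! ### Gaussian integration by parts -/

theorem hasDerivAt_gaussianPDFReal (x : ℝ) :
    HasDerivAt (gaussianPDFReal 0 1) (-(x * gaussianPDFReal 0 1 x)) x := by
  have h : HasDerivAt (fun x : ℝ => -(x - 0) ^ 2 / (2 * ((1 : NNReal) : ℝ))) (-x) x := by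
    refine ((((hasDerivAt_id x).sub_const 0).pow 2).neg.div_const _).congr_deriv ?_
    simp
    ring
  rw [gaussianPDFReal_def]
  exact (h.exp.const_mul _).congr_deriv (by ring)

/-- The density satisfies `p' = -x p`, so this is integration by parts on the line; the bounds on
`F` and `F'` serve integrability. -/
theorem integral_mul_gaussianReal {F F' : ℝ → ℝ} {C C' : ℝ} (hF : ∀ x, HasDerivAt F (F' x) x)
    (hC : ∀ x, |F x| ≤ C) (hC' : ∀ x, |F' x| ≤ C') (hF' : Continuous F') :
    ∫ x, x * F x ∂gaussianReal 0 1 = ∫ x, F' x ∂gaussianReal 0 1 := by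
  have hFc : Continuous F := continuous_iff_continuousAt.2 fun x => (hF x).continuousAt
  have hp := integrable_gaussianPDFReal 0 1
  have hpc : Continuous (gaussianPDFReal 0 1) :=
    continuous_iff_continuousAt.2 fun x => (hasDerivAt_gaussianPDFReal x).continuousAt
  have hxp : Integrable (fun x => x * gaussianPDFReal 0 1 x) := by
    have := (integrable_mul_exp_neg_mul_sq (b := 1 / 2) (by norm_num)).const_mul
      (√(2 * Real.pi))⁻¹
    refine this.congr (ae_of_all _ fun x => ?_)
    simp only [gaussianPDFReal, NNReal.coe_one, mul_one, sub_zero]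
    ring_nf
  rw [integral_gaussianReal_eq_integral_smul one_ne_zero,
    integral_gaussianReal_eq_integral_smul one_ne_zero]
  have h := integral_mul_deriv_eq_deriv_mul_of_integrable (u := F) (v := gaussianPDFReal 0 1)
    (u' := F') (v' := fun x => -(x * gaussianPDFReal 0 1 x)) (fun x _ => hF x)
    (fun x _ => hasDerivAt_gaussianPDFReal x)
    (hxp.neg.bdd_mul (c := C) hFc.aestronglyMeasurable (ae_of_all _ hC))
    (hp.bdd_mul (c := C') hF'.aestronglyMeasurable (ae_of_all _ hC'))
    (hp.bdd_mul (c := C) hFc.aestronglyMeasurable (ae_of_all _ hC))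
  simp only [smul_eq_mul]
  rw [← neg_inj]
  calc _ = ∫ x, F x * -(x * gaussianPDFReal 0 1 x) := by
        rw [← integral_neg]; congr 1; ext x; ring
    _ = _ := by rw [h]; congr 2; ext x; ring

end LatticeSync
end

noncomputable section

namespace LatticeSync

/-! ### Free energy of a family of noisy observations of signs -/

section FreeEnergy

variable {Ω : Type*} [Fintype Ω] {ι : Type*} [Fintype ι]

/-- The Hamiltonian `∑ h_i s_i(θ)` of the external fields `h`. -/
def spinField (s : ι → Ω → ℝ) (h : ι → ℝ) (θ : Ω) : ℝ := ∑ i, h i * s i θ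

/-- The free energy with the fields `h_i = c_i x_i + b_i`, where the `x_i` are independent with
laws `μ i`. -/
def meanLogSum (μ : ι → Measure ℝ) (W : Ω → ℝ) (s : ι → Ω → ℝ) (c b : ι → ℝ) : ℝ :=
  ∫ x, logSum W (spinField s fun i => c i * x i + b i) ∂Measure.pi μ

variable {W : Ω → ℝ} {s : ι → Ω → ℝ} {c b : ι → ℝ} {μ : ι → Measure ℝ}

theorem abs_le_one_of_sq_eq_one {a : ℝ} (h : a ^ 2 = 1) : |a| ≤ 1 := by
  rw [← sq_le_one_iff_abs_le_one, h]

theorem continuous_spinField (s : ι → Ω → ℝ) (c b : ι → ℝ) (θ : Ω) :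
    Continuous fun x : ι → ℝ => spinField s (fun i => c i * x i + b i) θ := by
  unfold spinField
  fun_prop

theorem continuous_gibbs_spinField (hW : IsWeight W) (s : ι → Ω → ℝ) (c b : ι → ℝ) (g : Ω → ℝ) :
    Continuous fun x : ι → ℝ => gibbs W (spinField s fun i => c i * x i + b i) g :=
  hW.continuous_gibbs (continuous_spinField s c b) g

theorem coordLip_logSum [DecidableEq ι] (hW : IsWeight W) (hs : ∀ i θ, s i θ ^ 2 = 1)
    (c b : ι → ℝ) :
    CoordLip (fun i => |c i|) (fun x => logSum W (spinField s fun i => c i * x i + b i)) := by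
  intro j x y
  refine abs_logSum_sub_le hW fun θ => ?_
  have : spinField s (fun i => c i * Function.update x j y i + b i) θ
      - spinField s (fun i => c i * x i + b i) θ = c j * (y - x j) * s j θ := by
    rw [spinField, spinField, ← Finset.sum_sub_distrib, Finset.sum_eq_single j]
    · simp; ring
    · intro i _ hij; simp [hij]
    · simp
  rw [this, abs_mul, abs_mul]
  exact mul_le_of_le_one_right (by positivity) (abs_le_one_of_sq_eq_one (hs j θ))

variable [∀ i, IsProbabilityMeasure (μ i)]

theorem integrable_logSum (hW : IsWeight W) (hs : ∀ i θ, s i θ ^ 2 = 1)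
    (hμ : ∀ i, MemLp id 2 (μ i)) (c b : ι → ℝ) :
    Integrable (fun x => logSum W (spinField s fun i => c i * x i + b i)) (Measure.pi μ) := by
  classical exact (coordLip_logSum hW hs c b).integrable hμ

theorem integrable_gibbs (hW : IsWeight W) (s : ι → Ω → ℝ) (c b : ι → ℝ) (g : Ω → ℝ) :
    Integrable (fun x => gibbs W (spinField s fun i => c i * x i + b i) g) (Measure.pi μ) := by
  have := (integrable_const (μ := Measure.pi μ) (1 : ℝ)).bdd_mul (c := ∑ θ, |g θ|)
    (continuous_gibbs_spinField hW s c b g).aestronglyMeasurable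
    (ae_of_all _ fun x => hW.abs_gibbs_le fun θ =>
      Finset.single_le_sum (f := fun θ => |g θ|) (fun _ _ => abs_nonneg _) (Finset.mem_univ θ))
  simpa using this

theorem integrable_gibbs_sq (hW : IsWeight W) (s : ι → Ω → ℝ) (c b : ι → ℝ) (g : Ω → ℝ) :
    Integrable (fun x => gibbs W (spinField s fun i => c i * x i + b i) g ^ 2)
      (Measure.pi μ) := by
  simp only [sq]
  exact (integrable_gibbs hW s c b g).bdd_mul (c := ∑ θ, |g θ|)
    (continuous_gibbs_spinField hW s c b g).aestronglyMeasurable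
    (ae_of_all _ fun x => hW.abs_gibbs_le fun θ =>
      Finset.single_le_sum (f := fun θ => |g θ|) (fun _ _ => abs_nonneg _) (Finset.mem_univ θ))

/-- Integration by parts in a Gaussian coordinate. -/
theorem integral_mul_gibbs (hW : IsWeight W) (hs : ∀ i θ, s i θ ^ 2 = 1)
    (hμ : ∀ i, MemLp id 2 (μ i)) (c b : ι → ℝ) {i : ι} (hi : μ i = gaussianReal 0 1) :
    ∫ x, x i * gibbs W (spinField s fun i => c i * x i + b i) (s i) ∂Measure.pi μ
      = ∫ x, c i * (1 - gibbs W (spinField s fun i => c i * x i + b i) (s i) ^ 2)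
          ∂Measure.pi μ := by
  classical
  have hg1 : ∀ h : ι → ℝ, |gibbs W (spinField s h) (s i)| ≤ 1 := fun h =>
    hW.abs_gibbs_le fun θ => abs_le_one_of_sq_eq_one (hs i θ)
  have hgc := continuous_gibbs_spinField hW s c b (s i)
  have i1 : Integrable (fun x : ι → ℝ =>
      x i * gibbs W (spinField s fun i => c i * x i + b i) (s i)) (Measure.pi μ) :=
    ((memLp_eval hμ i).integrable one_le_two).mul_bdd (c := 1) hgc.aestronglyMeasurable
      (ae_of_all _ fun x => hg1 _)
  have i2 : Integrable (fun x : ι → ℝ =>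
      c i * (1 - gibbs W (spinField s fun i => c i * x i + b i) (s i) ^ 2)) (Measure.pi μ) := by
    exact ((integrable_const _).sub (integrable_gibbs_sq hW s c b (s i))).const_mul _
  rw [← integral_integral_update μ i i1, ← integral_integral_update μ i i2]
  congr 1
  ext x
  rw [hi]
  simp only [Function.update_self]
  have hupd : Continuous fun y : ℝ => Function.update x i y :=
    continuous_const.update i continuous_id
  refine integral_mul_gaussianReal (C := 1) (C' := |c i| * 2) (fun y => ?_) (fun y => hg1 _)
    (fun y => ?_) ?_
  · have hd : ∀ θ, HasDerivAt (fun y => spinField s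
        (fun j => c j * Function.update x i y j + b j) θ) (c i * s i θ) y := by
      intro θ
      have h1 : ∀ j, HasDerivAt (fun y => (c j * Function.update x i y j + b j) * s j θ)
          (if j = i then c i * s i θ else 0) y := by
        intro j
        by_cases hj : j = i
        · subst hj
          simp only [Function.update_self, if_true]
          simpa using (((hasDerivAt_id y).const_mul (c j)).add_const (b j)).mul_const (s j θ)
        · simp only [Function.update_of_ne hj, if_neg hj]
          exact hasDerivAt_const _ _
      refine (HasDerivAt.fun_sum (u := Finset.univ) fun j _ => h1 j).congr_deriv ?_
      simp
    refine (hW.hasDerivAt_gibbs hd (s i)).congr_deriv ?_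
    -- The derivative of `⟨s_i⟩` in its field is the variance of a sign, and `s_i² = 1` turns it
    -- into `1 - ⟨s_i⟩²`.
    have e1 : ∀ H, gibbs W H (fun θ => c i * s i θ * s i θ) = c i := by
      intro H
      have : (fun θ => c i * s i θ * s i θ) = fun _ => c i := by
        ext θ; rw [mul_assoc, ← sq, hs, mul_one]
      rw [this, hW.gibbs_const]
    have e2 : ∀ H, gibbs W H (fun θ => c i * s i θ) = c i * gibbs W H (s i) := by
      intro H
      simpa using gibbs_sum (W := W) (H := H) {()} (fun _ => c i) (fun _ => s i)
    rw [e1, e2]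
    ring
  · rw [abs_mul]
    refine mul_le_mul_of_nonneg_left ?_ (abs_nonneg _)
    have := sq_le_one_iff_abs_le_one _ |>.2 (hg1 fun j => c j * Function.update x i y j + b j)
    rw [abs_le]
    constructor <;> nlinarith [sq_nonneg
      (gibbs W (spinField s fun j => c j * Function.update x i y j + b j) (s i))]
  · have := hgc.comp hupd
    simp only [Function.comp_def] at this
    fun_prop

/-- The derivative of the free energy along a path of channels. -/
theorem hasDerivAt_meanLogSum (hW : IsWeight W) (hs : ∀ i θ, s i θ ^ 2 = 1)
    (hμ : ∀ i, MemLp id 2 (μ i)) {c b c' b' : ℝ → ι → ℝ} {K : ℝ}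
    (hc : ∀ t i, HasDerivAt (fun t => c t i) (c' t i) t)
    (hb : ∀ t i, HasDerivAt (fun t => b t i) (b' t i) t)
    (hcK : ∀ t i, |c' t i| ≤ K) (hbK : ∀ t i, |b' t i| ≤ K)
    (hγ : ∀ t i, c' t i ≠ 0 → μ i = gaussianReal 0 1) (t : ℝ) :
    HasDerivAt (fun t => meanLogSum μ W s (c t) (b t))
      (∫ x, ∑ i, (c' t i * c t i *
          (1 - gibbs W (spinField s fun i => c t i * x i + b t i) (s i) ^ 2)
        + b' t i * gibbs W (spinField s fun i => c t i * x i + b t i) (s i)) ∂Measure.pi μ) t := by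
  set G : ℝ → (ι → ℝ) → ι → ℝ :=
    fun t x i => gibbs W (spinField s fun i => c t i * x i + b t i) (s i) with hG
  have hG1 : ∀ t x i, |G t x i| ≤ 1 := fun t x i =>
    hW.abs_gibbs_le fun θ => abs_le_one_of_sq_eq_one (hs i θ)
  have hGc : ∀ t i, Continuous fun x => G t x i := fun t i =>
    continuous_gibbs_spinField hW s (c t) (b t) (s i)
  have hd : ∀ x t, HasDerivAt (fun t => logSum W (spinField s fun i => c t i * x i + b t i))
      (∑ i, (c' t i * x i + b' t i) * G t x i) t := by
    intro x t
    have := hW.hasDerivAt_logSum (t := t) (H := fun t => spinField s fun i => c t i * x i + b t i)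
      (H' := fun θ => ∑ i, (c' t i * x i + b' t i) * s i θ) fun θ =>
        HasDerivAt.fun_sum fun i _ => (((hc t i).mul_const (x i)).add (hb t i)).mul_const (s i θ)
    rwa [gibbs_sum] at this
  -- Domination uniform in `t`, because Gibbs averages of signs are at most 1 in modulus.
  have hbound : ∀ x t, |∑ i, (c' t i * x i + b' t i) * G t x i| ≤ ∑ i, (K * |x i| + K) := by
    intro x t
    refine (Finset.abs_sum_le_sum_abs _ _).trans (Finset.sum_le_sum fun i _ => ?_)
    rw [abs_mul]
    refine (mul_le_of_le_one_right (abs_nonneg _) (hG1 t x i)).trans ?_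
    refine (abs_add_le _ _).trans (add_le_add ?_ (hbK t i))
    rw [abs_mul]
    exact mul_le_mul_of_nonneg_right (hcK t i) (abs_nonneg _)
  have hix : ∀ i, Integrable (fun x : ι → ℝ => x i) (Measure.pi μ) := fun i =>
    (memLp_eval hμ i).integrable one_le_two
  have hmain := (hasDerivAt_integral_of_dominated_loc_of_deriv_le (μ := Measure.pi μ)
    (F := fun t x => logSum W (spinField s fun i => c t i * x i + b t i))
    (F' := fun t x => ∑ i, (c' t i * x i + b' t i) * G t x i) (x₀ := t)
    (bound := fun x => ∑ i, (K * |x i| + K)) univ_mem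
    (Eventually.of_forall fun t => (integrable_logSum hW hs hμ (c t) (b t)).1)
    (integrable_logSum hW hs hμ (c t) (b t))
    (Continuous.aestronglyMeasurable (by have := hGc t; fun_prop))
    (ae_of_all _ fun x t _ => hbound x t)
    (integrable_finsetSum _ fun i _ => ((hix i).norm.const_mul K).add (integrable_const K))
    (ae_of_all _ fun x t _ => hd x t)).2
  refine hmain.congr_deriv ?_
  have j1 : ∀ i, Integrable (fun x => x i * G t x i) (Measure.pi μ) := fun i =>
    (hix i).mul_bdd (c := 1) (hGc t i).aestronglyMeasurable (ae_of_all _ fun x => hG1 t x i)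
  have j2 : ∀ i, Integrable (fun x => G t x i) (Measure.pi μ) := fun i =>
    integrable_gibbs hW s (c t) (b t) (s i)
  have j3 : ∀ i, Integrable (fun x => 1 - G t x i ^ 2) (Measure.pi μ) := fun i => by
    exact (integrable_const _).sub (integrable_gibbs_sq hW s (c t) (b t) (s i))
  have j4 : ∀ i, Integrable (fun x => (c' t i * x i + b' t i) * G t x i) (Measure.pi μ) := by
    intro i
    refine (((j1 i).const_mul (c' t i)).add ((j2 i).const_mul (b' t i))).congr
      (ae_of_all _ fun x => ?_)
    simp only [Pi.add_apply]; ring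
  have j5 : ∀ i, Integrable (fun x => c' t i * c t i * (1 - G t x i ^ 2) + b' t i * G t x i)
      (Measure.pi μ) := fun i => ((j3 i).const_mul (c' t i * c t i)).add ((j2 i).const_mul (b' t i))
  change _ = ∫ x, ∑ i, (c' t i * c t i * (1 - G t x i ^ 2) + b' t i * G t x i) ∂Measure.pi μ
  rw [integral_finsetSum _ fun i _ => j4 i, integral_finsetSum _ fun i _ => j5 i]
  refine Finset.sum_congr rfl fun i _ => ?_
  rw [integral_add ((j3 i).const_mul _) ((j2 i).const_mul _)]
  have e : ∀ x, (c' t i * x i + b' t i) * G t x i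
      = c' t i * (x i * G t x i) + b' t i * G t x i := fun x => by ring
  simp only [e]
  rw [integral_add ((j1 i).const_mul _) ((j2 i).const_mul _)]
  congr 1
  rw [integral_const_mul, integral_const_mul]
  -- A coordinate whose gain is momentarily constant needs no integration by parts, so its law may
  -- be non-Gaussian; the edge signs are of this kind.
  by_cases h0 : c' t i = 0
  · simp [h0]
  · have := integral_mul_gibbs hW hs hμ (c t) (b t) (hγ t i h0)
    rw [integral_const_mul] at this
    rw [this]
    ring

/-! ### The Nishimori identity -/

/-- On boxes the integral of the product density factorises by independence of the coordinates. -/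
theorem pi_withDensity (ν : ι → Measure ℝ) [∀ i, IsProbabilityMeasure (ν i)]
    {f : ι → ℝ → ENNReal} (hf : ∀ i, Measurable (f i))
    [∀ i, SigmaFinite ((ν i).withDensity (f i))] :
    Measure.pi (fun i => (ν i).withDensity (f i))
      = (Measure.pi ν).withDensity (fun x => ∏ i, f i (x i)) := by
  refine Measure.pi_eq fun S hS => ?_
  rw [withDensity_apply _ (MeasurableSet.univ_pi hS),
    ← lintegral_indicator (MeasurableSet.univ_pi hS)]
  have e : (Set.univ.pi S).indicator (fun x : ι → ℝ => ∏ i, f i (x i))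
      = fun x => ∏ i, (S i).indicator (f i) (x i) := by
    classical
    ext x
    by_cases h : x ∈ Set.univ.pi S
    · rw [Set.indicator_of_mem h]
      exact Finset.prod_congr rfl fun i _ => (Set.indicator_of_mem (h i trivial) _).symm
    · rw [Set.indicator_of_notMem h]
      simp only [Set.mem_univ_pi, not_forall] at h
      obtain ⟨i, hi⟩ := h
      exact (Finset.prod_eq_zero (Finset.mem_univ i) (Set.indicator_of_notMem hi _)).symm
  have hm : ∀ i, Measurable ((S i).indicator (f i)) := fun i => (hf i).indicator (hS i)
  rw [e, lintegral_prod_eq_prod_lintegral_of_indepFun Finset.univ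
    (fun i (x : ι → ℝ) => (S i).indicator (f i) (x i))
    (iIndepFun_pi fun i => (hm i).aemeasurable) fun i => (hm i).comp (measurable_pi_apply i)]
  refine Finset.prod_congr rfl fun i _ => ?_
  have := (measurePreserving_eval ν i).lintegral_comp (hm i)
  simp only [Function.eval] at this
  rw [this, lintegral_indicator (hS i), withDensity_apply _ (hS i)]

variable [Group Ω]

/-- The law of a field which is the log-likelihood ratio of a sign. -/
def IsSymmetricChannel (ν : Measure ℝ) : Prop :=
  ν.map (fun y => -y) = ν.withDensity fun y => ENNReal.ofReal (Real.exp (-2 * y))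

theorem IsSymmetricChannel.map_mul {ν : Measure ℝ} (hν : IsSymmetricChannel ν) {a : ℝ}
    (ha : a ^ 2 = 1) :
    ν.map (fun y => a * y) = ν.withDensity fun y => ENNReal.ofReal (Real.exp ((a - 1) * y)) := by
  rcases sq_eq_one_iff.1 ha with rfl | rfl
  · simp
  · have e : (-1 : ℝ) - 1 = -2 := by norm_num
    rw [IsSymmetricChannel] at hν
    simpa only [e, neg_mul, one_mul] using hν

/-- Multiplying field `i` by the sign `s_i(σ)` produces the density `exp ((s_i(σ) - 1) h_i)`, by
symmetry of the channel. The product over `i` is the likelihood ratio of `σ` against the truth `1`.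
-/
theorem integral_gauge {ν : ι → Measure ℝ} [∀ i, IsProbabilityMeasure (ν i)]
    (hν : ∀ i, IsSymmetricChannel (ν i)) (hs : ∀ i θ, s i θ ^ 2 = 1) (hs1 : ∀ i, s i 1 = 1) (σ : Ω)
    {F : (ι → ℝ) → ℝ} (hF : Measurable F) :
    ∫ h, F (fun i => s i σ * h i) ∂Measure.pi ν
      = ∫ h, Real.exp (spinField s h σ - spinField s h 1) * F h ∂Measure.pi ν := by
  have hp : ∀ i, IsProbabilityMeasure ((ν i).map fun y => s i σ * y) := fun i =>
    Measure.isProbabilityMeasure_map (by fun_prop)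
  have hp' : ∀ i, IsProbabilityMeasure
      ((ν i).withDensity fun y => ENNReal.ofReal (Real.exp ((s i σ - 1) * y))) := fun i =>
    (hν i).map_mul (hs i σ) ▸ hp i
  have hmap : (Measure.pi ν).map (fun h i => s i σ * h i)
      = (Measure.pi ν).withDensity
        (fun h => ENNReal.ofReal (Real.exp (spinField s h σ - spinField s h 1))) := by
    rw [Measure.pi_map_pi (f := fun i y => s i σ * y) fun i => by fun_prop]
    simp only [fun i => (hν i).map_mul (hs i σ)]
    rw [pi_withDensity ν fun i => by fun_prop]
    congr 1
    ext h
    rw [← ENNReal.ofReal_prod_of_nonneg fun i _ => (Real.exp_pos _).le, ← Real.exp_sum]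
    congr 2
    simp only [spinField, hs1, ← Finset.sum_sub_distrib]
    exact Finset.sum_congr rfl fun i _ => by ring
  have h1 := integral_map (μ := Measure.pi ν) (φ := fun h i => s i σ * h i)
    (Measurable.aemeasurable (by fun_prop))
    (f := F) hF.aestronglyMeasurable
  rw [← h1, hmap, integral_withDensity_eq_integral_toReal_smul (by unfold spinField; fun_prop)
    (ae_of_all _ fun _ => ENNReal.ofReal_lt_top)]
  simp only [ENNReal.toReal_ofReal (Real.exp_pos _).le, smul_eq_mul]

theorem spinField_gauge (hmul : ∀ i θ θ', s i (θ * θ') = s i θ * s i θ') (h : ι → ℝ) (σ θ : Ω) :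
    spinField s (fun i => s i σ * h i) θ = spinField s h (σ * θ) := by
  simp only [spinField, hmul]
  exact Finset.sum_congr rfl fun i _ => by ring

/-- The Nishimori identity for the averages of characters. -/
theorem integral_gibbs_sq (hs : ∀ i θ, s i θ ^ 2 = 1)
    (hmul : ∀ i θ θ', s i (θ * θ') = s i θ * s i θ') {w : ℝ} (hw : 0 < w)
    (hν : ∀ i, IsSymmetricChannel ((μ i).map fun x => c i * x + b i)) (j : ι) :
    ∫ x, gibbs (fun _ => w) (spinField s fun i => c i * x i + b i) (s j) ^ 2 ∂Measure.pi μ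
      = ∫ x, gibbs (fun _ => w) (spinField s fun i => c i * x i + b i) (s j) ∂Measure.pi μ := by
  have hW : IsWeight (fun _ : Ω => w) := isWeight_const hw
  have hs1 : ∀ i, s i 1 = 1 := fun i => by
    have h1 := hmul i 1 1
    have h2 := hs i 1
    rw [mul_one] at h1
    rw [h1, ← sq, h2]
  set ν : ι → Measure ℝ := fun i => (μ i).map fun x => c i * x + b i with hν_def
  have hp : ∀ i, IsProbabilityMeasure (ν i) := fun i =>
    Measure.isProbabilityMeasure_map (by fun_prop)
  have hmap : (Measure.pi μ).map (fun x i => c i * x i + b i) = Measure.pi ν :=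
    Measure.pi_map_pi (f := fun i x => c i * x + b i) fun i => by fun_prop
  have hc0 : ∀ θ, Continuous fun h : ι → ℝ => spinField s h θ := fun θ => by
    unfold spinField; fun_prop
  set G : (ι → ℝ) → ℝ := fun h => gibbs (fun _ => w) (spinField s h) (s j) with hG
  have hGc : Continuous G := hW.continuous_gibbs hc0 _
  have hG1 : ∀ h, |G h| ≤ 1 := fun h => hW.abs_gibbs_le fun θ => abs_le_one_of_sq_eq_one (hs j θ)
  set Z : (ι → ℝ) → ℝ := fun h => partitionSum (fun _ => w) (spinField s h) with hZ
  have hZpos : ∀ h, 0 < Z h := fun h => hW.partitionSum_pos _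
  have hZc : Continuous Z := by
    simp only [hZ, partitionSum]
    fun_prop
  have hZg : ∀ h σ, Z (fun i => s i σ * h i) = Z h := fun h σ => by
    simp only [hZ, partitionSum, spinField_gauge hmul]
    exact Fintype.sum_equiv (Equiv.mulLeft σ) _ _ fun θ => rfl
  have hGg : ∀ h σ, G (fun i => s i σ * h i) = s j σ * G h := fun h σ => by
    have := hZg h σ
    simp only [hZ] at this
    simp only [hG, gibbs, this, spinField_gauge hmul, mul_div_assoc', Finset.mul_sum]
    congr 1
    refine Fintype.sum_equiv (Equiv.mulLeft σ) _ _ fun θ => ?_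
    simp only [Equiv.coe_mulLeft, hmul]
    have := hs j σ
    linear_combination (-(w * Real.exp (spinField s h (σ * θ)) * s j θ)) * this
  -- The gauge change is applied to the posterior weight of `1` times `⟨s_j⟩`: it turns the former
  -- into the weight of `σ` and multiplies the latter by `s_j(σ)`.
  have key : ∀ σ, ∫ h, Real.exp (spinField s h σ) / Z h * (s j σ * G h) ∂Measure.pi ν
      = ∫ h, Real.exp (spinField s h σ) / Z h * G h ∂Measure.pi ν := by
    intro σ
    have := integral_gauge (F := fun h => Real.exp (spinField s h 1) / Z h * G h) hν hs hs1 σ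
      ((Continuous.div (by fun_prop) hZc fun h => (hZpos h).ne').mul hGc).measurable
    simp only [hZg, hGg, spinField_gauge hmul, mul_one] at this
    rw [this]
    refine integral_congr_ae (ae_of_all _ fun h => ?_)
    simp only [Real.exp_sub]
    field_simp
  have hint : ∀ σ (a : ℝ), Integrable (fun h => Real.exp (spinField s h σ) / Z h * (a * G h))
      (Measure.pi ν) := by
    intro σ a
    refine Integrable.mono' (integrable_const (w⁻¹ * |a|))
      (Continuous.aestronglyMeasurable ?_) (ae_of_all _ fun h => ?_)
    · exact (Continuous.div (by fun_prop) hZc fun h => (hZpos h).ne').mul (by fun_prop)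
    · rw [Real.norm_eq_abs, abs_mul, abs_mul]
      have h1 : |Real.exp (spinField s h σ) / Z h| ≤ w⁻¹ := by
        rw [abs_of_pos (div_pos (Real.exp_pos _) (hZpos h)), div_le_iff₀ (hZpos h),
          ← div_eq_inv_mul, le_div_iff₀ hw, mul_comm]
        exact Finset.single_le_sum (f := fun θ => w * Real.exp (spinField s h θ))
          (fun θ _ => (mul_pos hw (Real.exp_pos _)).le) (Finset.mem_univ σ)
      have h2 : |a| * |G h| ≤ |a| := mul_le_of_le_one_right (abs_nonneg _) (hG1 h)
      exact mul_le_mul h1 h2 (by positivity) (by positivity)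
  -- One factor of `⟨s_j⟩²` is expanded over a posterior sample `σ`; in `e2` the total mass 1 of the
  -- posterior is inserted instead. Then `key` matches the two sums term by term.
  have e1 : ∀ h, G h ^ 2 = ∑ σ, w * (Real.exp (spinField s h σ) / Z h * (s j σ * G h)) := by
    intro h
    have : G h = ∑ σ, w * (Real.exp (spinField s h σ) / Z h) * s j σ := by
      simp only [hG, gibbs, Finset.sum_div]
      exact Finset.sum_congr rfl fun σ _ => by simp only [hZ]; ring
    rw [sq]
    nth_rewrite 1 [this]
    rw [Finset.sum_mul]
    exact Finset.sum_congr rfl fun σ _ => by ring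
  have e2 : ∀ h, G h = ∑ σ, w * (Real.exp (spinField s h σ) / Z h * (1 * G h)) := by
    intro h
    have : ∑ σ, w * Real.exp (spinField s h σ) = Z h := rfl
    rw [← Finset.mul_sum, ← Finset.sum_mul, ← Finset.sum_div, ← mul_assoc, ← mul_div_assoc,
      Finset.mul_sum, this, div_self (hZpos h).ne']
    ring
  have t1 : ∫ x, G (fun i => c i * x i + b i) ^ 2 ∂Measure.pi μ = ∫ h, G h ^ 2 ∂Measure.pi ν := by
    rw [← hmap, integral_map (Measurable.aemeasurable (by fun_prop)) (by fun_prop)]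
  have t2 : ∫ x, G (fun i => c i * x i + b i) ∂Measure.pi μ = ∫ h, G h ∂Measure.pi ν := by
    rw [← hmap, integral_map (Measurable.aemeasurable (by fun_prop)) (by fun_prop)]
  change ∫ x, G (fun i => c i * x i + b i) ^ 2 ∂Measure.pi μ
    = ∫ x, G (fun i => c i * x i + b i) ∂Measure.pi μ
  rw [t1, t2, integral_congr_ae (ae_of_all _ e1), integral_congr_ae (ae_of_all _ e2),
    integral_finsetSum _ fun σ _ => (hint σ _).const_mul w,
    integral_finsetSum _ fun σ _ => (hint σ _).const_mul w]
  refine Finset.sum_congr rfl fun σ _ => ?_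
  rw [integral_const_mul, integral_const_mul, key]
  simp only [one_mul]

end FreeEnergy

/-! ### Symmetry of the Gaussian and the sign channel -/

/-- The law is `N(r², r²)`, whose log-density changes by `-2y` from `y` to `-y`; this ties the mean
`r²` to the gain `r`. For `r = 0` it is the point mass at 0. -/
theorem isSymmetricChannel_gaussianReal (r : ℝ) :
    IsSymmetricChannel ((gaussianReal 0 1).map fun x => r * x + r ^ 2) := by
  have h1 : (gaussianReal 0 1).map (fun x => r * x + r ^ 2)
      = gaussianReal (r ^ 2) (NNReal.mk (r ^ 2) (sq_nonneg r)) := by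
    have : (fun x : ℝ => r * x + r ^ 2) = (fun x => x + r ^ 2) ∘ (fun x => r * x) := rfl
    rw [this, ← Measure.map_map (by fun_prop) (by fun_prop), gaussianReal_map_const_mul,
      gaussianReal_map_add_const]
    simp
  rw [h1, IsSymmetricChannel, gaussianReal_map_neg]
  by_cases hr : r = 0
  · subst hr
    have : NNReal.mk (0 ^ 2) (sq_nonneg (0 : ℝ)) = 0 := by ext; simp
    rw [this, gaussianReal_zero_var, gaussianReal_zero_var]
    ext S hS
    rw [withDensity_apply _ hS, ← lintegral_indicator hS, lintegral_dirac' _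
      (Measurable.indicator (by fun_prop) hS)]
    by_cases h0 : (0 : ℝ) ∈ S <;> simp [hS, h0]
  · have hv : NNReal.mk (r ^ 2) (sq_nonneg r) ≠ 0 := by
      intro h
      have := congrArg NNReal.toReal h
      simp [hr] at this
    rw [gaussianReal_of_var_ne_zero _ hv, gaussianReal_of_var_ne_zero _ hv,
      ← withDensity_mul _ (measurable_gaussianPDF _ _) (by fun_prop)]
    congr 1
    ext y
    simp only [gaussianPDF, Pi.mul_apply]
    rw [← ENNReal.ofReal_mul (gaussianPDFReal_nonneg _ _ _)]
    congr 1
    simp only [gaussianPDFReal, mul_assoc, ← Real.exp_add]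
    congr 2
    change -(y - -r ^ 2) ^ 2 / (2 * r ^ 2) = -(y - r ^ 2) ^ 2 / (2 * r ^ 2) + -2 * y
    field_simp
    ring

/-- The law on `{1, -1} ⊆ ℝ` of the sign of an edge. -/
def signMeasure (δ : ℝ) : Measure ℝ :=
  ENNReal.ofReal (1 - flipProb δ) • Measure.dirac 1 + ENNReal.ofReal (flipProb δ) • Measure.dirac (-1)

theorem flipProb_pos {δ : ℝ} (h1 : δ < 1) : 0 < flipProb δ := by
  unfold flipProb; linarith

theorem flipProb_lt_one {δ : ℝ} (h0 : 0 ≤ δ) : flipProb δ < 1 := by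
  unfold flipProb; linarith

theorem isProbabilityMeasure_signMeasure {δ : ℝ} (h0 : 0 ≤ δ) (h1 : δ < 1) :
    IsProbabilityMeasure (signMeasure δ) := by
  constructor
  have := flipProb_pos h1
  have := flipProb_lt_one h0
  simp only [signMeasure, Measure.coe_add, Measure.coe_smul, Pi.add_apply, Pi.smul_apply,
    measure_univ, smul_eq_mul, mul_one]
  rw [← ENNReal.ofReal_add (by linarith) (by linarith)]
  simp

/-- The points `β` and `-β` carry masses `1 - p` and `p`, which the factor `exp (-2β) = p / (1 - p)`
and its inverse exchange. This is where the value of `β` matters. -/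
theorem isSymmetricChannel_signMeasure {δ : ℝ} (h0 : 0 ≤ δ) (h1 : δ < 1) :
    IsSymmetricChannel ((signMeasure δ).map fun x => invTemp δ * x + 0) := by
  have hp := flipProb_pos h1
  have hq := flipProb_lt_one h0
  have hd : ∀ (a : ℝ) (f : ℝ → ENNReal), Measurable f →
      (Measure.dirac a).withDensity f = f a • Measure.dirac a := by
    intro a f hf
    ext S hS
    rw [withDensity_apply _ hS, ← lintegral_indicator hS, lintegral_dirac' _
      (hf.indicator hS)]
    by_cases h : a ∈ S <;> simp [hS, h]
  have e1 : Real.exp (-2 * invTemp δ) = flipProb δ / (1 - flipProb δ) := by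
    have : -2 * invTemp δ = Real.log (flipProb δ / (1 - flipProb δ)) := by
      rw [invTemp, Real.log_div (by linarith) hp.ne', Real.log_div hp.ne' (by linarith)]
      ring
    rw [this, Real.exp_log (div_pos hp (by linarith))]
  have e2 : Real.exp (2 * invTemp δ) = (1 - flipProb δ) / flipProb δ := by
    have := congrArg (·⁻¹) e1
    simp only [← Real.exp_neg, inv_div] at this
    rw [← this]
    ring_nf
  have hm : Measurable fun y : ℝ => ENNReal.ofReal (Real.exp (-2 * y)) := by fun_prop
  simp only [IsSymmetricChannel, signMeasure, add_zero]
  rw [Measure.map_map (by fun_prop) (by fun_prop), Measure.map_add _ _ (by fun_prop),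
    Measure.map_add _ _ (by fun_prop)]
  simp only [Measure.map_smul]
  rw [Measure.map_dirac' (by fun_prop), Measure.map_dirac' (by fun_prop),
    Measure.map_dirac' (by fun_prop), Measure.map_dirac' (by fun_prop), withDensity_add_measure,
    withDensity_smul_measure, withDensity_smul_measure, hd _ _ hm, hd _ _ hm, smul_smul, smul_smul]
  simp only [Function.comp, mul_one, mul_neg, neg_neg]
  rw [← ENNReal.ofReal_mul (by linarith), ← ENNReal.ofReal_mul hp.le, add_comm]
  have a1 : (1 - flipProb δ) * Real.exp (-(2 * invTemp δ)) = flipProb δ := by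
    have : 1 - flipProb δ ≠ 0 := by linarith
    rw [← neg_mul, e1]; field_simp
  have a2 : flipProb δ * Real.exp (2 * invTemp δ) = 1 - flipProb δ := by
    rw [e2]; field_simp
  simp only [neg_mul, neg_neg, a1, a2]

end LatticeSync
end

noncomputable section

namespace LatticeSync

/-! ### Gauge fixing -/

section GaugeFixing

open Classical

variable {V : Type} [Fintype V]

theorem abs_eq_one_of_sq_eq_one {a : ℝ} (h : a ^ 2 = 1) : |a| = 1 := by
  rcases sq_eq_one_iff.1 h with rfl | rfl <;> simp

theorem pairSpin_mk (θ : V → ℤˣ) (u v : V) :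
    pairSpin θ s(u, v) = ((θ u : ℤ) : ℝ) * ((θ v : ℤ) : ℝ) := rfl

theorem intUnit_sq (a : ℤˣ) : (((a : ℤ) : ℝ)) ^ 2 = 1 := by
  rcases Int.units_eq_one_or a with rfl | rfl <;> simp

theorem pairSpin_mul (θ θ' : V → ℤˣ) (e : Sym2 V) :
    pairSpin (θ * θ') e = pairSpin θ e * pairSpin θ' e := by
  induction e using Sym2.inductionOn with
  | hf u v =>
    simp only [pairSpin_mk, Pi.mul_apply, Units.val_mul, Int.cast_mul]
    ring

theorem pairSpin_sq (θ : V → ℤˣ) (e : Sym2 V) : pairSpin θ e ^ 2 = 1 := by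
  induction e using Sym2.inductionOn with
  | hf u v => rw [pairSpin_mk, mul_pow, intUnit_sq, intUnit_sq, one_mul]

/-- The laws of the noise: signs for the edges, Gaussian variables for the side information. -/
def noiseLaw (E ι : Type) (δ : ℝ) : E ⊕ ι → Measure ℝ :=
  Sum.elim (fun _ => signMeasure δ) (fun _ => gaussianReal 0 1)

variable {ι : Type} [Fintype ι]

/-- The products of spins observed on the lattice and as side information. -/
def obsSpin (G : SimpleGraph V) (s : ι → (V → ℤˣ) → ℝ) : G.edgeSet ⊕ ι → (V → ℤˣ) → ℝ :=
  Sum.elim (fun e θ => pairSpin θ e.1) s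

/-- The gains of the noise in the fields. -/
def obsGain (E : Type) (δ : ℝ) (r : ι → ℝ) : E ⊕ ι → ℝ := Sum.elim (fun _ => invTemp δ) r

/-- The means of the fields of the side information. -/
def obsMean (E : Type) (r : ι → ℝ) : E ⊕ ι → ℝ := Sum.elim (fun _ => 0) (fun i => r i ^ 2)

/-- The free energy, when the spins `θ₀` are all `1`, of the lattice observations and of the
observations `r_i s_i(θ₀) + z_i`. -/
def modelEnergy (G : SimpleGraph V) (δ : ℝ) (W : (V → ℤˣ) → ℝ) (s : ι → (V → ℤˣ) → ℝ)
    (r : ι → ℝ) : ℝ :=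
  meanLogSum (noiseLaw G.edgeSet ι δ) W (obsSpin G s) (obsGain G.edgeSet δ r)
    (obsMean G.edgeSet r) - ∑ i, r i ^ 2 / 2

theorem isProbabilityMeasure_noiseLaw (E ι : Type) {δ : ℝ} (h0 : 0 ≤ δ) (h1 : δ < 1) (i : E ⊕ ι) :
    IsProbabilityMeasure (noiseLaw E ι δ i) := by
  have := isProbabilityMeasure_signMeasure h0 h1
  rcases i with e | i
  · exact this
  · exact inferInstanceAs (IsProbabilityMeasure (gaussianReal 0 1))

theorem memLp_signMeasure (δ : ℝ) : MemLp id 2 (signMeasure δ) := by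
  have hfin : IsFiniteMeasure (signMeasure δ) := by
    have h1 := Measure.smul_finite (Measure.dirac (1 : ℝ))
      (ENNReal.ofReal_ne_top (r := 1 - flipProb δ))
    have h2 := Measure.smul_finite (Measure.dirac (-1 : ℝ)) (ENNReal.ofReal_ne_top (r := flipProb δ))
    unfold signMeasure
    infer_instance
  refine MemLp.of_bound (by fun_prop) 1 ?_
  rw [signMeasure, ae_add_measure_iff]
  constructor
  · refine Measure.ae_smul_measure ?_ _
    rw [ae_dirac_eq]; simp
  · refine Measure.ae_smul_measure ?_ _
    rw [ae_dirac_eq]; simp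

theorem memLp_noiseLaw (E ι : Type) (δ : ℝ) (i : E ⊕ ι) : MemLp id 2 (noiseLaw E ι δ i) := by
  rcases i with e | i
  · exact memLp_signMeasure δ
  · exact memLp_id_gaussianReal 2

theorem integral_signMeasure {δ : ℝ} (h0 : 0 ≤ δ) (h1 : δ < 1) (f : ℝ → ℝ) :
    ∫ y, f y ∂signMeasure δ = (1 - flipProb δ) * f 1 + flipProb δ * f (-1) := by
  have hp := flipProb_pos h1
  have hq := flipProb_lt_one h0
  rw [signMeasure, integral_add_measure, integral_smul_measure, integral_smul_measure,
    integral_dirac, integral_dirac, ENNReal.toReal_ofReal (by linarith),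
    ENNReal.toReal_ofReal hp.le, smul_eq_mul, smul_eq_mul]
  · exact (integrable_dirac (by simp)).smul_measure (by simp)
  · exact (integrable_dirac (by simp)).smul_measure (by simp)

theorem integral_sq_noiseLaw (E ι : Type) {δ : ℝ} (h0 : 0 ≤ δ) (h1 : δ < 1) (i : E ⊕ ι) :
    ∫ y, y ^ 2 ∂noiseLaw E ι δ i = 1 := by
  rcases i with e | i
  · change ∫ y, y ^ 2 ∂signMeasure δ = 1
    rw [integral_signMeasure h0 h1]
    ring
  · change ∫ y, y ^ 2 ∂gaussianReal 0 1 = 1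
    have h := variance_fun_id_gaussianReal (μ := 0) (v := 1)
    rw [variance_of_integral_eq_zero (by fun_prop) integral_id_gaussianReal] at h
    simpa using h

theorem integral_abs_noiseLaw_le (E ι : Type) {δ : ℝ} (h0 : 0 ≤ δ) (h1 : δ < 1) (i : E ⊕ ι) :
    ∫ y, |y| ∂noiseLaw E ι δ i ≤ 1 := by
  have := isProbabilityMeasure_noiseLaw E ι h0 h1 i
  have h := sq_integral_le_integral_sq (memLp_noiseLaw E ι δ i).norm
  simp only [id, Real.norm_eq_abs, sq_abs, integral_sq_noiseLaw E ι h0 h1 i] at h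
  exact (abs_le_one_iff_mul_self_le_one.2 (by rwa [← sq])).trans' (le_abs_self _)

/-- The law of the sign of an edge, on `ℤˣ`. -/
def unitMeasure (δ : ℝ) : Measure ℤˣ :=
  ENNReal.ofReal (1 - flipProb δ) • Measure.dirac 1 + ENNReal.ofReal (flipProb δ) • Measure.dirac (-1)

instance : MeasurableSingletonClass ℤˣ :=
  ⟨fun a => ⟨{(a : ℤ)}, measurableSet_singleton _, by ext; simp [Units.ext_iff]⟩⟩

theorem measurable_of_units {β : Type*} [MeasurableSpace β] (f : ℤˣ → β) : Measurable f := by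
  intro S _
  exact (Set.toFinite _).measurableSet

theorem map_unitMeasure (δ : ℝ) :
    (unitMeasure δ).map (fun a : ℤˣ => ((a : ℤ) : ℝ)) = signMeasure δ := by
  have hm := measurable_of_units fun a : ℤˣ => ((a : ℤ) : ℝ)
  rw [unitMeasure, Measure.map_add _ _ hm, Measure.map_smul, Measure.map_smul,
    Measure.map_dirac' hm, Measure.map_dirac' hm, signMeasure]
  simp

theorem unitMeasure_singleton (δ : ℝ) (a : ℤˣ) :
    unitMeasure δ {a} = ENNReal.ofReal (flipWeight δ a) := by
  rcases Int.units_eq_one_or a with rfl | rfl <;> simp [unitMeasure, flipWeight]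

theorem isProbabilityMeasure_unitMeasure {δ : ℝ} (h0 : 0 ≤ δ) (h1 : δ < 1) :
    IsProbabilityMeasure (unitMeasure δ) := by
  constructor
  have := flipProb_pos h1
  have := flipProb_lt_one h0
  simp only [unitMeasure, Measure.coe_add, Measure.coe_smul, Pi.add_apply, Pi.smul_apply,
    measure_univ, smul_eq_mul, mul_one]
  rw [← ENNReal.ofReal_add (by linarith) (by linarith)]
  simp

theorem flipWeight_nonneg {δ : ℝ} (h0 : 0 ≤ δ) (h1 : δ < 1) (a : ℤˣ) : 0 ≤ flipWeight δ a := by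
  have := flipProb_pos h1
  have := flipProb_lt_one h0
  unfold flipWeight
  split_ifs <;> linarith

/-- The law is the image of a product law on the finite type `E → ℤˣ`, where an integral is a sum
over points. -/
theorem integral_pi_signMeasure {E : Type} [Fintype E] [DecidableEq E] {δ : ℝ} (h0 : 0 ≤ δ) (h1 : δ < 1)
    {g : (E → ℝ) → ℝ} (hg : AEStronglyMeasurable g (Measure.pi fun _ => signMeasure δ)) :
    ∫ x, g x ∂(Measure.pi fun _ : E => signMeasure δ)
      = ∑ ξ : E → ℤˣ, (∏ e, flipWeight δ (ξ e)) * g fun e => ((ξ e : ℤ) : ℝ) := by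
  have hu := isProbabilityMeasure_unitMeasure h0 h1
  have hsg := isProbabilityMeasure_signMeasure h0 h1
  have hm := measurable_of_units fun a : ℤˣ => ((a : ℤ) : ℝ)
  have hmap : (Measure.pi fun _ : E => unitMeasure δ).map (fun ξ e => ((ξ e : ℤ) : ℝ))
      = Measure.pi fun _ : E => signMeasure δ := by
    have hsf : ∀ _ : E, SigmaFinite ((unitMeasure δ).map fun a : ℤˣ => ((a : ℤ) : ℝ)) :=
      fun _ => by rw [map_unitMeasure]; infer_instance
    rw [Measure.pi_map_pi (f := fun _ (a : ℤˣ) => ((a : ℤ) : ℝ)) fun _ => hm.aemeasurable]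
    simp only [map_unitMeasure]
  rw [← hmap] at hg ⊢
  rw [integral_map (φ := fun (ξ : E → ℤˣ) e => ((ξ e : ℤ) : ℝ)) (Measurable.aemeasurable
    (measurable_pi_iff.2 fun e => hm.comp (measurable_pi_apply e))) hg, integral_fintype .of_finite]
  refine Finset.sum_congr rfl fun ξ _ => ?_
  rw [smul_eq_mul, Measure.real, Measure.pi_singleton, ENNReal.toReal_prod]
  simp only [unitMeasure_singleton, ENNReal.toReal_ofReal (flipWeight_nonneg h0 h1 _)]

theorem integral_pi_noiseLaw {E : Type} [Fintype E] [DecidableEq E] {δ : ℝ} (h0 : 0 ≤ δ) (h1 : δ < 1)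
    {Φ : (E ⊕ ι → ℝ) → ℝ} (hΦ : Integrable Φ (Measure.pi (noiseLaw E ι δ))) :
    ∫ x, Φ x ∂Measure.pi (noiseLaw E ι δ)
      = ∑ ξ : E → ℤˣ, (∏ e, flipWeight δ (ξ e)) *
        ∫ z, Φ (Sum.elim (fun e => ((ξ e : ℤ) : ℝ)) z)
          ∂Measure.pi fun _ : ι => gaussianReal 0 1 := by
  have hsg := isProbabilityMeasure_signMeasure h0 h1
  have hp := isProbabilityMeasure_noiseLaw E ι h0 h1
  have hmp : MeasurePreserving (fun p : (E → ℝ) × (ι → ℝ) => (Sum.elim p.1 p.2 : E ⊕ ι → ℝ))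
      ((Measure.pi fun _ : E => signMeasure δ).prod (Measure.pi fun _ : ι => gaussianReal 0 1))
      (Measure.pi (noiseLaw E ι δ)) := by
    have := measurePreserving_sumPiEquivProdPi_symm (noiseLaw E ι δ)
    convert this using 1
    · ext p i
      rcases i with e | i <;> rfl
    · rfl
  have hi := hmp.integrable_comp_of_integrable hΦ
  have h2 : ∫ x, Φ x ∂Measure.pi (noiseLaw E ι δ) = ∫ p, (Φ ∘ fun p : (E → ℝ) × (ι → ℝ) =>
      (Sum.elim p.1 p.2 : E ⊕ ι → ℝ)) p
      ∂((Measure.pi fun _ : E => signMeasure δ).prod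
        (Measure.pi fun _ : ι => gaussianReal 0 1)) := by
    rw [← hmp.map_eq, integral_map hmp.measurable.aemeasurable (by rw [hmp.map_eq]; exact hΦ.1)]
    rfl
  rw [h2, integral_prod _ hi, integral_pi_signMeasure h0 h1 hi.integral_prod_left.1]
  rfl

theorem logSum_const_mul_left {Ω : Type*} [Fintype Ω] [Group Ω] (w : ℝ) (H : Ω → ℝ) (σ : Ω) :
    logSum (fun _ => w) (fun θ => H (σ * θ)) = logSum (fun _ => w) H := by
  unfold logSum partitionSum
  congr 1
  exact Fintype.sum_equiv (Equiv.mulLeft σ) _ _ fun θ => rfl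

theorem logPartition_eq_logSum (H : (V → ℤˣ) → ℝ) :
    logPartition H = logSum (fun _ => (2 ^ Fintype.card V)⁻¹) H := by
  rw [logPartition, logSum, partitionSum, Finset.mul_sum]

theorem obsSpin_sq (G : SimpleGraph V) {s : ι → (V → ℤˣ) → ℝ} (hs : ∀ i θ, s i θ ^ 2 = 1)
    (i : G.edgeSet ⊕ ι) (θ : V → ℤˣ) : obsSpin G s i θ ^ 2 = 1 := by
  rcases i with e | i
  · exact pairSpin_sq _ _
  · exact hs i θ

theorem obsSpin_mul (G : SimpleGraph V) {s : ι → (V → ℤˣ) → ℝ}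
    (hmul : ∀ i θ θ', s i (θ * θ') = s i θ * s i θ') (i : G.edgeSet ⊕ ι) (θ θ' : V → ℤˣ) :
    obsSpin G s i (θ * θ') = obsSpin G s i θ * obsSpin G s i θ' := by
  rcases i with e | i
  · exact pairSpin_mul _ _ _
  · exact hmul i θ θ'

theorem spinField_obs (G : SimpleGraph V) (δ : ℝ) (s : ι → (V → ℤˣ) → ℝ) (r : ι → ℝ)
    (x : G.edgeSet → ℝ) (z : ι → ℝ) (θ : V → ℤˣ) :
    spinField (obsSpin G s) (fun i => obsGain G.edgeSet δ r i * (Sum.elim x z : _ → ℝ) i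
        + obsMean G.edgeSet r i) θ
      = ∑ e : G.edgeSet, invTemp δ * x e * pairSpin θ e.1
        + ∑ i, (r i * z i + r i ^ 2) * s i θ := by
  simp [spinField, obsSpin, obsGain, obsMean, Fintype.sum_sum_type]

/-- Substituting `θ₀ θ` for `θ` cancels `θ₀` from the lattice term and from the means of the fields,
and leaves it only in the noise `s_i(θ₀) z_i`. This has the law of `z_i`, so every `θ₀` contributes
the same amount. -/
theorem expect_eq_modelEnergy (G : SimpleGraph V) {δ : ℝ} (h0 : 0 ≤ δ) (h1 : δ < 1)
    {s : ι → (V → ℤˣ) → ℝ} (hs : ∀ i θ, s i θ ^ 2 = 1)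
    (hmul : ∀ i θ θ', s i (θ * θ') = s i θ * s i θ') (r : ι → ℝ) :
    expect G δ (fun θ₀ ξ z => logPartition fun θ => edgeHamiltonian G δ (edgeObs G θ₀ ξ) θ
        + ∑ i, (r i * (r i * s i θ₀ + z i) * s i θ - r i ^ 2 / 2))
      = modelEnergy G δ (fun _ => (2 ^ Fintype.card V)⁻¹) s r := by
  have hW : IsWeight (fun _ : V → ℤˣ => ((2 : ℝ) ^ Fintype.card V)⁻¹) :=
    isWeight_const (by positivity)
  have hp := isProbabilityMeasure_noiseLaw G.edgeSet ι h0 h1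
  set Φ : (G.edgeSet ⊕ ι → ℝ) → ℝ := fun x => logSum (fun _ => (2 ^ Fintype.card V)⁻¹)
    (spinField (obsSpin G s) fun i => obsGain G.edgeSet δ r i * x i + obsMean G.edgeSet r i) with hΦ
  have hΦi : Integrable Φ (Measure.pi (noiseLaw G.edgeSet ι δ)) :=
    integrable_logSum hW (obsSpin_sq G hs) (memLp_noiseLaw _ _ δ) _ _
  have hΦc : Continuous Φ := hW.continuous_logSum (continuous_spinField _ _ _)
  have hpt : ∀ (θ₀ : V → ℤˣ) (ξ : G.edgeSet → ℤˣ) (z : ι → ℝ),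
      (logPartition fun θ => edgeHamiltonian G δ (edgeObs G θ₀ ξ) θ
        + ∑ i, (r i * (r i * s i θ₀ + z i) * s i θ - r i ^ 2 / 2))
      = Φ (Sum.elim (fun e => ((ξ e : ℤ) : ℝ)) fun i => s i θ₀ * z i) - ∑ i, r i ^ 2 / 2 := by
    intro θ₀ ξ z
    rw [logPartition_eq_logSum, ← logSum_const_mul_left _ _ θ₀, hΦ, sub_eq_add_neg,
      ← logSum_add_const hW]
    congr 1
    ext θ
    rw [spinField_obs, edgeHamiltonian, Finset.mul_sum, Finset.sum_sub_distrib, add_assoc,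
      ← sub_eq_add_neg]
    congr 1
    · refine Finset.sum_congr rfl fun e _ => ?_
      rw [edgeObs]
      rw [pairSpin_mul]
      linear_combination (invTemp δ * (ξ e : ℤ) * pairSpin θ e.1) * pairSpin_sq θ₀ e.1
    · congr 1
      refine Finset.sum_congr rfl fun i _ => ?_
      rw [hmul]
      linear_combination (r i ^ 2 * s i θ) * hs i θ₀
  have hgauge : ∀ (θ₀ : V → ℤˣ) (ξ : G.edgeSet → ℤˣ),
      ∫ z, Φ (Sum.elim (fun e => ((ξ e : ℤ) : ℝ)) fun i => s i θ₀ * z i)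
          ∂(Measure.pi fun _ : ι => gaussianReal 0 1)
        = ∫ z, Φ (Sum.elim (fun e => ((ξ e : ℤ) : ℝ)) z)
          ∂(Measure.pi fun _ : ι => gaussianReal 0 1) := by
    intro θ₀ ξ
    have hmp : MeasurePreserving (fun (z : ι → ℝ) i => s i θ₀ * z i)
        (Measure.pi fun _ : ι => gaussianReal 0 1) (Measure.pi fun _ : ι => gaussianReal 0 1) := by
      refine measurePreserving_pi _ _ (f := fun i y => s i θ₀ * y) fun i => ⟨by fun_prop, ?_⟩
      rw [gaussianReal_map_const_mul, mul_zero]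
      congr 1
      ext
      simp [hs]
    have hc : Continuous fun z : ι → ℝ => Φ (Sum.elim (fun e => ((ξ e : ℤ) : ℝ)) z) := by
      refine hΦc.comp (continuous_pi fun i => ?_)
      rcases i with e | i
      · exact continuous_const
      · exact continuous_apply i
    conv_rhs => rw [← hmp.map_eq]
    rw [integral_map hmp.measurable.aemeasurable hc.aestronglyMeasurable]
  have hsum1 : ∑ ξ : G.edgeSet → ℤˣ, ∏ e, flipWeight δ (ξ e) = 1 := by
    have hsg := isProbabilityMeasure_signMeasure h0 h1
    have := integral_pi_signMeasure (E := G.edgeSet) h0 h1 (g := fun _ => 1) (by fun_prop)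
    simpa using this.symm
  have hint : ∀ ξ : G.edgeSet → ℤˣ, Integrable (fun z : ι → ℝ =>
      Φ (Sum.elim (fun e => ((ξ e : ℤ) : ℝ)) z)) (Measure.pi fun _ : ι => gaussianReal 0 1) := by
    intro ξ
    have hl : CoordLip (fun i => |r i|)
        (fun z : ι → ℝ => Φ (Sum.elim (fun e => ((ξ e : ℤ) : ℝ)) z)) := by
      intro j x y
      have := coordLip_logSum hW (obsSpin_sq G hs) (obsGain G.edgeSet δ r) (obsMean G.edgeSet r)
        (Sum.inr j) (Sum.elim (fun e => ((ξ e : ℤ) : ℝ)) x) y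
      simp only [Sum.update_elim_inr, Sum.elim_inr, obsGain] at this
      exact this
    exact hl.integrable fun _ => memLp_id_gaussianReal 2
  have hin : ∀ (θ₀ : V → ℤˣ), ∑ ξ : G.edgeSet → ℤˣ, (∏ e, flipWeight δ (ξ e)) *
      ∫ z, (logPartition fun θ => edgeHamiltonian G δ (edgeObs G θ₀ ξ) θ
        + ∑ i, (r i * (r i * s i θ₀ + z i) * s i θ - r i ^ 2 / 2))
        ∂(Measure.pi fun _ : ι => gaussianReal 0 1)
      = modelEnergy G δ (fun _ => (2 ^ Fintype.card V)⁻¹) s r := by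
    intro θ₀
    rw [modelEnergy, meanLogSum, integral_pi_noiseLaw h0 h1 hΦi]
    have hK : ∑ i, r i ^ 2 / 2
        = ∑ ξ : G.edgeSet → ℤˣ, (∏ e, flipWeight δ (ξ e)) * ∑ i, r i ^ 2 / 2 := by
      rw [← Finset.sum_mul, hsum1, one_mul]
    conv_rhs => rw [hK, ← Finset.sum_sub_distrib]
    refine Finset.sum_congr rfl fun ξ _ => ?_
    rw [← mul_sub]
    congr 1
    simp only [hpt]
    rw [integral_sub, hgauge]
    · simp
    · have hl : CoordLip (fun i => |r i|) (fun z : ι → ℝ =>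
          Φ (Sum.elim (fun e => ((ξ e : ℤ) : ℝ)) fun i => s i θ₀ * z i)) := by
        intro j x y
        have := coordLip_logSum hW (obsSpin_sq G hs) (obsGain G.edgeSet δ r)
          (obsMean G.edgeSet r) (Sum.inr j)
          (Sum.elim (fun e => ((ξ e : ℤ) : ℝ)) fun i => s i θ₀ * x i) (s j θ₀ * y)
        have e : (fun i => s i θ₀ * Function.update x j y i)
            = Function.update (fun i => s i θ₀ * x i) j (s j θ₀ * y) := by
          ext i
          by_cases h : i = j
          · subst h; simp
          · simp [h]
        have e2 : |s j θ₀ * y - s j θ₀ * x j| = |y - x j| := by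
          rw [← mul_sub, abs_mul, abs_eq_one_of_sq_eq_one (hs j θ₀), one_mul]
        simp only [Sum.update_elim_inr, Sum.elim_inr, obsGain, e2] at this
        simp only [e]
        exact this
      exact hl.integrable fun _ => memLp_id_gaussianReal 2
    · exact integrable_const _
  have hcard : ∑ _θ₀ : V → ℤˣ, ((2 : ℝ) ^ Fintype.card V)⁻¹ = 1 := by
    simp [Finset.card_univ]
  unfold expect
  simp only [hin]
  rw [← Finset.sum_mul, hcard, one_mul]

end GaugeFixing

end LatticeSync
end

noncomputable section

namespace LatticeSync

/-! ### Marginals of product measures -/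

/-- It suffices to compare cylinders. A cylinder over `J` pulls back to the cylinder over its image
under `g`, unrestricted at the other coordinates. -/
theorem infinitePi_map_comp {I J : Type*} (μ : I → Measure ℝ) [∀ i, IsProbabilityMeasure (μ i)]
    {g : J → I} (hg : Function.Injective g) :
    (Measure.infinitePi μ).map (fun x j => x (g j)) = Measure.infinitePi fun j => μ (g j) := by
  classical
  refine Measure.eq_infinitePi _ fun s t ht => ?_
  have hm : Measurable fun (x : I → ℝ) j => x (g j) := by fun_prop
  rw [Measure.map_apply hm (MeasurableSet.pi s.countable_toSet fun j _ => ht j)]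
  have e : (fun (x : I → ℝ) j => x (g j)) ⁻¹' ((s : Set J).pi t)
      = ((s.map ⟨g, hg⟩ : Finset I) : Set I).pi (Function.extend g t fun _ => Set.univ) := by
    ext x
    simp [Set.mem_pi, hg.extend_apply]
  rw [e, Measure.infinitePi_pi, Finset.prod_map]
  · simp [hg.extend_apply]
  · intro i hi
    obtain ⟨j, _, rfl⟩ := Finset.mem_map.1 hi
    simpa [hg.extend_apply] using ht j

theorem pi_map_comp {I J : Type*} [Fintype I] [Fintype J] (μ : I → Measure ℝ)
    [∀ i, IsProbabilityMeasure (μ i)] {g : J → I} (hg : Function.Injective g) :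
    (Measure.pi μ).map (fun x j => x (g j)) = Measure.pi fun j => μ (g j) := by
  rw [← Measure.infinitePi_eq_pi, ← Measure.infinitePi_eq_pi, infinitePi_map_comp μ hg]

theorem sum_eq_sum_comp {I J : Type*} [Fintype I] [Fintype J] {g : J → I}
    (hg : Function.Injective g) {f : I → ℝ} (hf : ∀ i ∉ Set.range g, f i = 0) :
    ∑ i, f i = ∑ j, f (g j) := by
  classical
  have hmap := Finset.sum_map Finset.univ ⟨g, hg⟩ f
  simp only [Function.Embedding.coeFn_mk] at hmap
  rw [← hmap]
  refine (Finset.sum_subset (Finset.subset_univ _) fun i _ hi => hf i ?_).symm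
  simpa using hi

/-- A field that vanishes identically does not enter the Hamiltonian, and its noise integrates out.
In this way one whole kind of side information disappears at either end of the interpolation. -/
theorem meanLogSum_comp {Ω I J : Type*} [Fintype Ω] [Fintype I] [Fintype J] {μ : I → Measure ℝ}
    [∀ i, IsProbabilityMeasure (μ i)] {W : Ω → ℝ} (hW : IsWeight W) {s : I → Ω → ℝ} {c b : I → ℝ}
    {g : J → I} (hg : Function.Injective g) (hc : ∀ i ∉ Set.range g, c i = 0)
    (hb : ∀ i ∉ Set.range g, b i = 0) :
    meanLogSum μ W s c b = meanLogSum (fun j => μ (g j)) W (fun j => s (g j)) (fun j => c (g j))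
      (fun j => b (g j)) := by
  unfold meanLogSum
  rw [← pi_map_comp μ hg, integral_map (Measurable.aemeasurable (by fun_prop))
    (hW.continuous_logSum (continuous_spinField _ _ _)).aestronglyMeasurable]
  congr 1
  ext x
  congr 1
  ext θ
  refine sum_eq_sum_comp hg fun i hi => ?_
  change (c i * x i + b i) * s i θ = 0
  rw [hc i hi, hb i hi]
  ring

/-! ### Bounds in finite volume -/

/-- As `sin t cos t` is the derivative of `sin² t / 2`, the function `f - (A/2) sin²` is antitone;
no integrability of `f'` is needed. -/
theorem le_add_half_of_hasDerivAt {f f' : ℝ → ℝ} (hf : ∀ t, HasDerivAt f (f' t) t) {A : ℝ}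
    (h : ∀ t ∈ Set.Icc 0 (Real.pi / 2), f' t ≤ A * (Real.sin t * Real.cos t)) :
    f (Real.pi / 2) ≤ f 0 + A / 2 := by
  have hg : ∀ t, HasDerivAt (fun t => f t - A / 2 * Real.sin t ^ 2)
      (f' t - A * (Real.sin t * Real.cos t)) t := fun t => by
    refine ((hf t).sub (((Real.hasDerivAt_sin t).pow 2).const_mul (A / 2))).congr_deriv ?_
    simp only [Nat.cast_ofNat]
    ring
  have hanti : AntitoneOn (fun t => f t - A / 2 * Real.sin t ^ 2) (Set.Icc 0 (Real.pi / 2)) := by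
    refine antitoneOn_of_deriv_nonpos (convex_Icc _ _)
      (fun t _ => (hg t).continuousAt.continuousWithinAt)
      (fun t _ => (hg t).differentiableAt.differentiableWithinAt) fun t ht => ?_
    rw [(hg t).deriv]
    linarith [h t (interior_subset ht)]
  have hpi : (0 : ℝ) ≤ Real.pi / 2 := by positivity
  have := hanti (Set.left_mem_Icc.2 hpi) (Set.right_mem_Icc.2 hpi) hpi
  simp only [Real.sin_zero, Real.sin_pi_div_two] at this
  linarith

section FiniteVolume

open Classical

variable {V : Type} [Fintype V]

/-- The spin at a site. -/
def siteSpin (u : V) (θ : V → ℤˣ) : ℝ := ((θ u : ℤ) : ℝ)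

/-- The product of the spins over a pair. -/
def offDiagSpin (e : DistinctPair V) (θ : V → ℤˣ) : ℝ := pairSpin θ e.1

/-- The total magnetization. -/
def magnetization (θ : V → ℤˣ) : ℝ := ∑ u, siteSpin u θ

theorem siteSpin_sq (u : V) (θ : V → ℤˣ) : siteSpin u θ ^ 2 = 1 := intUnit_sq _

theorem siteSpin_mul (u : V) (θ θ' : V → ℤˣ) :
    siteSpin u (θ * θ') = siteSpin u θ * siteSpin u θ' := by simp [siteSpin]

theorem offDiagSpin_sq (e : DistinctPair V) (θ : V → ℤˣ) : offDiagSpin e θ ^ 2 = 1 :=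
  pairSpin_sq _ _

theorem offDiagSpin_mul (e : DistinctPair V) (θ θ' : V → ℤˣ) :
    offDiagSpin e (θ * θ') = offDiagSpin e θ * offDiagSpin e θ' := pairSpin_mul _ _ _

theorem two_mul_sum_distinctPair (F : Sym2 V → ℝ) :
    2 * ∑ e : DistinctPair V, F e.1 = ∑ p : V × V with p.1 ≠ p.2, F s(p.1, p.2) := by
  have h := Finset.sum_fiberwise_of_maps_to (s := Finset.univ.filter fun p : V × V => p.1 ≠ p.2)
    (t := Finset.univ.filter fun e : Sym2 V => ¬ e.IsDiag) (g := fun p => s(p.1, p.2))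
    (by intro p hp; simpa using hp) (fun p => F s(p.1, p.2))
  rw [← h, Finset.mul_sum, ← Finset.sum_subtype_eq_sum_filter, ← Finset.subtype_univ]
  refine Finset.sum_congr (by ext; simp) fun e _ => ?_
  obtain ⟨e, he⟩ := e
  induction e using Sym2.inductionOn with
  | hf u v =>
    have huv : u ≠ v := by simpa using he
    have : ((Finset.univ.filter fun p : V × V => p.1 ≠ p.2).filter
        fun p => s(p.1, p.2) = s(u, v)) = {(u, v), (v, u)} := by
      ext ⟨a, b⟩
      simp only [Finset.mem_filter, Finset.mem_univ, true_and, Finset.mem_insert,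
        Finset.mem_singleton, Prod.mk.injEq, Sym2.eq_iff]
      constructor
      · rintro ⟨_, h⟩; exact h
      · rintro (⟨rfl, rfl⟩ | ⟨rfl, rfl⟩)
        · exact ⟨huv, Or.inl ⟨rfl, rfl⟩⟩
        · exact ⟨huv.symm, Or.inr ⟨rfl, rfl⟩⟩
    rw [this, Finset.sum_pair (by simp [huv])]
    simp only [Sym2.eq_swap (a := v) (b := u)]
    ring

/-- In the expansion of the square the diagonal gives 1 per site and each pair occurs twice. Hence
pair terms and site terms are both functions of the magnetization. -/
theorem two_mul_sum_offDiagSpin (θ : V → ℤˣ) :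
    2 * ∑ e, offDiagSpin e θ = magnetization θ ^ 2 - Fintype.card V := by
  have h := two_mul_sum_distinctPair (V := V) (fun e => pairSpin θ e)
  simp only [offDiagSpin]
  rw [h, Finset.sum_filter, Fintype.sum_prod_type, magnetization, sq, Finset.sum_mul_sum]
  have hc : (Fintype.card V : ℝ) = ∑ _u : V, (1 : ℝ) := by simp
  rw [hc, ← Finset.sum_sub_distrib]
  refine Finset.sum_congr rfl fun u _ => ?_
  rw [← Finset.sum_erase_add _ _ (Finset.mem_univ u),
    ← Finset.sum_erase_add (a := u) _ _ (Finset.mem_univ u)]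
  have h1 : siteSpin u θ * siteSpin u θ = 1 := by rw [← sq, siteSpin_sq]
  simp only [ne_eq, not_true_eq_false, if_false, h1, add_zero, add_sub_cancel_right]
  refine Finset.sum_congr rfl fun v hv => ?_
  rw [if_pos (Finset.ne_of_mem_erase hv).symm]
  rfl

/-- Two replicas: for a multiplicative `f`, the square of its average is its average at the product
`θ θ'`. -/
theorem sum_sq_average {Ω κ : Type*} [Fintype Ω] [Group Ω] [Fintype κ] (p : Ω → ℝ)
    {f : κ → Ω → ℝ} (hf : ∀ k θ θ', f k (θ * θ') = f k θ * f k θ') :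
    ∑ k, (∑ θ, p θ * f k θ) ^ 2 = ∑ θ, ∑ θ', p θ * p θ' * ∑ k, f k (θ * θ') := by
  have h : ∀ k, (∑ θ, p θ * f k θ) ^ 2 = ∑ θ, ∑ θ', p θ * p θ' * f k (θ * θ') := fun k => by
    rw [sq, Finset.sum_mul_sum]
    refine Finset.sum_congr rfl fun θ _ => Finset.sum_congr rfl fun θ' _ => ?_
    rw [hf]
    ring
  simp only [h, Finset.mul_sum]
  rw [Finset.sum_comm]
  exact Finset.sum_congr rfl fun θ _ => Finset.sum_comm

theorem sum_average {Ω κ : Type*} [Fintype Ω] [Fintype κ] (p : Ω → ℝ) (f : κ → Ω → ℝ) :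
    ∑ k, ∑ θ, p θ * f k θ = ∑ θ, p θ * ∑ k, f k θ := by
  rw [Finset.sum_comm]
  simp only [Finset.mul_sum]

/-- Comparison of the two kinds of side information, for a Gibbs measure with magnetization
close to `q`. -/
theorem overlap_upper [Nonempty V] {p : (V → ℤˣ) → ℝ} (hp : ∀ θ, 0 ≤ p θ) (hp1 : ∑ θ, p θ = 1)
    {η q ε : ℝ} (hη : 0 ≤ η)
    (hS : ∀ θ, p θ ≠ 0 → |magnetization θ - Fintype.card V * q| ≤ Fintype.card V * ε) :
    η / Fintype.card V * ∑ e : DistinctPair V, (2 * ∑ θ, p θ * offDiagSpin e θ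
        - (∑ θ, p θ * offDiagSpin e θ) ^ 2)
      - η * q * ∑ u : V, (2 * ∑ θ, p θ * siteSpin u θ - (∑ θ, p θ * siteSpin u θ) ^ 2)
      ≤ η * Fintype.card V * (ε ^ 2 - q ^ 2 / 2) := by
  set n : ℝ := (Fintype.card V : ℝ) with hn
  have hn0 : 0 < n := by rw [hn]; exact_mod_cast Fintype.card_pos
  have e1 : ∀ θ : V → ℤˣ, ∑ e, offDiagSpin e θ = (magnetization θ ^ 2 - n) / 2 := fun θ => by
    linarith [two_mul_sum_offDiagSpin θ]
  simp only [Finset.sum_sub_distrib, ← Finset.mul_sum]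
  rw [sum_average, sum_average, sum_sq_average p offDiagSpin_mul, sum_sq_average p siteSpin_mul]
  simp only [e1, ← magnetization.eq_1]
  have hpp : ∑ θ, ∑ θ', p θ * p θ' = 1 := by
    rw [← Finset.sum_mul_sum, hp1, one_mul]
  -- The terms linear in the Gibbs average complete to `(η/n)(M - nq)²`, which the window bounds by
  -- `η n ε²`.
  have a1 : ∑ θ, p θ * (η / n * (magnetization θ ^ 2 - n) - 2 * η * q * magnetization θ)
      ≤ η * n * ε ^ 2 - η * n * q ^ 2 - η := by
    calc _ ≤ ∑ θ, p θ * (η * n * ε ^ 2 - η * n * q ^ 2 - η) := by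
          refine Finset.sum_le_sum fun θ _ => ?_
          by_cases h0 : p θ = 0
          · simp [h0]
          refine mul_le_mul_of_nonneg_left ?_ (hp θ)
          have h2 : (magnetization θ - n * q) ^ 2 ≤ (n * ε) ^ 2 := sq_le_sq' 
            (by linarith [(abs_le.1 (hS θ h0)).1]) (abs_le.1 (hS θ h0)).2
          have h3 : η / n * (magnetization θ - n * q) ^ 2 ≤ η / n * (n * ε) ^ 2 :=
            mul_le_mul_of_nonneg_left h2 (by positivity)
          have h4 : η / n * (n * ε) ^ 2 = η * n * ε ^ 2 := by field_simp
          have h5 : η / n * (magnetization θ - n * q) ^ 2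
              = η / n * (magnetization θ ^ 2 - n) - 2 * η * q * magnetization θ
                + η * n * q ^ 2 + η := by field_simp; ring
          linarith
      _ = _ := by rw [← Finset.sum_mul, hp1, one_mul]
  -- The replica terms enter the goal with a negative sign, so their square is dropped and no
  -- control of the overlap is needed.
  have a2 : -(η * n * q ^ 2 + η) ≤ ∑ θ, ∑ θ', p θ * p θ' *
      (η / n * (magnetization (θ * θ') ^ 2 - n) - 2 * η * q * magnetization (θ * θ')) := by
    calc _ = ∑ θ, ∑ θ', p θ * p θ' * (-(η * n * q ^ 2 + η)) := by
          simp only [← Finset.sum_mul, hpp, one_mul]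
      _ ≤ _ := by
          refine Finset.sum_le_sum fun θ _ => Finset.sum_le_sum fun θ' _ => ?_
          refine mul_le_mul_of_nonneg_left ?_ (mul_nonneg (hp θ) (hp θ'))
          have h3 : 0 ≤ η / n * (magnetization (θ * θ') - n * q) ^ 2 := by positivity
          have h5 : η / n * (magnetization (θ * θ') - n * q) ^ 2
              = η / n * (magnetization (θ * θ') ^ 2 - n) - 2 * η * q * magnetization (θ * θ')
                + η * n * q ^ 2 + η := by field_simp; ring
          linarith
  have b1 : η / n * (2 * ∑ θ, p θ * ((magnetization θ ^ 2 - n) / 2))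
        - η * q * (2 * ∑ θ, p θ * magnetization θ)
      = ∑ θ, p θ * (η / n * (magnetization θ ^ 2 - n) - 2 * η * q * magnetization θ) := by
    simp only [Finset.mul_sum, ← Finset.sum_sub_distrib]
    exact Finset.sum_congr rfl fun θ _ => by ring
  have b2 : 2 * (η / n * (∑ θ, ∑ θ', p θ * p θ' * ((magnetization (θ * θ') ^ 2 - n) / 2))
        - η * q * (∑ θ, ∑ θ', p θ * p θ' * magnetization (θ * θ')))
      = ∑ θ, ∑ θ', p θ * p θ' *
        (η / n * (magnetization (θ * θ') ^ 2 - n) - 2 * η * q * magnetization (θ * θ')) := by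
    simp only [Finset.mul_sum, ← Finset.sum_sub_distrib]
    exact Finset.sum_congr rfl fun θ _ => Finset.sum_congr rfl fun θ' _ => by ring
  nlinarith

/-- For each `θ` the right side is the left side plus `η/(2n) (M - nq)²`. No concentration is
needed, because the Nishimori identity will have absorbed the replica terms. -/
theorem overlap_lower [Nonempty V] {p : (V → ℤˣ) → ℝ} (hp : ∀ θ, 0 ≤ p θ) (hp1 : ∑ θ, p θ = 1)
    {η q : ℝ} (hη : 0 ≤ η) :
    -(η * Fintype.card V * q ^ 2 / 2 + η / 2)
      ≤ η / Fintype.card V * ∑ e : DistinctPair V, ∑ θ, p θ * offDiagSpin e θ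
        - η * q * ∑ u : V, ∑ θ, p θ * siteSpin u θ := by
  set n : ℝ := (Fintype.card V : ℝ) with hn
  have hn0 : 0 < n := by rw [hn]; exact_mod_cast Fintype.card_pos
  have e1 : ∀ θ : V → ℤˣ, ∑ e, offDiagSpin e θ = (magnetization θ ^ 2 - n) / 2 := fun θ => by
    linarith [two_mul_sum_offDiagSpin θ]
  rw [sum_average, sum_average]
  simp only [e1, ← magnetization.eq_1]
  rw [Finset.mul_sum, Finset.mul_sum, ← Finset.sum_sub_distrib]
  calc _ = ∑ θ, p θ * (-(η * n * q ^ 2 / 2 + η / 2)) := by rw [← Finset.sum_mul, hp1, one_mul]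
    _ ≤ _ := by
      refine Finset.sum_le_sum fun θ _ => ?_
      have h3 : 0 ≤ η / n / 2 * (magnetization θ - n * q) ^ 2 := by positivity
      have h5 : η / n / 2 * (magnetization θ - n * q) ^ 2
          = η / n * ((magnetization θ ^ 2 - n) / 2) - η * q * magnetization θ
            + η * n * q ^ 2 / 2 + η / 2 := by field_simp; ring
      have := mul_le_mul_of_nonneg_left (a := p θ) (show -(η * n * q ^ 2 / 2 + η / 2) ≤
        η / n * ((magnetization θ ^ 2 - n) / 2) - η * q * magnetization θ by linarith) (hp θ)
      refine this.trans (le_of_eq ?_)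
      ring

variable {ι : Type} [Fintype ι]

/-- The noise contributes `r r' (1 - ⟨s⟩²)` by integration by parts, the mean `r²` contributes `2 r
r' ⟨s⟩`, and the term `-r²/2` cancels the remaining `r r'`. The edge fields are constant along the
path and drop out. -/
theorem hasDerivAt_modelEnergy (G : SimpleGraph V) {δ : ℝ} (h0 : 0 ≤ δ) (h1 : δ < 1)
    {W : (V → ℤˣ) → ℝ} (hW : IsWeight W) {s : ι → (V → ℤˣ) → ℝ} (hs : ∀ i θ, s i θ ^ 2 = 1)
    {r r' : ℝ → ι → ℝ} {K : ℝ} (hr : ∀ t i, HasDerivAt (fun t => r t i) (r' t i) t)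
    (hr1 : ∀ t i, |r t i| ≤ K) (hr1' : ∀ t i, |r' t i| ≤ K) (t : ℝ) :
    HasDerivAt (fun t => modelEnergy G δ W s (r t))
      (∫ x, ∑ i, r t i * r' t i *
        (2 * gibbs W (spinField (obsSpin G s) fun j => obsGain G.edgeSet δ (r t) j * x j
            + obsMean G.edgeSet (r t) j) (s i)
          - gibbs W (spinField (obsSpin G s) fun j => obsGain G.edgeSet δ (r t) j * x j
            + obsMean G.edgeSet (r t) j) (s i) ^ 2)
        ∂Measure.pi (noiseLaw G.edgeSet ι δ)) t := by
  have hp := isProbabilityMeasure_noiseLaw G.edgeSet ι h0 h1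
  have hsum : HasDerivAt (fun t => ∑ i, r t i ^ 2 / 2) (∑ i, r t i * r' t i) t := by
    refine HasDerivAt.fun_sum fun i _ => ?_
    refine (((hr t i).pow 2).div_const 2).congr_deriv ?_
    simp only [Nat.cast_ofNat]
    ring
  have hK : ∀ i : ι, 0 ≤ K := fun i => (abs_nonneg _).trans (hr1 0 i)
  have hmain := hasDerivAt_meanLogSum (μ := noiseLaw G.edgeSet ι δ) hW (obsSpin_sq G hs)
    (memLp_noiseLaw _ _ δ) (c := fun t => obsGain G.edgeSet δ (r t))
    (b := fun t => obsMean G.edgeSet (r t))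
    (c' := fun t => Sum.elim (fun _ => 0) (r' t))
    (b' := fun t => Sum.elim (fun _ => 0) fun i => 2 * r t i * r' t i)
    -- One constant for both derivatives, `r'` and `(r²)' = 2 r r'`.
    (K := |K| + 2 * |K| * |K|) ?_ ?_ ?_ ?_ ?_ t
  · refine (hmain.sub hsum).congr_deriv ?_
    set g : (G.edgeSet ⊕ ι → ℝ) → ι → ℝ := fun x i => gibbs W (spinField (obsSpin G s) fun j =>
      obsGain G.edgeSet δ (r t) j * x j + obsMean G.edgeSet (r t) j) (s i) with hg
    have hgi : ∀ i, Integrable (fun x => g x i) (Measure.pi (noiseLaw G.edgeSet ι δ)) :=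
      fun i => integrable_gibbs hW _ _ _ _
    have hg2 : ∀ i, Integrable (fun x => g x i ^ 2) (Measure.pi (noiseLaw G.edgeSet ι δ)) :=
      fun i => integrable_gibbs_sq hW _ _ _ _
    have hd : Integrable (fun x => ∑ i, r t i * r' t i * (2 * g x i - g x i ^ 2))
        (Measure.pi (noiseLaw G.edgeSet ι δ)) :=
      integrable_finsetSum _ fun i _ => (((hgi i).const_mul 2).sub (hg2 i)).const_mul _
    have hc : ∑ i, r t i * r' t i
        = ∫ _x, ∑ i, r t i * r' t i ∂Measure.pi (noiseLaw G.edgeSet ι δ) := by simp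
    rw [sub_eq_iff_eq_add]
    rw [hc, ← integral_add hd (integrable_const _)]
    refine integral_congr_ae (ae_of_all _ fun x => ?_)
    simp only [Fintype.sum_sum_type, Sum.elim_inl, Sum.elim_inr, zero_mul, add_zero,
      Finset.sum_const_zero, zero_add, ← Finset.sum_add_distrib]
    refine Finset.sum_congr rfl fun i _ => ?_
    change r' t i * r t i * (1 - g x i ^ 2) + 2 * r t i * r' t i * g x i = _
    ring
  · rintro t (e | i)
    · exact hasDerivAt_const _ _
    · exact hr t i
  · rintro t (e | i)
    · exact hasDerivAt_const _ _
    · refine ((hr t i).pow 2).congr_deriv ?_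
      simp only [Nat.cast_ofNat, Sum.elim_inr]
      ring
  · rintro t (e | i)
    · simp only [Sum.elim_inl, abs_zero]
      positivity
    · have := hr1' t i
      simp only [Sum.elim_inr]
      nlinarith [abs_nonneg K, le_abs_self K, mul_nonneg (abs_nonneg K) (abs_nonneg K)]
  · rintro t (e | i)
    · simp only [Sum.elim_inl, abs_zero]
      positivity
    · simp only [Sum.elim_inr, abs_mul, abs_two]
      have h2 : |r t i| * |r' t i| ≤ |K| * |K| :=
        mul_le_mul ((hr1 t i).trans (le_abs_self K)) ((hr1' t i).trans (le_abs_self K))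
          (abs_nonneg _) (abs_nonneg _)
      nlinarith [abs_nonneg K]
  · rintro t (e | i) h
    · exact absurd rfl h
    · rfl

theorem modelEnergy_comp (G : SimpleGraph V) {δ : ℝ} (h0 : 0 ≤ δ) (h1 : δ < 1)
    {W : (V → ℤˣ) → ℝ} (hW : IsWeight W) {κ : Type} [Fintype κ] {s : ι → (V → ℤˣ) → ℝ} {r : ι → ℝ}
    {g : κ → ι} (hg : Function.Injective g) (hr : ∀ i ∉ Set.range g, r i = 0) :
    modelEnergy G δ W s r = modelEnergy G δ W (fun k => s (g k)) (fun k => r (g k)) := by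
  have hp := isProbabilityMeasure_noiseLaw G.edgeSet ι h0 h1
  unfold modelEnergy
  rw [sum_eq_sum_comp hg (f := fun i => r i ^ 2 / 2) fun i hi => by rw [hr i hi]; simp]
  congr 1
  have hg' : Function.Injective (Sum.map id g : G.edgeSet ⊕ κ → G.edgeSet ⊕ ι) :=
    Function.injective_id.sumMap hg
  have hz : ∀ i ∉ Set.range (Sum.map id g : G.edgeSet ⊕ κ → G.edgeSet ⊕ ι),
      ∃ k, i = Sum.inr k ∧ k ∉ Set.range g := by
    rintro (e | i) hi
    · exact absurd ⟨Sum.inl e, rfl⟩ hi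
    · refine ⟨i, rfl, ?_⟩
      rintro ⟨k, rfl⟩
      exact hi ⟨Sum.inr k, rfl⟩
  rw [meanLogSum_comp hW hg']
  · congr 1 <;> ext j <;> rcases j with e | j <;> rfl
  · intro i hi
    obtain ⟨k, rfl, hk⟩ := hz i hi
    exact hr k hk
  · intro i hi
    obtain ⟨k, rfl, hk⟩ := hz i hi
    simp [obsMean, hr k hk]

end FiniteVolume

end LatticeSync
end

noncomputable section

namespace LatticeSync

/-! ### Interpolation between scalar and spiked GOE side information -/

theorem sin_mul_cos_nonneg {t : ℝ} (ht : t ∈ Set.Icc 0 (Real.pi / 2)) :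
    0 ≤ Real.sin t * Real.cos t :=
  mul_nonneg (Real.sin_nonneg_of_nonneg_of_le_pi ht.1 (by linarith [ht.2, Real.pi_pos]))
    (Real.cos_nonneg_of_neg_pi_div_two_le_of_le (by linarith [ht.1, Real.pi_pos]) ht.2)

section Interpolation

open Classical

variable {V : Type} [Fintype V]

/-- The free energy with scalar side information, for given a priori weights. -/
def scalarEnergy (G : SimpleGraph V) (δ lam : ℝ) (W : (V → ℤˣ) → ℝ) : ℝ :=
  modelEnergy G δ W siteSpin fun _ : V => √lam

/-- The free energy with spiked GOE side information, for given a priori weights. -/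
def goeEnergy (G : SimpleGraph V) (δ η : ℝ) (W : (V → ℤˣ) → ℝ) : ℝ :=
  modelEnergy G δ W offDiagSpin fun _ : DistinctPair V => √(η / Fintype.card V)

/-- The uniform weights. -/
def uniformWeight (V : Type) [Fintype V] (_ : V → ℤˣ) : ℝ := (2 ^ Fintype.card V)⁻¹

theorem isWeight_uniformWeight : IsWeight (uniformWeight V) :=
  isWeight_const (c := ((2 : ℝ) ^ Fintype.card V)⁻¹) (by positivity)

/-- Both kinds of side information. -/
def mixedSpin : DistinctPair V ⊕ V → (V → ℤˣ) → ℝ := Sum.elim offDiagSpin siteSpin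

variable (V) in
/-- The path from scalar to spiked GOE side information. -/
def mixedGain (η q t : ℝ) : DistinctPair V ⊕ V → ℝ :=
  Sum.elim (fun _ => √(η / Fintype.card V) * Real.sin t) (fun _ => √(η * q) * Real.cos t)

theorem mixedSpin_sq (i : DistinctPair V ⊕ V) (θ : V → ℤˣ) : mixedSpin i θ ^ 2 = 1 := by
  rcases i with e | u
  · exact offDiagSpin_sq _ _
  · exact siteSpin_sq _ _

theorem mixedSpin_mul (i : DistinctPair V ⊕ V) (θ θ' : V → ℤˣ) :
    mixedSpin i (θ * θ') = mixedSpin i θ * mixedSpin i θ' := by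
  rcases i with e | u
  · exact offDiagSpin_mul _ _ _
  · exact siteSpin_mul _ _ _

variable (G : SimpleGraph V) {δ : ℝ} (h0 : 0 ≤ δ) (h1 : δ < 1) {W : (V → ℤˣ) → ℝ}
  (hW : IsWeight W)

include h0 h1 hW

theorem modelEnergy_mixed_zero (η q : ℝ) :
    modelEnergy G δ W mixedSpin (mixedGain V η q 0) = scalarEnergy G δ (η * q) W := by
  rw [modelEnergy_comp G h0 h1 hW (g := Sum.inr) Sum.inr_injective]
  · simp [scalarEnergy, mixedGain, mixedSpin]
  · rintro (e | u) hi
    · simp [mixedGain]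
    · exact absurd ⟨u, rfl⟩ hi

theorem modelEnergy_mixed_pi_div_two (η q : ℝ) :
    modelEnergy G δ W mixedSpin (mixedGain V η q (Real.pi / 2)) = goeEnergy G δ η W := by
  rw [modelEnergy_comp G h0 h1 hW (g := Sum.inl) Sum.inl_injective]
  · simp [goeEnergy, mixedGain, mixedSpin]
  · rintro (e | u) hi
    · exact absurd ⟨e, rfl⟩ hi
    · simp [mixedGain]

/-- The Gibbs average along the path. -/
theorem hasDerivAt_mixed {η q : ℝ} (hη : 0 ≤ η) (hq : 0 ≤ q) (t : ℝ) :
    HasDerivAt (fun t => modelEnergy G δ W mixedSpin (mixedGain V η q t))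
      (∫ x, Real.sin t * Real.cos t * (η / Fintype.card V * ∑ e : DistinctPair V,
          (2 * gibbs W (spinField (obsSpin G mixedSpin) fun j =>
              obsGain G.edgeSet δ (mixedGain V η q t) j * x j
                + obsMean G.edgeSet (mixedGain V η q t) j) (offDiagSpin e)
            - gibbs W (spinField (obsSpin G mixedSpin) fun j =>
              obsGain G.edgeSet δ (mixedGain V η q t) j * x j
                + obsMean G.edgeSet (mixedGain V η q t) j) (offDiagSpin e) ^ 2)
        - η * q * ∑ u : V,
          (2 * gibbs W (spinField (obsSpin G mixedSpin) fun j =>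
              obsGain G.edgeSet δ (mixedGain V η q t) j * x j
                + obsMean G.edgeSet (mixedGain V η q t) j) (siteSpin u)
            - gibbs W (spinField (obsSpin G mixedSpin) fun j =>
              obsGain G.edgeSet δ (mixedGain V η q t) j * x j
                + obsMean G.edgeSet (mixedGain V η q t) j) (siteSpin u) ^ 2))
        ∂Measure.pi (noiseLaw G.edgeSet (DistinctPair V ⊕ V) δ)) t := by
  have hs1 : √(η / Fintype.card V) ^ 2 = η / Fintype.card V := Real.sq_sqrt (by positivity)
  have hs2 : √(η * q) ^ 2 = η * q := Real.sq_sqrt (by positivity)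
  have a0 := Real.sqrt_nonneg (η / Fintype.card V)
  have a1 := Real.sqrt_nonneg (η * q)
  have hb : ∀ a b x : ℝ, 0 ≤ a → 0 ≤ b → |x| ≤ 1 → |a * x| ≤ a + b := fun a b x ha hb hx => by
    rw [abs_mul, abs_of_nonneg ha]
    nlinarith [abs_nonneg x]
  -- Gains in `sin` and `cos` are differentiable at both ends of the path, unlike square roots of
  -- linear functions, and make `r r'` a constant times `± sin t cos t`.
  refine (hasDerivAt_modelEnergy G h0 h1 hW mixedSpin_sq
    (r' := fun t => Sum.elim (fun _ => √(η / Fintype.card V) * Real.cos t)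
      (fun _ => √(η * q) * (-Real.sin t))) (K := √(η / Fintype.card V) + √(η * q))
    ?_ ?_ ?_ t).congr_deriv ?_
  · rintro t (e | u)
    · exact (Real.hasDerivAt_sin t).const_mul _
    · exact (Real.hasDerivAt_cos t).const_mul _
  · rintro t (e | u)
    · exact hb _ _ _ a0 a1 (Real.abs_sin_le_one t)
    · rw [add_comm]; exact hb _ _ _ a1 a0 (Real.abs_cos_le_one t)
  · rintro t (e | u)
    · exact hb _ _ _ a0 a1 (Real.abs_cos_le_one t)
    · rw [add_comm]; exact hb _ _ _ a1 a0 (by rw [abs_neg]; exact Real.abs_sin_le_one t)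
  · congr 1
    ext x
    rw [Fintype.sum_sum_type, mul_sub, Finset.mul_sum, Finset.mul_sum, Finset.mul_sum,
      Finset.mul_sum, sub_eq_add_neg, ← Finset.sum_neg_distrib]
    congr 1
    · refine Finset.sum_congr rfl fun e _ => ?_
      have h : ∀ X, √(η / Fintype.card V) * Real.sin t * (√(η / Fintype.card V) * Real.cos t) * X
          = Real.sin t * Real.cos t * (η / Fintype.card V * X) := fun X => by
        linear_combination (Real.sin t * Real.cos t * X) * hs1
      exact h _
    · refine Finset.sum_congr rfl fun u _ => ?_
      have h : ∀ X, √(η * q) * Real.cos t * (√(η * q) * (-Real.sin t)) * X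
          = -(Real.sin t * Real.cos t * (η * q * X)) := fun X => by
        linear_combination (-(Real.sin t * Real.cos t * X)) * hs2
      exact h _

/-- The interpolation bound for a priori weights concentrated near a given magnetization. -/
theorem goeEnergy_le [Nonempty V] {η q ε : ℝ} (hη : 0 ≤ η) (hq : 0 ≤ q)
    (hS : ∀ θ, W θ ≠ 0 → |magnetization θ - Fintype.card V * q| ≤ Fintype.card V * ε) :
    goeEnergy G δ η W ≤ scalarEnergy G δ (η * q) W
      + η * Fintype.card V * (ε ^ 2 - q ^ 2 / 2) / 2 := by
  have hp := isProbabilityMeasure_noiseLaw G.edgeSet (DistinctPair V ⊕ V) h0 h1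
  rw [← modelEnergy_mixed_zero G h0 h1 hW η q, ← modelEnergy_mixed_pi_div_two G h0 h1 hW η q]
  refine le_add_half_of_hasDerivAt (hasDerivAt_mixed G h0 h1 hW hη hq) fun t ht => ?_
  have hsc := sin_mul_cos_nonneg ht
  have hle := fun x : G.edgeSet ⊕ (DistinctPair V ⊕ V) → ℝ =>
    overlap_upper (p := gibbsWeight W (spinField (obsSpin G mixedSpin) fun j =>
      obsGain G.edgeSet δ (mixedGain V η q t) j * x j
        + obsMean G.edgeSet (mixedGain V η q t) j)) (fun θ => hW.gibbsWeight_nonneg θ)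
      hW.sum_gibbsWeight (q := q) (ε := ε) hη
      fun θ h => hS θ fun h' => h (by rw [gibbsWeight, h', zero_mul, zero_div])
  simp only [← gibbs_eq_sum] at hle
  refine (integral_mono (Integrable.const_mul (Integrable.sub
    (Integrable.const_mul (integrable_finsetSum _ fun e _ =>
      ((integrable_gibbs hW _ _ _ _).const_mul 2).sub (integrable_gibbs_sq hW _ _ _ _)) _)
    (Integrable.const_mul (integrable_finsetSum _ fun e _ =>
      ((integrable_gibbs hW _ _ _ _).const_mul 2).sub (integrable_gibbs_sq hW _ _ _ _)) _)) _)
    (integrable_const _) fun x => mul_le_mul_of_nonneg_left (hle x) hsc).trans_eq ?_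
  rw [integral_const, probReal_univ, one_smul, mul_comm]

omit hW in
/-- The interpolation bound in the Bayes-optimal case. -/
theorem scalarEnergy_le [Nonempty V] {η q : ℝ} (hη : 0 ≤ η) (hq : 0 ≤ q) :
    scalarEnergy G δ (η * q) (uniformWeight V) - η * Fintype.card V * q ^ 2 / 4 - η / 4
      ≤ goeEnergy G δ η (uniformWeight V) := by
  have hW := isWeight_uniformWeight (V := V)
  have hp := isProbabilityMeasure_noiseLaw G.edgeSet (DistinctPair V ⊕ V) h0 h1
  rw [← modelEnergy_mixed_zero G h0 h1 hW η q, ← modelEnergy_mixed_pi_div_two G h0 h1 hW η q]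
  -- Applied to minus the free energy, since the derivative is bounded from below.
  have key := le_add_half_of_hasDerivAt (A := η * Fintype.card V * q ^ 2 / 2 + η / 2)
    (fun t => (hasDerivAt_mixed G h0 h1 hW hη hq t).neg) fun t ht => ?_
  · simp only [Pi.neg_apply] at key
    linarith
  have hsc := sin_mul_cos_nonneg ht
  set g : (G.edgeSet ⊕ (DistinctPair V ⊕ V) → ℝ) → ((V → ℤˣ) → ℝ) → ℝ := fun x =>
    gibbs (uniformWeight V) (spinField (obsSpin G mixedSpin) fun j =>
      obsGain G.edgeSet δ (mixedGain V η q t) j * x j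
        + obsMean G.edgeSet (mixedGain V η q t) j) with hg
  set P := Measure.pi (noiseLaw G.edgeSet (DistinctPair V ⊕ V) δ) with hP
  have hgi : ∀ f, Integrable (fun x => g x f) P := fun f => integrable_gibbs hW _ _ _ _
  have hg2 : ∀ f, Integrable (fun x => g x f ^ 2) P := fun f => integrable_gibbs_sq hW _ _ _ _
  -- Gain and mean stay of the form `r`, `r²` along the whole path, so the Nishimori identity holds
  -- at every `t`.
  have hsym : ∀ i, IsSymmetricChannel ((noiseLaw G.edgeSet (DistinctPair V ⊕ V) δ i).map fun x =>
      obsGain G.edgeSet δ (mixedGain V η q t) i * x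
        + obsMean G.edgeSet (mixedGain V η q t) i) := by
    rintro (e | i)
    · exact isSymmetricChannel_signMeasure h0 h1
    · exact isSymmetricChannel_gaussianReal _
  have hN : ∀ i, ∫ x, g x (mixedSpin i) ^ 2 ∂P = ∫ x, g x (mixedSpin i) ∂P := fun i =>
    integral_gibbs_sq (obsSpin_sq G mixedSpin_sq) (obsSpin_mul G mixedSpin_mul)
      (w := ((2 : ℝ) ^ Fintype.card V)⁻¹) (by positivity) hsym (Sum.inr i)
  have hI : ∀ i, ∫ x, (2 * g x (mixedSpin i) - g x (mixedSpin i) ^ 2) ∂P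
      = ∫ x, g x (mixedSpin i) ∂P := fun i => by
    rw [integral_sub ((hgi _).const_mul 2) (hg2 _), integral_const_mul, hN]
    ring
  have hi1 : ∀ i, Integrable (fun x => 2 * g x (mixedSpin i) - g x (mixedSpin i) ^ 2) P :=
    fun i => ((hgi _).const_mul 2).sub (hg2 _)
  have hI2 : ∫ x, Real.sin t * Real.cos t * (η / Fintype.card V * ∑ e : DistinctPair V,
          (2 * g x (offDiagSpin e) - g x (offDiagSpin e) ^ 2)
        - η * q * ∑ u : V, (2 * g x (siteSpin u) - g x (siteSpin u) ^ 2)) ∂P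
      = ∫ x, Real.sin t * Real.cos t * (η / Fintype.card V * ∑ e : DistinctPair V,
          g x (offDiagSpin e) - η * q * ∑ u : V, g x (siteSpin u)) ∂P := by
    rw [integral_const_mul, integral_const_mul, integral_sub, integral_sub, integral_const_mul,
      integral_const_mul, integral_const_mul, integral_const_mul, integral_finsetSum,
      integral_finsetSum, integral_finsetSum, integral_finsetSum]
    · congr 3
      · exact Finset.sum_congr rfl fun e _ => hI (Sum.inl e)
      · exact Finset.sum_congr rfl fun u _ => hI (Sum.inr u)
    · exact fun u _ => hgi _
    · exact fun u _ => hgi _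
    · exact fun u _ => hi1 (Sum.inr u)
    · exact fun e _ => hi1 (Sum.inl e)
    · exact (integrable_finsetSum _ fun e _ => hgi _).const_mul _
    · exact (integrable_finsetSum _ fun e _ => hgi _).const_mul _
    · exact (integrable_finsetSum _ fun e _ => hi1 (Sum.inl e)).const_mul _
    · exact (integrable_finsetSum _ fun e _ => hi1 (Sum.inr e)).const_mul _
  have hle := fun x : G.edgeSet ⊕ (DistinctPair V ⊕ V) → ℝ =>
    overlap_lower (p := gibbsWeight (uniformWeight V) (spinField (obsSpin G mixedSpin) fun j =>
      obsGain G.edgeSet δ (mixedGain V η q t) j * x j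
        + obsMean G.edgeSet (mixedGain V η q t) j)) (fun θ => hW.gibbsWeight_nonneg θ)
      hW.sum_gibbsWeight (q := q) hη
  simp only [← gibbs_eq_sum] at hle
  rw [neg_le]
  refine le_trans (le_of_eq ?_) ((integral_mono (integrable_const _) (Integrable.const_mul
    (Integrable.sub ((integrable_finsetSum _ fun e _ => hgi (offDiagSpin e)).const_mul _)
      ((integrable_finsetSum _ fun u _ => hgi (siteSpin u)).const_mul _)) _)
    fun x => mul_le_mul_of_nonneg_left (hle x) hsc).trans_eq hI2.symm)
  rw [integral_const, probReal_univ, one_smul]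
  ring

end Interpolation

end LatticeSync
end

noncomputable section

namespace LatticeSync

/-! ### Windows of magnetization and the upper bound -/

section Windows

open Classical

variable {V : Type} [Fintype V]

/-- The uniform weights, restricted to the configurations of magnetization about `|V| k / K`. -/
def windowWeight (V : Type) [Fintype V] (K k : ℕ) (θ : V → ℤˣ) : ℝ :=
  if |magnetization θ - Fintype.card V * ((k : ℝ) / K)| ≤ Fintype.card V * (1 / (K : ℝ)) then
    uniformWeight V θ else 0

theorem uniformWeight_pos (θ : V → ℤˣ) : 0 < uniformWeight V θ := by
  unfold uniformWeight; positivity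

theorem windowWeight_nonneg (K k : ℕ) (θ : V → ℤˣ) : 0 ≤ windowWeight V K k θ := by
  unfold windowWeight
  split_ifs
  · exact (uniformWeight_pos θ).le
  · exact le_rfl

theorem windowWeight_le (K k : ℕ) (θ : V → ℤˣ) : windowWeight V K k θ ≤ uniformWeight V θ := by
  unfold windowWeight
  split_ifs
  · exact le_rfl
  · exact (uniformWeight_pos θ).le

theorem abs_magnetization_le (θ : V → ℤˣ) : |magnetization θ| ≤ Fintype.card V := by
  refine (Finset.abs_sum_le_sum_abs _ _).trans ?_
  simp [abs_eq_one_of_sq_eq_one (siteSpin_sq _ θ), Finset.card_univ]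

/-- Take for `k` the integer part of `K M / n`: then `M / n` is within `1/K` of `k/K`, and `M ≤ n`
gives `k ≤ K`. -/
theorem exists_windowWeight {K : ℕ} (hK : 0 < K) {θ : V → ℤˣ} (h : 0 ≤ magnetization θ) :
    ∃ k ∈ Finset.range (K + 1), windowWeight V K k θ = uniformWeight V θ := by
  set n : ℝ := (Fintype.card V : ℝ) with hn
  have hK' : (0 : ℝ) < K := by exact_mod_cast hK
  have hn0 : 0 ≤ n := Nat.cast_nonneg _
  have hM : magnetization θ ≤ n := (abs_le.1 (abs_magnetization_le θ)).2
  set y := magnetization θ / n * K with hy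
  have hy0 : 0 ≤ y := by positivity
  have hyK : y ≤ K := by
    have : magnetization θ / n ≤ 1 := div_le_one_of_le₀ hM hn0
    nlinarith
  have hMy : magnetization θ = n * (y / K) := by
    rcases hn0.eq_or_lt with h0 | h0
    · rw [← h0, zero_mul]
      linarith
    · rw [hy]; field_simp
  refine ⟨⌊y⌋₊, Finset.mem_range.2 (Nat.lt_succ_of_le (Nat.floor_le_of_le hyK)), if_pos ?_⟩
  rw [hMy, ← mul_sub, abs_mul, abs_of_nonneg hn0, ← sub_div, abs_div, abs_of_pos hK']
  refine mul_le_mul_of_nonneg_left (div_le_div_of_nonneg_right ?_ hK'.le) hn0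
  rw [abs_of_nonneg (by linarith [Nat.floor_le hy0])]
  linarith [Nat.lt_floor_add_one y]

theorem magnetization_neg_one_mul (θ : V → ℤˣ) : magnetization ((fun _ => -1) * θ) = -magnetization θ := by
  simp [magnetization, siteSpin]

theorem pairSpin_neg_one_mul (θ : V → ℤˣ) (e : Sym2 V) :
    pairSpin ((fun _ => -1) * θ) e = pairSpin θ e := by
  induction e using Sym2.inductionOn with
  | hf u v => simp [pairSpin_mk]

/-- Half of the partition function of an even Hamiltonian is carried by the windows. -/
theorem partitionSum_le_sum_windows {K : ℕ} (hK : 0 < K) {H : (V → ℤˣ) → ℝ}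
    (hH : ∀ θ, H ((fun _ => -1) * θ) = H θ) :
    partitionSum (uniformWeight V) H
      ≤ 2 * ∑ k ∈ Finset.range (K + 1), partitionSum (windowWeight V K k) H := by
  -- One of `θ` and `-θ` has non-negative magnetization, so the windows with `k ≥ 0` suffice up to a
  -- factor 2.
  have hpt : ∀ θ : V → ℤˣ, uniformWeight V θ ≤ ∑ k ∈ Finset.range (K + 1), windowWeight V K k θ
      + ∑ k ∈ Finset.range (K + 1), windowWeight V K k ((fun _ => -1) * θ) := by
    intro θ
    have hnn : ∀ θ : V → ℤˣ, 0 ≤ ∑ k ∈ Finset.range (K + 1), windowWeight V K k θ := fun θ =>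
      Finset.sum_nonneg fun k _ => windowWeight_nonneg K k θ
    rcases le_total 0 (magnetization θ) with h | h
    · obtain ⟨k, hk, he⟩ := exists_windowWeight hK h
      have := Finset.single_le_sum (f := fun k => windowWeight V K k θ)
        (fun k _ => windowWeight_nonneg K k θ) hk
      simp only [he] at this
      linarith [hnn ((fun _ => -1) * θ)]
    · obtain ⟨k, hk, he⟩ := exists_windowWeight (θ := (fun _ => -1) * θ) hK
        (by rw [magnetization_neg_one_mul]; linarith)
      have := Finset.single_le_sum (f := fun k => windowWeight V K k ((fun _ => -1) * θ))
        (fun k _ => windowWeight_nonneg K k _) hk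
      simp only [he] at this
      have he2 : uniformWeight V ((fun _ => -1) * θ) = uniformWeight V θ := rfl
      linarith [hnn θ]
  have hflip : ∀ k, ∑ θ, windowWeight V K k ((fun _ => -1) * θ) * Real.exp (H θ)
      = partitionSum (windowWeight V K k) H := fun k =>
    Fintype.sum_equiv (Equiv.mulLeft (fun _ => -1)) _ _ fun θ => by
      rw [Equiv.coe_mulLeft, hH]
  calc partitionSum (uniformWeight V) H
      ≤ ∑ θ, (∑ k ∈ Finset.range (K + 1), windowWeight V K k θ
        + ∑ k ∈ Finset.range (K + 1), windowWeight V K k ((fun _ => -1) * θ)) * Real.exp (H θ) :=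
        Finset.sum_le_sum fun θ _ => mul_le_mul_of_nonneg_right (hpt θ) (Real.exp_pos _).le
    _ = _ := by
        simp only [add_mul, Finset.sum_mul, Finset.sum_add_distrib]
        rw [Finset.sum_comm, Finset.sum_comm (s := Finset.univ)]
        simp only [hflip, two_mul]
        rfl

theorem modelEnergy_mono (G : SimpleGraph V) {δ : ℝ} (h0 : 0 ≤ δ) (h1 : δ < 1)
    {W W' : (V → ℤˣ) → ℝ} (hW : IsWeight W) (hW' : IsWeight W') (h : ∀ θ, W θ ≤ W' θ)
    {ι : Type} [Fintype ι] {s : ι → (V → ℤˣ) → ℝ} (hs : ∀ i θ, s i θ ^ 2 = 1) (r : ι → ℝ) :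
    modelEnergy G δ W s r ≤ modelEnergy G δ W' s r := by
  have hp := isProbabilityMeasure_noiseLaw G.edgeSet ι h0 h1
  refine sub_le_sub_right (integral_mono (integrable_logSum hW (obsSpin_sq G hs)
    (memLp_noiseLaw _ _ δ) _ _) (integrable_logSum hW' (obsSpin_sq G hs)
    (memLp_noiseLaw _ _ δ) _ _) fun x => logSum_mono hW h) _

theorem card_distinctPair_le : (Fintype.card (DistinctPair V) : ℝ) ≤ (Fintype.card V : ℝ) ^ 2 := by
  have h : Fintype.card (DistinctPair V) = (Fintype.card V).choose 2 := Sym2.card_subtype_not_diag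
  rw [h]
  exact_mod_cast (Nat.choose_le_pow _ _)

/-- The fluctuations of the free energy with spiked GOE side information. -/
theorem integral_abs_sub_le_goe (G : SimpleGraph V) {δ η : ℝ} (h0 : 0 ≤ δ) (h1 : δ < 1)
    (hη : 0 ≤ η) {W : (V → ℤˣ) → ℝ} (hW : IsWeight W) :
    ∫ x, |logSum W (spinField (obsSpin G offDiagSpin) fun i =>
        obsGain G.edgeSet δ (fun _ : DistinctPair V => √(η / Fintype.card V)) i * x i
          + obsMean G.edgeSet (fun _ : DistinctPair V => √(η / Fintype.card V)) i)
        - meanLogSum (noiseLaw G.edgeSet (DistinctPair V) δ) W (obsSpin G offDiagSpin)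
          (obsGain G.edgeSet δ fun _ : DistinctPair V => √(η / Fintype.card V))
          (obsMean G.edgeSet fun _ : DistinctPair V => √(η / Fintype.card V))|
        ∂Measure.pi (noiseLaw G.edgeSet (DistinctPair V) δ)
      ≤ √(4 * (invTemp δ ^ 2 * Fintype.card G.edgeSet + η * Fintype.card V)) := by
  have hp := isProbabilityMeasure_noiseLaw G.edgeSet (DistinctPair V) h0 h1
  refine ((coordLip_logSum hW (obsSpin_sq G offDiagSpin_sq) _ _).integral_abs_sub_integral_le
    (memLp_noiseLaw _ _ δ) (integral_abs_noiseLaw_le _ _ h0 h1)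
    fun i => (integral_sq_noiseLaw _ _ h0 h1 i).le).trans (Real.sqrt_le_sqrt ?_)
  rw [← Finset.mul_sum, Fintype.sum_sum_type]
  simp only [obsGain, Sum.elim_inl, Sum.elim_inr, sq_abs, Finset.sum_const, Finset.card_univ,
    nsmul_eq_mul]
  rw [Real.sq_sqrt (by positivity)]
  have h2 := card_distinctPair_le (V := V)
  -- At most `n²` pairs with squared gain `η/n` each: the variance is of order `n` although the
  -- noise has order `n²` coordinates.
  have h3 : (Fintype.card (DistinctPair V) : ℝ) * (η / Fintype.card V) ≤ η * Fintype.card V := by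
    rcases (Nat.cast_nonneg (α := ℝ) (Fintype.card V)).eq_or_lt with h | h
    · rw [← h]; simp
    · calc _ ≤ (Fintype.card V : ℝ) ^ 2 * (η / Fintype.card V) :=
            mul_le_mul_of_nonneg_right h2 (by positivity)
        _ = _ := by field_simp
  linarith

/-- The upper bound on the free energy with spiked GOE side information. -/
theorem goeEnergy_uniform_le [Nonempty V] (G : SimpleGraph V) {δ η a : ℝ} (h0 : 0 ≤ δ) (h1 : δ < 1)
    (hη : 0 ≤ η) {K : ℕ} (hK : 0 < K)
    (ha : ∀ k ∈ Finset.range (K + 1), scalarEnergy G δ (η * ((k : ℝ) / K)) (uniformWeight V)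
      - η * Fintype.card V * ((k : ℝ) / K) ^ 2 / 4 ≤ a) :
    goeEnergy G δ η (uniformWeight V) ≤ Real.log (2 * (K + 1)) + a
      + η * Fintype.card V / (2 * (K : ℝ) ^ 2)
      + (K + 1) * √(4 * (invTemp δ ^ 2 * Fintype.card G.edgeSet + η * Fintype.card V)) := by
  have hp := isProbabilityMeasure_noiseLaw G.edgeSet (DistinctPair V) h0 h1
  have hU := isWeight_uniformWeight (V := V)
  set r : DistinctPair V → ℝ := fun _ => √(η / Fintype.card V) with hr
  set P := Measure.pi (noiseLaw G.edgeSet (DistinctPair V) δ) with hP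
  set H : (G.edgeSet ⊕ DistinctPair V → ℝ) → (V → ℤˣ) → ℝ := fun x =>
    spinField (obsSpin G offDiagSpin) fun i => obsGain G.edgeSet δ r i * x i
      + obsMean G.edgeSet r i with hH
  set C := ∑ i, r i ^ 2 / 2 with hC
  set b := a + η * Fintype.card V / (2 * (K : ℝ) ^ 2) with hb
  set D := √(4 * (invTemp δ ^ 2 * Fintype.card G.edgeSet + η * Fintype.card V)) with hD
  -- A window without configurations has partition function zero and no meaningful logarithm, so it
  -- is left out.
  set T := (Finset.range (K + 1)).filter fun k => IsWeight (windowWeight V K k) with hT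
  have hTcard : (T.card : ℝ) ≤ K + 1 := by
    have := Finset.card_filter_le (Finset.range (K + 1)) fun k => IsWeight (windowWeight V K k)
    rw [Finset.card_range] at this
    exact_mod_cast this
  -- Interpolation within the window, with `ε = 1/K` giving the error `η n / (2 K²)`; the restricted
  -- scalar energy is then bounded by the unrestricted one.
  have hmean : ∀ k ∈ T, ∫ x, logSum (windowWeight V K k) (H x) ∂P ≤ b + C := by
    intro k hk
    obtain ⟨hkK, hW⟩ := Finset.mem_filter.1 hk
    have e1 := goeEnergy_le G h0 h1 hW (η := η) (q := (k : ℝ) / K) (ε := 1 / (K : ℝ)) hη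
      (by positivity) fun θ h => by
        by_contra hc
        exact h (if_neg hc)
    have e2 : scalarEnergy G δ (η * ((k : ℝ) / K)) (windowWeight V K k)
        ≤ scalarEnergy G δ (η * ((k : ℝ) / K)) (uniformWeight V) :=
      modelEnergy_mono G h0 h1 hW hU (windowWeight_le K k) siteSpin_sq _
    have e3 := ha k hkK
    have e4 : η * Fintype.card V * ((1 / (K : ℝ)) ^ 2 - ((k : ℝ) / K) ^ 2 / 2) / 2
        = η * Fintype.card V / (2 * (K : ℝ) ^ 2)
          - η * Fintype.card V * ((k : ℝ) / K) ^ 2 / 4 := by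
      have : (K : ℝ) ≠ 0 := by exact_mod_cast hK.ne'
      field_simp
      ring
    have e5 : goeEnergy G δ η (windowWeight V K k)
        = ∫ x, logSum (windowWeight V K k) (H x) ∂P - C := rfl
    rw [hb]
    linarith
  have hdev : ∀ k ∈ T, ∫ x, |logSum (windowWeight V K k) (H x)
      - ∫ y, logSum (windowWeight V K k) (H y) ∂P| ∂P ≤ D := fun k hk =>
    integral_abs_sub_le_goe G h0 h1 hη (Finset.mem_filter.1 hk).2
  have hint : ∀ W, IsWeight W → Integrable (fun x => logSum W (H x)) P := fun W hW =>
    integrable_logSum hW (obsSpin_sq G offDiagSpin_sq) (memLp_noiseLaw _ _ δ) _ _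
  -- The sum of the deviations dominates each of them, and its mean is at most `(K + 1) D`.
  set Δ : (G.edgeSet ⊕ DistinctPair V → ℝ) → ℝ := fun x => ∑ k ∈ T,
    |logSum (windowWeight V K k) (H x) - ∫ y, logSum (windowWeight V K k) (H y) ∂P| with hΔ
  have hdevi : ∀ k ∈ T, Integrable (fun x => |logSum (windowWeight V K k) (H x)
      - ∫ y, logSum (windowWeight V K k) (H y) ∂P|) P := fun k hk =>
    ((hint _ (Finset.mem_filter.1 hk).2).sub (integrable_const _)).abs
  have hΔi : Integrable Δ P := integrable_finsetSum _ hdevi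
  have hΔD : ∫ x, Δ x ∂P ≤ (K + 1) * D := by
    refine (integral_finsetSum _ hdevi).trans_le ?_
    refine (Finset.sum_le_card_nsmul _ _ _ hdev).trans ?_
    rw [nsmul_eq_mul]
    exact mul_le_mul_of_nonneg_right hTcard (Real.sqrt_nonneg _)
  have hpt : ∀ x, logSum (uniformWeight V) (H x) ≤ Real.log (2 * (K + 1)) + (b + C) + Δ x := by
    intro x
    have heven : ∀ θ, H x ((fun _ => -1) * θ) = H x θ := fun θ => by
      refine Finset.sum_congr rfl fun i _ => ?_
      rcases i with e | e
      · exact congrArg _ (pairSpin_neg_one_mul θ e.1)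
      · exact congrArg _ (pairSpin_neg_one_mul θ e.1)
    have h2 := partitionSum_le_sum_windows hK heven
    have h3 : ∑ k ∈ Finset.range (K + 1), partitionSum (windowWeight V K k) (H x)
        = ∑ k ∈ T, partitionSum (windowWeight V K k) (H x) := by
      refine (Finset.sum_subset (Finset.filter_subset _ _) fun k hk hkT => ?_).symm
      have hnot : ¬ IsWeight (windowWeight V K k) := fun h => hkT (Finset.mem_filter.2 ⟨hk, h⟩)
      refine Finset.sum_eq_zero fun θ _ => ?_
      have : windowWeight V K k θ = 0 := by
        by_contra h
        exact hnot ⟨windowWeight_nonneg K k,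
          ⟨θ, lt_of_le_of_ne (windowWeight_nonneg K k θ) (Ne.symm h)⟩⟩
      rw [this, zero_mul]
    have h4 : ∀ k ∈ T, partitionSum (windowWeight V K k) (H x) ≤ Real.exp (b + C + Δ x) := by
      intro k hk
      rw [← Real.log_le_iff_le_exp ((Finset.mem_filter.1 hk).2.partitionSum_pos _)]
      have h5 := Finset.single_le_sum (f := fun k => |logSum (windowWeight V K k) (H x)
        - ∫ y, logSum (windowWeight V K k) (H y) ∂P|) (fun k _ => abs_nonneg _) hk
      have h6 := le_abs_self (logSum (windowWeight V K k) (H x)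
        - ∫ y, logSum (windowWeight V K k) (H y) ∂P)
      have h7 := hmean k hk
      change logSum (windowWeight V K k) (H x) ≤ _
      change _ ≤ Δ x at h5
      linarith
    have h8 : partitionSum (uniformWeight V) (H x) ≤ 2 * (K + 1) * Real.exp (b + C + Δ x) := by
      rw [h3] at h2
      have := Finset.sum_le_card_nsmul _ _ _ h4
      rw [nsmul_eq_mul] at this
      have h9 := mul_le_mul_of_nonneg_right hTcard (Real.exp_pos (b + C + Δ x)).le
      linarith
    have h10 := Real.log_le_log (hU.partitionSum_pos _) h8
    rw [Real.log_mul (by positivity) (Real.exp_pos _).ne', Real.log_exp] at h10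
    change Real.log _ ≤ _
    linarith
  have hfin : ∫ x, logSum (uniformWeight V) (H x) ∂P
      ≤ Real.log (2 * (K + 1)) + (b + C) + (K + 1) * D := by
    refine (integral_mono (hint _ hU) ((integrable_const _).add hΔi) hpt).trans ?_
    simp only [Pi.add_apply]
    rw [integral_add (integrable_const _) hΔi, integral_const, probReal_univ, one_smul]
    linarith
  have e5 : goeEnergy G δ η (uniformWeight V)
      = ∫ x, logSum (uniformWeight V) (H x) ∂P - C := rfl
  rw [e5]
  linarith

end Windows

end LatticeSync
end

noncomputable section

namespace LatticeSync

/-! ### Almost additive functions of finite regions -/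

section Tiling

open Classical

variable {d : ℕ}

theorem latticeGraph_adj_iff {u v : Fin d → ℤ} :
    (latticeGraph d).Adj u v ↔ ∑ i, (u i - v i) ^ 2 = 1 := Iff.rfl

theorem abs_sub_le_one_of_adj {u v : Fin d → ℤ} (h : (latticeGraph d).Adj u v) (i : Fin d) :
    |u i - v i| ≤ 1 := by
  rw [← sq_le_one_iff_abs_le_one, ← latticeGraph_adj_iff.1 h]
  exact Finset.single_le_sum (f := fun i => (u i - v i) ^ 2) (fun _ _ => sq_nonneg _)
    (Finset.mem_univ i)

theorem adj_update (u : Fin d → ℤ) (i : Fin d) {t : ℤ} (ht : (u i - t) ^ 2 = 1) :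
    (latticeGraph d).Adj u (Function.update u i t) := by
  rw [latticeGraph_adj_iff, Finset.sum_eq_single i]
  · simpa using ht
  · intro j _ hj; simp [hj]
  · simp

/-- Neighbours differ by at most 1 in every coordinate and so lie in a cube of side 3; the exact
degree is not needed. -/
theorem card_filter_adj_le (S : Finset (Fin d → ℤ)) (u : Fin d → ℤ) :
    (S.filter fun v => (latticeGraph d).Adj u v).card ≤ 3 ^ d := by
  have hsub : (S.filter fun v => (latticeGraph d).Adj u v)
      ⊆ Fintype.piFinset fun i => Finset.Icc (u i - 1) (u i + 1) := by
    intro v hv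
    rw [Fintype.mem_piFinset]
    intro i
    have := abs_le.1 (abs_sub_le_one_of_adj (Finset.mem_filter.1 hv).2 i)
    rw [Finset.mem_Icc]
    omega
  refine (Finset.card_le_card hsub).trans (le_of_eq ?_)
  rw [Fintype.card_piFinset]
  have : ∀ i, (Finset.Icc (u i - 1) (u i + 1)).card = 3 := fun i => by
    rw [Int.card_Icc]; omega
  simp [this]

/-- The pairs of neighbours between two regions. -/
def crossPairs (B B' : Finset (Fin d → ℤ)) : Finset ((Fin d → ℤ) × (Fin d → ℤ)) :=
  (B ×ˢ B').filter fun p => (latticeGraph d).Adj p.1 p.2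

theorem card_crossPairs_le {B B' S : Finset (Fin d → ℤ)}
    (h : ∀ u ∈ B, ∀ v ∈ B', (latticeGraph d).Adj u v → u ∈ S) :
    (crossPairs B B').card ≤ S.card * 3 ^ d := by
  have hmaps : ∀ p ∈ crossPairs B B', p.1 ∈ S := fun p hp => by
    obtain ⟨h1, h2⟩ := Finset.mem_filter.1 hp
    obtain ⟨h3, h4⟩ := Finset.mem_product.1 h1
    exact h _ h3 _ h4 h2
  refine (Finset.card_le_mul_card_image_of_maps_to hmaps (3 ^ d) fun u hu => ?_).trans
    (le_of_eq (mul_comm _ _))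
  refine (Finset.card_le_card_of_injOn Prod.snd (t := B'.filter fun v => (latticeGraph d).Adj u v)
    ?_ ?_).trans (card_filter_adj_le _ u)
  · rintro ⟨a, v⟩ hp
    obtain ⟨h1, rfl⟩ := Finset.mem_filter.1 hp
    obtain ⟨h2, h3⟩ := Finset.mem_filter.1 h1
    exact Finset.mem_filter.2 ⟨(Finset.mem_product.1 h2).2, h3⟩
  · rintro ⟨a, v⟩ hp ⟨a', v'⟩ hp' hv
    have e1 := (Finset.mem_filter.1 hp).2
    have e2 := (Finset.mem_filter.1 hp').2
    simp only at e1 e2 hv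
    rw [e1, e2, hv]

/-- The translate of a region. -/
def translate (a : Fin d → ℤ) (B : Finset (Fin d → ℤ)) : Finset (Fin d → ℤ) :=
  B.map (Equiv.addRight a).toEmbedding

theorem mem_translate {a u : Fin d → ℤ} {B : Finset (Fin d → ℤ)} :
    u ∈ translate a B ↔ u - a ∈ B := by
  simp [translate, Finset.mem_map_equiv, Equiv.addRight_symm, sub_eq_add_neg]

theorem card_translate (a : Fin d → ℤ) (B : Finset (Fin d → ℤ)) :
    (translate a B).card = B.card := Finset.card_map _

theorem adj_sub_iff {a u v : Fin d → ℤ} :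
    (latticeGraph d).Adj (u - a) (v - a) ↔ (latticeGraph d).Adj u v := by
  simp [latticeGraph_adj_iff]

theorem boundary_translate (a : Fin d → ℤ) (B : Finset (Fin d → ℤ)) :
    boundary (translate a B) = translate a (boundary B) := by
  ext u
  simp only [boundary, mem_translate, Finset.mem_filter]
  refine and_congr_right fun _ => ⟨?_, ?_⟩
  · rintro ⟨v, h1, h2⟩
    exact ⟨v - a, adj_sub_iff.2 h1, h2⟩
  · rintro ⟨v, h1, h2⟩
    refine ⟨v + a, ?_, by simpa using h2⟩
    rw [← adj_sub_iff (a := a)]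
    simpa using h1

/-- The error in the additivity of `F` is at most `b` for each pair of neighbours that is cut. -/
structure AlmostAdditive (F : Finset (Fin d → ℤ) → ℝ) (b : ℝ) : Prop where
  translate : ∀ a B, F (translate a B) = F B
  union : ∀ B B', Disjoint B B' → |F (B ∪ B') - F B - F B'| ≤ b * (crossPairs B B').card

/-- The cube of side `L`. -/
def box (d L : ℕ) : Finset (Fin d → ℤ) := Fintype.piFinset fun _ => Finset.Ico 0 (L : ℤ)

theorem card_box (d L : ℕ) : (box d L).card = L ^ d := by
  simp [box, Fintype.card_piFinset]

/-- The index of the tile of side `L` which contains `u`. -/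
def tileIndex (L : ℕ) (u : Fin d → ℤ) : Fin d → ℤ := fun i => u i / L

/-- The tile of side `L` with index `a`. -/
def tile (L : ℕ) (a : Fin d → ℤ) : Finset (Fin d → ℤ) := translate (fun i => L * a i) (box d L)

theorem mem_tile {L : ℕ} (hL : 0 < L) {a u : Fin d → ℤ} : u ∈ tile L a ↔ tileIndex L u = a := by
  have hL' : (0 : ℤ) < L := by exact_mod_cast hL
  simp only [tile, mem_translate, box, Fintype.mem_piFinset, Finset.mem_Ico, tileIndex,
    funext_iff, Pi.sub_apply]
  refine forall_congr' fun i => ?_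
  rw [Int.ediv_eq_iff_of_pos hL']
  constructor
  · rintro ⟨h1, h2⟩; constructor <;> nlinarith
  · rintro ⟨h1, h2⟩; constructor <;> nlinarith

/-- Walk inside the tile from `u` to `v` by unit steps in one coordinate, by induction on the ℓ¹
distance. The last site before the walk first leaves `B` is the one sought. -/
theorem exists_mem_boundary_of_tile {L : ℕ} (hL : 0 < L) {B : Finset (Fin d → ℤ)}
    {u v : Fin d → ℤ} (hu : u ∈ B) (hv : v ∉ B) (h : tileIndex L u = tileIndex L v) :
    ∃ x ∈ boundary B, tileIndex L x = tileIndex L v := by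
  have key : ∀ (n : ℕ) (u : Fin d → ℤ), u ∈ B → tileIndex L u = tileIndex L v →
      ∑ i, (u i - v i).natAbs = n → ∃ x ∈ boundary B, tileIndex L x = tileIndex L v := by
    intro n
    induction n with
    | zero =>
      intro u hu _ hn
      rw [Finset.sum_eq_zero_iff] at hn
      have : u = v := funext fun i => by
        have := hn i (Finset.mem_univ i)
        omega
      exact absurd (this ▸ hu) hv
    | succ n ih =>
      intro u hu hτ hn
      have hne : ∃ i, u i ≠ v i := by
        by_contra hcon
        push Not at hcon
        simp [hcon] at hn
      obtain ⟨i, hi⟩ := hne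
      -- The step goes towards `v i`, so `t` lies between `u i` and `v i`, and monotonicity of the
      -- division keeps it in the tile.
      obtain ⟨t, ht1, ht2, ht3⟩ : ∃ t : ℤ, (u i - t) ^ 2 = 1 ∧ t / L = v i / L ∧
          (t - v i).natAbs + 1 = (u i - v i).natAbs := by
        have hL' : (0 : ℤ) ≤ L := Int.natCast_nonneg L
        have hτi : u i / L = v i / L := congrFun hτ i
        rcases lt_or_gt_of_ne hi with hlt | hgt
        · refine ⟨u i + 1, by ring, ?_, by omega⟩
          exact le_antisymm (Int.ediv_le_ediv (by exact_mod_cast hL) (by omega))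
            (hτi ▸ Int.ediv_le_ediv (by exact_mod_cast hL) (by omega))
        · refine ⟨u i - 1, by ring, ?_, by omega⟩
          exact le_antisymm (hτi ▸ Int.ediv_le_ediv (by exact_mod_cast hL) (by omega))
            (Int.ediv_le_ediv (by exact_mod_cast hL) (by omega))
      by_cases hmem : Function.update u i t ∈ B
      · refine ih _ hmem ?_ ?_
        · ext j
          by_cases hj : j = i
          · subst hj; simpa [tileIndex] using ht2
          · simpa [tileIndex, hj] using congrFun hτ j
        · rw [← Finset.add_sum_erase _ _ (Finset.mem_univ i)] at hn ⊢
          have : ∑ j ∈ Finset.univ.erase i, (Function.update u i t j - v j).natAbs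
              = ∑ j ∈ Finset.univ.erase i, (u j - v j).natAbs :=
            Finset.sum_congr rfl fun j hj => by
              rw [Function.update_of_ne (Finset.ne_of_mem_erase hj)]
          rw [this, Function.update_self]
          omega
      · exact ⟨u, Finset.mem_filter.2 ⟨hu, _, adj_update u i ht1, hmem⟩, hτ⟩
  exact key _ u hu h rfl

variable {F : Finset (Fin d → ℤ) → ℝ} {b : ℝ}

theorem AlmostAdditive.empty (hF : AlmostAdditive F b) : F ∅ = 0 := by
  have := hF.union ∅ ∅ (Finset.disjoint_empty_left _)
  simp only [crossPairs, Finset.empty_product, Finset.filter_empty, Finset.card_empty,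
    Nat.cast_zero, mul_zero, Finset.empty_union] at this
  have h := abs_nonpos_iff.1 this
  linarith

theorem AlmostAdditive.singleton (hF : AlmostAdditive F b) (u : Fin d → ℤ) : F {u} = F {0} := by
  rw [← hF.translate u {0}]
  congr 1
  ext v
  simp [mem_translate, sub_eq_zero]

/-- Sites are added one at a time; each brings `F {0}`, by translation invariance, and at most `3^d`
cut pairs. -/
theorem AlmostAdditive.abs_le (hF : AlmostAdditive F b) (hb : 0 ≤ b) (B : Finset (Fin d → ℤ)) :
    |F B| ≤ (|F {0}| + b * 3 ^ d) * B.card := by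
  induction B using Finset.induction_on with
  | empty => simp [hF.empty]
  | insert u B hu ih =>
    have h := hF.union {u} B (Finset.disjoint_singleton_left.2 hu)
    rw [hF.singleton, ← Finset.insert_eq] at h
    have h2 : ((crossPairs {u} B).card : ℝ) ≤ 3 ^ d := by
      have := card_crossPairs_le (B := {u}) (B' := B) (S := {u}) fun _ h _ _ _ => h
      rw [Finset.card_singleton, one_mul] at this
      exact_mod_cast this
    have h3 := mul_le_mul_of_nonneg_left h2 hb
    rw [Finset.card_insert_of_notMem hu]
    push_cast
    have h4 : |F (insert u B)| ≤ |F (insert u B) - F {0} - F B| + |F {0}| + |F B| := by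
      calc _ = |(F (insert u B) - F {0} - F B) + F {0} + F B| := by ring_nf
        _ ≤ _ := (abs_add_le _ _).trans (add_le_add_left (abs_add_le _ _) _)
    linarith

/-- The part of `B` in a tile. -/
def tilePart (L : ℕ) (B : Finset (Fin d → ℤ)) (a : Fin d → ℤ) : Finset (Fin d → ℤ) :=
  B.filter fun u => tileIndex L u = a

theorem tilePart_subset_tile {L : ℕ} (hL : 0 < L) (B : Finset (Fin d → ℤ)) (a : Fin d → ℤ) :
    tilePart L B a ⊆ tile L a := fun _ hu => (mem_tile hL).2 (Finset.mem_filter.1 hu).2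

/-- Tiles are detached one at a time. A pair cut when tile `a` is detached has its first end in the
boundary of that tile. -/
theorem AlmostAdditive.abs_sub_sum_tiles (hF : AlmostAdditive F b) (hb : 0 ≤ b) {L : ℕ}
    (hL : 0 < L) (B A : Finset (Fin d → ℤ)) :
    |F (B.filter fun u => tileIndex L u ∈ A) - ∑ a ∈ A, F (tilePart L B a)|
      ≤ ∑ a ∈ A, b * 3 ^ d * (tilePart L B a ∩ boundary (tile L a)).card := by
  induction A using Finset.induction_on with
  | empty => simp [hF.empty]
  | insert a A ha ih =>
    rw [Finset.sum_insert ha, Finset.sum_insert ha]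
    have e : (B.filter fun u => tileIndex L u ∈ insert a A)
        = tilePart L B a ∪ B.filter fun u => tileIndex L u ∈ A := by
      ext u
      simp only [tilePart, Finset.mem_filter, Finset.mem_insert, Finset.mem_union]
      tauto
    have hd : Disjoint (tilePart L B a) (B.filter fun u => tileIndex L u ∈ A) := by
      rw [Finset.disjoint_left]
      intro u h1 h2
      rw [tilePart, Finset.mem_filter] at h1
      rw [Finset.mem_filter] at h2
      exact ha (h1.2 ▸ h2.2)
    have h1 := hF.union _ _ hd
    have h2 : ((crossPairs (tilePart L B a) (B.filter fun u => tileIndex L u ∈ A)).card : ℝ)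
        ≤ (tilePart L B a ∩ boundary (tile L a)).card * 3 ^ d := by
      have := card_crossPairs_le (B := tilePart L B a) (B' := B.filter fun u => tileIndex L u ∈ A)
        (S := tilePart L B a ∩ boundary (tile L a)) fun u hu v hv huv =>
          Finset.mem_inter.2 ⟨hu, Finset.mem_filter.2
            ⟨tilePart_subset_tile hL B a hu, v, huv, fun hva =>
              ha ((mem_tile hL).1 hva ▸ (Finset.mem_filter.1 hv).2)⟩⟩
      exact_mod_cast this
    have h3 := mul_le_mul_of_nonneg_left h2 hb
    rw [e]
    set x := F (tilePart L B a ∪ B.filter fun u => tileIndex L u ∈ A)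
    set y := F (B.filter fun u => tileIndex L u ∈ A)
    calc _ = |(x - F (tilePart L B a) - y) + (y - ∑ a ∈ A, F (tilePart L B a))| := by ring_nf
      _ ≤ _ := abs_add_le _ _
      _ ≤ _ := by linarith

/-- Tiles inside `B` contribute exactly `F (box d L)`, up to a cut cost proportional to the boundary
of the cube. Every other tile meeting `B` contains a boundary site of `B`, so there are at most
`|∂B|` of them, each with an error of order `L^d`. -/
theorem AlmostAdditive.abs_sub_le (hF : AlmostAdditive F b) (hb : 0 ≤ b) {L : ℕ} (hL : 0 < L)
    (B : Finset (Fin d → ℤ)) :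
    |F B - B.card * (F (box d L) / (L : ℝ) ^ d)|
      ≤ (2 * |F {0}| + 3 * (b * 3 ^ d)) * (B.card * ((boundary (box d L)).card / (L : ℝ) ^ d)
        + (L : ℝ) ^ d * (boundary B).card) := by
  set N : ℝ := (L : ℝ) ^ d with hN
  have hN0 : 0 < N := by have : (0 : ℝ) < L := by exact_mod_cast hL
                         positivity
  set κ := F (box d L) / N with hκ
  set c := b * 3 ^ d with hc
  have hc0 : 0 ≤ c := by positivity
  set C := |F {0}| + c with hC
  have hC0 : 0 ≤ C := by positivity
  have hκC : |κ| ≤ C := by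
    rw [hκ, abs_div, abs_of_pos hN0, div_le_iff₀ hN0]
    have := hF.abs_le hb (box d L)
    rwa [card_box, Nat.cast_pow] at this
  set A := B.image (tileIndex L) with hA
  have hBA : (B.filter fun u => tileIndex L u ∈ A) = B :=
    Finset.filter_true_of_mem fun u hu => Finset.mem_image_of_mem _ hu
  have h1 := hF.abs_sub_sum_tiles hb hL B A
  rw [hBA] at h1
  have hcard : (B.card : ℝ) = ∑ a ∈ A, ((tilePart L B a).card : ℝ) := by
    rw [Finset.card_eq_sum_card_image (tileIndex L) B]
    push_cast
    rfl
  have htile : ∀ a : Fin d → ℤ, ((tile L a).card : ℝ) = N := fun a => by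
    rw [tile, card_translate, card_box, Nat.cast_pow]
  set good := A.filter fun a => tile L a ⊆ B with hgood
  set bad := A.filter fun a => ¬ tile L a ⊆ B with hbad
  have hgoodpart : ∀ a ∈ good, tilePart L B a = tile L a := fun a ha => by
    refine (tilePart_subset_tile hL B a).antisymm fun u hu => Finset.mem_filter.2
      ⟨(Finset.mem_filter.1 ha).2 hu, (mem_tile hL).1 hu⟩
  have hngood : good.card * N ≤ B.card := by
    rw [hcard, ← nsmul_eq_mul]
    calc good.card • N = ∑ a ∈ good, ((tilePart L B a).card : ℝ) := by
          rw [Finset.sum_congr rfl fun a ha => by rw [hgoodpart a ha, htile a]]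
          simp
      _ ≤ _ := Finset.sum_le_sum_of_subset_of_nonneg (Finset.filter_subset _ _)
          fun _ _ _ => Nat.cast_nonneg _
  have hnbad : (bad.card : ℝ) ≤ (boundary B).card := by
    have hsub : bad ⊆ (boundary B).image (tileIndex L) := by
      intro a ha
      obtain ⟨h2, h3⟩ := Finset.mem_filter.1 ha
      obtain ⟨u, hu, rfl⟩ := Finset.mem_image.1 h2
      obtain ⟨v, hv, hvB⟩ := Finset.not_subset.1 h3
      have hv' := (mem_tile hL).1 hv
      obtain ⟨x, hx, hxv⟩ := exists_mem_boundary_of_tile hL hu hvB hv'.symm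
      exact Finset.mem_image.2 ⟨x, hx, hxv.trans hv'⟩
    exact_mod_cast (Finset.card_le_card hsub).trans Finset.card_image_le
  -- In a tile not contained in `B`, the value of `F` and its prediction by `κ` are each at most `C
  -- N`, and the cut pairs cost at most `c N`.
  have hterm : ∀ a ∈ A, |F (tilePart L B a) - (tilePart L B a).card * κ|
      + c * (tilePart L B a ∩ boundary (tile L a)).card
      ≤ (if tile L a ⊆ B then c * (boundary (box d L)).card else 0)
        + (if ¬ tile L a ⊆ B then (2 * C + c) * N else 0) := by
    intro a ha
    by_cases hg : tile L a ⊆ B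
    · have hp := hgoodpart a (Finset.mem_filter.2 ⟨ha, hg⟩)
      rw [if_pos hg, if_neg (not_not.2 hg), hp, htile, tile, hF.translate, hκ,
        mul_div_cancel₀ _ hN0.ne', sub_self, abs_zero, zero_add, add_zero, boundary_translate]
      refine mul_le_mul_of_nonneg_left ?_ hc0
      exact_mod_cast (Finset.card_le_card Finset.inter_subset_right).trans
        (card_translate _ _).le
    · rw [if_neg hg, if_pos hg, zero_add]
      have hp : ((tilePart L B a).card : ℝ) ≤ N := by
        rw [← htile a]
        exact_mod_cast Finset.card_le_card (tilePart_subset_tile hL B a)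
      have hp2 : ((tilePart L B a ∩ boundary (tile L a)).card : ℝ) ≤ (tilePart L B a).card := by
        exact_mod_cast Finset.card_le_card Finset.inter_subset_left
      have q1 := hF.abs_le hb (tilePart L B a)
      have q2 : |(tilePart L B a).card * κ| ≤ (tilePart L B a).card * C := by
        rw [abs_mul, Nat.abs_cast]
        exact mul_le_mul_of_nonneg_left hκC (Nat.cast_nonneg _)
      have q3 := abs_sub (F (tilePart L B a)) ((tilePart L B a).card * κ)
      have q4 := mul_le_mul_of_nonneg_left hp hC0
      have q5 := mul_le_mul_of_nonneg_left (hp2.trans hp) hc0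
      linarith
  have hsum := Finset.sum_le_sum hterm
  rw [Finset.sum_add_distrib, Finset.sum_add_distrib, ← Finset.sum_filter, ← Finset.sum_filter,
    Finset.sum_const, Finset.sum_const, nsmul_eq_mul, nsmul_eq_mul] at hsum
  have h2 : |∑ a ∈ A, F (tilePart L B a) - B.card * κ|
      ≤ ∑ a ∈ A, |F (tilePart L B a) - (tilePart L B a).card * κ| := by
    rw [hcard, Finset.sum_mul, ← Finset.sum_sub_distrib]
    exact Finset.abs_sum_le_sum_abs _ _
  have h3 : |F B - B.card * κ| ≤ |F B - ∑ a ∈ A, F (tilePart L B a)|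
      + |∑ a ∈ A, F (tilePart L B a) - B.card * κ| := by
    calc _ = |(F B - ∑ a ∈ A, F (tilePart L B a))
          + (∑ a ∈ A, F (tilePart L B a) - B.card * κ)| := by ring_nf
      _ ≤ _ := abs_add_le _ _
  have h4 : (good.card : ℝ) * (c * (boundary (box d L)).card)
      ≤ c * (B.card * ((boundary (box d L)).card / N)) := by
    have : (good.card : ℝ) ≤ B.card / N := by rwa [le_div_iff₀ hN0]
    have := mul_le_mul_of_nonneg_right this
      (show 0 ≤ c * ((boundary (box d L)).card : ℝ) by positivity)
    refine this.trans (le_of_eq ?_)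
    field_simp
  have h5 : (bad.card : ℝ) * ((2 * C + c) * N) ≤ (2 * C + c) * (N * (boundary B).card) := by
    have := mul_le_mul_of_nonneg_right hnbad (show 0 ≤ (2 * C + c) * N by positivity)
    linarith
  have h6 : 0 ≤ (2 * C) * (B.card * (((boundary (box d L)).card : ℝ) / N)) := by positivity
  have h7 : 2 * |F {0}| + 3 * c = 2 * C + c := by rw [hC]; ring
  rw [h7]
  linarith

/-- Sites of the inner cube of side `L - 2` have all their neighbours in the box. -/
theorem card_boundary_box_le (d : ℕ) {L : ℕ} (hL : 2 ≤ L) :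
    ((boundary (box d L)).card : ℝ) ≤ (L : ℝ) ^ d - ((L : ℝ) - 2) ^ d := by
  set I : Finset (Fin d → ℤ) := Fintype.piFinset fun _ => Finset.Ico 1 ((L : ℤ) - 1) with hI
  have hIc : (I.card : ℝ) = ((L : ℝ) - 2) ^ d := by
    have h1 : ((L : ℤ) - 1 - 1).toNat = L - 2 := by omega
    rw [hI, Fintype.card_piFinset]
    simp only [Int.card_Ico, h1, Finset.prod_const, Finset.card_univ, Fintype.card_fin]
    push_cast [Nat.cast_sub hL]
    rfl
  have hIb : I ⊆ box d L := fun u hu => by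
    rw [hI, Fintype.mem_piFinset] at hu
    rw [box, Fintype.mem_piFinset]
    intro i
    have := Finset.mem_Ico.1 (hu i)
    rw [Finset.mem_Ico]
    omega
  have hdis : boundary (box d L) ⊆ box d L \ I := by
    intro u hu
    obtain ⟨h1, v, huv, hv⟩ := Finset.mem_filter.1 hu
    refine Finset.mem_sdiff.2 ⟨h1, fun huI => hv ?_⟩
    rw [hI, Fintype.mem_piFinset] at huI
    rw [box, Fintype.mem_piFinset]
    intro i
    have h2 := Finset.mem_Ico.1 (huI i)
    have h3 := abs_le.1 (abs_sub_le_one_of_adj huv i)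
    rw [Finset.mem_Ico]
    omega
  have h := Finset.card_le_card hdis
  rw [Finset.card_sdiff_of_subset hIb, card_box] at h
  have h2 : I.card ≤ L ^ d := card_box d L ▸ Finset.card_le_card hIb
  rw [← hIc]
  have h3 : ((L ^ d - I.card : ℕ) : ℝ) = (L : ℝ) ^ d - I.card := by
    rw [Nat.cast_sub h2, Nat.cast_pow]
  rw [← h3]
  exact_mod_cast h

theorem tendsto_boundary_box (d : ℕ) :
    Tendsto (fun L : ℕ => ((boundary (box d L)).card : ℝ) / (L : ℝ) ^ d) atTop (𝓝 0) := by
  have h1 : Tendsto (fun L : ℕ => 1 - (1 - 2 / (L : ℝ)) ^ d) atTop (𝓝 (1 - (1 - 0) ^ d)) :=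
    tendsto_const_nhds.sub ((tendsto_const_nhds.sub
      (tendsto_const_div_atTop_nhds_zero_nat 2)).pow d)
  rw [sub_zero, one_pow, sub_self] at h1
  refine tendsto_of_tendsto_of_tendsto_of_le_of_le' tendsto_const_nhds h1
    (Eventually.of_forall fun L => by positivity) ?_
  filter_upwards [eventually_ge_atTop 2] with L hL
  have hL0 : (0 : ℝ) < L := by exact_mod_cast (by omega : 0 < L)
  rw [div_le_iff₀ (by positivity), sub_mul, one_mul, ← mul_pow]
  have : (1 - 2 / (L : ℝ)) * L = L - 2 := by field_simp
  rw [this]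
  exact card_boundary_box_le d hL

theorem AlmostAdditive.abs_div_sub_le (hF : AlmostAdditive F b) (hb : 0 ≤ b) {L : ℕ} (hL : 0 < L)
    {B : Finset (Fin d → ℤ)} (hB : B.Nonempty) :
    |F B / B.card - F (box d L) / (L : ℝ) ^ d|
      ≤ (2 * |F {0}| + 3 * (b * 3 ^ d)) * ((boundary (box d L)).card / (L : ℝ) ^ d
        + (L : ℝ) ^ d * ((boundary B).card / B.card)) := by
  have hB0 : (0 : ℝ) < B.card := by exact_mod_cast hB.card_pos
  have h := hF.abs_sub_le hb hL B
  have e : F B / B.card - F (box d L) / (L : ℝ) ^ d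
      = (F B - B.card * (F (box d L) / (L : ℝ) ^ d)) / B.card := by field_simp
  rw [e, abs_div, abs_of_pos hB0, div_le_iff₀ hB0]
  refine h.trans (le_of_eq ?_)
  field_simp

/-- An almost additive function has a density along all sequences of regions with negligible
boundary. -/
theorem AlmostAdditive.exists_tendsto (hF : AlmostAdditive F b) (hb : 0 ≤ b) :
    ∃ l : ℝ, ∀ B : ℕ → Finset (Fin d → ℤ), (∀ᶠ n in atTop, (B n).Nonempty) →
      Tendsto (fun n => ((boundary (B n)).card : ℝ) / ((B n).card : ℝ)) atTop (𝓝 0) →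
      Tendsto (fun n => F (B n) / (B n).card) atTop (𝓝 l) := by
  set C := 2 * |F {0}| + 3 * (b * 3 ^ d) with hC
  have hC0 : 0 ≤ C := by positivity
  -- For fixed `L` the error from the boundary of `B n` vanishes as `n → ∞`; the remaining one is
  -- small once `L` is large.
  have key : ∀ B : ℕ → Finset (Fin d → ℤ), (∀ᶠ n in atTop, (B n).Nonempty) →
      Tendsto (fun n => ((boundary (B n)).card : ℝ) / ((B n).card : ℝ)) atTop (𝓝 0) →
      ∀ ε > 0, ∃ L₀ : ℕ, ∀ L ≥ L₀, ∀ᶠ n in atTop,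
        |F (B n) / (B n).card - F (box d L) / (L : ℝ) ^ d| < ε := by
    intro B hB hlim ε hε
    have h1 : ∀ᶠ L : ℕ in atTop, C * (((boundary (box d L)).card : ℝ) / (L : ℝ) ^ d) < ε := by
      have := (tendsto_boundary_box d).const_mul C
      rw [mul_zero] at this
      exact this.eventually_lt_const hε
    obtain ⟨L₀, hL₀⟩ := eventually_atTop.1 (h1.and (eventually_gt_atTop 0))
    refine ⟨L₀, fun L hL => ?_⟩
    obtain ⟨h2, h3⟩ := hL₀ L hL
    have h4 := ((tendsto_const_nhds (x := ((boundary (box d L)).card : ℝ) / (L : ℝ) ^ d)).add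
      (hlim.const_mul ((L : ℝ) ^ d))).const_mul C
    rw [mul_zero, add_zero] at h4
    filter_upwards [h4.eventually_lt_const h2, hB] with n hn hne
    exact (hF.abs_div_sub_le hb h3 hne).trans_lt hn
  have hbox : ∀ᶠ L : ℕ in atTop, (box d L).Nonempty := by
    filter_upwards [eventually_gt_atTop 0] with L hL
    rw [← Finset.card_pos, card_box]
    positivity
  have hcb : ∀ L : ℕ, ((box d L).card : ℝ) = (L : ℝ) ^ d := fun L => by
    rw [card_box, Nat.cast_pow]
  -- The boxes are themselves such a sequence, so their densities can be compared with that of one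
  -- fixed box.
  have hcauchy : CauchySeq fun L : ℕ => F (box d L) / (L : ℝ) ^ d := by
    rw [Metric.cauchySeq_iff]
    intro ε hε
    obtain ⟨L, hL⟩ := key (fun L => box d L) hbox
      (by simpa only [hcb] using tendsto_boundary_box d) (ε / 2) (half_pos hε)
    obtain ⟨N, hN⟩ := eventually_atTop.1 (hL L le_rfl)
    refine ⟨N, fun m hm n hn => ?_⟩
    have h1 := hN m hm
    have h2 := hN n hn
    simp only [hcb] at h1 h2
    rw [Real.dist_eq]
    rw [abs_sub_comm] at h2
    calc _ = |(F (box d m) / (m : ℝ) ^ d - F (box d L) / (L : ℝ) ^ d)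
          + (F (box d L) / (L : ℝ) ^ d - F (box d n) / (n : ℝ) ^ d)| := by ring_nf
      _ ≤ _ := abs_add_le _ _
      _ < ε := by linarith
  obtain ⟨l, hl⟩ := cauchySeq_tendsto_of_complete hcauchy
  refine ⟨l, fun B hB hlim => ?_⟩
  rw [Metric.tendsto_nhds]
  intro ε hε
  obtain ⟨L₀, hL₀⟩ := key B hB hlim (ε / 2) (half_pos hε)
  obtain ⟨L, hL1, hL2⟩ := ((eventually_ge_atTop L₀).and
    ((Metric.tendsto_nhds.1 hl) (ε / 2) (half_pos hε))).exists
  filter_upwards [hL₀ L hL1] with n hn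
  rw [Real.dist_eq] at hL2 ⊢
  calc _ = |(F (B n) / (B n).card - F (box d L) / (L : ℝ) ^ d)
        + (F (box d L) / (L : ℝ) ^ d - l)| := by ring_nf
    _ ≤ _ := abs_add_le _ _
    _ < ε := by linarith

end Tiling

end LatticeSync
end

noncomputable section

namespace LatticeSync

open Classical

/-! ### Free energies of regions -/

/-- Reduced to the sum over all distinct pairs by extending `F` by zero off the edges. -/
theorem two_mul_sum_edgeSet {V : Type} [Fintype V] (G : SimpleGraph V) (F : Sym2 V → ℝ) :
    2 * ∑ e : G.edgeSet, F e.1 = ∑ u, ∑ v with G.Adj u v, F s(u, v) := by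
  have h := two_mul_sum_distinctPair fun e => if e ∈ G.edgeSet then F e else 0
  have hg : Function.Injective fun e : G.edgeSet =>
      (⟨e.1, G.not_isDiag_of_mem_edgeSet e.2⟩ : DistinctPair V) := fun e e' h => by
    simpa [Subtype.ext_iff] using h
  rw [sum_eq_sum_comp hg] at h
  · simp only [Subtype.coe_prop, if_true] at h
    rw [h, Finset.sum_filter, Fintype.sum_prod_type]
    refine Finset.sum_congr rfl fun u _ => ?_
    rw [Finset.sum_filter]
    refine Finset.sum_congr rfl fun v _ => ?_
    by_cases huv : G.Adj u v <;> simp [huv, SimpleGraph.mem_edgeSet]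
    exact fun h => absurd (h ▸ huv) G.irrefl
  · intro e he
    refine if_neg fun h => he ⟨⟨e.1, h⟩, rfl⟩

theorem expect_goeHamiltonian {V : Type} [Fintype V] (inst : Fintype (DistinctPair V))
    (G : SimpleGraph V) {δ η : ℝ} (h0 : 0 ≤ δ) (h1 : δ < 1) (hη : 0 ≤ η) :
    expect (ι := DistinctPair V) G δ (fun θ₀ ξ Z => logPartition fun θ =>
      edgeHamiltonian G δ (edgeObs G θ₀ ξ) θ + goeHamiltonian η (goeObs η θ₀ Z) θ)
      = goeEnergy G δ η (uniformWeight V) := by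
  obtain rfl : inst = Subtype.fintype _ := Subsingleton.elim _ _
  have hn : (0 : ℝ) ≤ η / Fintype.card V := by positivity
  have h2 : η / (2 * (Fintype.card V : ℝ)) = η / Fintype.card V / 2 := by
    rw [div_div, mul_comm]
  refine Eq.trans ?_ (expect_eq_modelEnergy G h0 h1 offDiagSpin_sq offDiagSpin_mul
    fun _ => √(η / Fintype.card V))
  simp only [goeHamiltonian, goeObs, Real.sq_sqrt hn, offDiagSpin, h2]

variable {d : ℕ}

theorem sum_regionGraph (B : Finset (Fin d → ℤ)) (f : (Fin d → ℤ) → (Fin d → ℤ) → ℝ) :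
    ∑ u : B, ∑ v : B with (regionGraph B).Adj u v, f u v
      = ∑ u ∈ B, ∑ v ∈ B with (latticeGraph d).Adj u v, f u v := by
  rw [← Finset.sum_coe_sort B]
  refine Finset.sum_congr rfl fun u _ => ?_
  rw [Finset.sum_filter, Finset.sum_filter, ← Finset.sum_coe_sort B]
  rfl

theorem card_edgeSet_regionGraph_le (B : Finset (Fin d → ℤ)) :
    (Fintype.card (regionGraph B).edgeSet : ℝ) ≤ 3 ^ d * B.card := by
  have h := two_mul_sum_edgeSet (regionGraph B) fun _ => 1
  rw [sum_regionGraph B fun _ _ => 1] at h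
  have h2 : ∑ u ∈ B, ∑ v ∈ B with (latticeGraph d).Adj u v, (1 : ℝ) ≤ ∑ u ∈ B, (3 : ℝ) ^ d := by
    refine Finset.sum_le_sum fun u _ => ?_
    rw [Finset.sum_const, nsmul_eq_mul, mul_one]
    exact_mod_cast card_filter_adj_le B u
  simp only [Finset.sum_const, nsmul_eq_mul, mul_one, Finset.card_univ] at h h2
  have h3 : (0 : ℝ) ≤ Fintype.card (regionGraph B).edgeSet := by positivity
  linarith

theorem scalarFreeEnergy_eq (B : Finset (Fin d → ℤ)) {δ lam : ℝ} (h0 : 0 ≤ δ) (h1 : δ < 1)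
    (hlam : 0 ≤ lam) : scalarFreeEnergy δ lam B
      = scalarEnergy (regionGraph B) δ lam (uniformWeight B) / B.card := by
  have h := expect_eq_modelEnergy (regionGraph B) h0 h1 siteSpin_sq siteSpin_mul fun _ => √lam
  rw [scalarFreeEnergy, one_div_mul_eq_div]
  congr 1
  refine Eq.trans ?_ h
  simp only [scalarHamiltonian, scalarObs, Real.sq_sqrt hlam, siteSpin]

theorem goeFreeEnergy_eq (B : Finset (Fin d → ℤ)) {δ η : ℝ} (h0 : 0 ≤ δ) (h1 : δ < 1)
    (hη : 0 ≤ η) : goeFreeEnergy δ η B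
      = goeEnergy (regionGraph B) δ η (uniformWeight B) / B.card := by
  rw [goeFreeEnergy, one_div_mul_eq_div, expect_goeHamiltonian _ _ h0 h1 hη]

/-! ### The scalar free energy is almost additive -/

/-- The scalar Hamiltonian of the region `B`, for noise on all of the lattice. -/
def latticeField (δ lam : ℝ) (B : Finset (Fin d → ℤ))
    (ω : Sym2 (Fin d → ℤ) ⊕ (Fin d → ℤ) → ℝ) (τ : (Fin d → ℤ) → ℤˣ) : ℝ :=
  invTemp δ / 2 * ∑ u ∈ B, ∑ v ∈ B with (latticeGraph d).Adj u v, ω (.inl s(u, v)) * (((τ u : ℤ) : ℝ) * ((τ v : ℤ) : ℝ))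
    + ∑ u ∈ B, (√lam * ω (.inr u) + lam) * ((τ u : ℤ) : ℝ)

end LatticeSync
end

noncomputable section

namespace LatticeSync

open Classical

/-! ### Relabelling and decoupling of log-partition functions -/

section LogPartition

variable {V : Type} [Fintype V]

theorem integrable_logPartition (G : SimpleGraph V) {δ : ℝ} (h0 : 0 ≤ δ) (h1 : δ < 1) (lam : ℝ) :
    Integrable (fun x => logPartition (spinField (obsSpin G siteSpin) fun i =>
        obsGain G.edgeSet δ (fun _ : V => √lam) i * x i + obsMean G.edgeSet (fun _ => √lam) i))
      (Measure.pi (noiseLaw G.edgeSet V δ)) := by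
  have hp := isProbabilityMeasure_noiseLaw G.edgeSet V h0 h1
  simp only [logPartition_eq_logSum]
  exact integrable_logSum isWeight_uniformWeight (obsSpin_sq G siteSpin_sq) (memLp_noiseLaw _ _ δ)
    _ _

theorem scalarEnergy_eq_integral_logPartition (G : SimpleGraph V) (δ : ℝ) {lam : ℝ}
    (hlam : 0 ≤ lam) :
    scalarEnergy G δ lam (uniformWeight V) = ∫ x, logPartition (spinField (obsSpin G siteSpin)
        fun i => obsGain G.edgeSet δ (fun _ : V => √lam) i * x i
          + obsMean G.edgeSet (fun _ => √lam) i) ∂Measure.pi (noiseLaw G.edgeSet V δ)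
      - Fintype.card V * (lam / 2) := by
  simp only [logPartition_eq_logSum, scalarEnergy, modelEnergy, meanLogSum, Real.sq_sqrt hlam,
    Finset.sum_const, Finset.card_univ, nsmul_eq_mul]
  rfl

theorem abs_logPartition_sub_le {H H' : (V → ℤˣ) → ℝ} {C : ℝ} (h : ∀ θ, |H θ - H' θ| ≤ C) :
    |logPartition H - logPartition H'| ≤ C := by
  rw [logPartition_eq_logSum, logPartition_eq_logSum]
  exact abs_logSum_sub_le isWeight_uniformWeight h

theorem logPartition_equiv {V' : Type} [Fintype V'] (e : V ≃ V') {H : (V → ℤˣ) → ℝ}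
    {H' : (V' → ℤˣ) → ℝ} (h : ∀ θ, H' θ = H fun u => θ (e u)) : logPartition H' = logPartition H := by
  rw [logPartition, logPartition, Fintype.card_congr e]
  congr 2
  refine Fintype.sum_equiv (e.arrowCongr (Equiv.refl _)).symm _ _ fun θ => ?_
  rw [h]
  rfl

/-- Without interaction the Boltzmann weights factorise, and so does the normalisation `2^{-|V|}`.
-/
theorem logPartition_add_logPartition {V₁ V₂ : Type} [Fintype V₁] [Fintype V₂]
    (e : (V₁ → ℤˣ) × (V₂ → ℤˣ) ≃ (V → ℤˣ))
    (hcard : Fintype.card V = Fintype.card V₁ + Fintype.card V₂) {H : (V → ℤˣ) → ℝ}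
    {H₁ : (V₁ → ℤˣ) → ℝ} {H₂ : (V₂ → ℤˣ) → ℝ} (h : ∀ p, H (e p) = H₁ p.1 + H₂ p.2) :
    logPartition H₁ + logPartition H₂ = logPartition H := by
  have hpos : ∀ {U : Type} [Fintype U] (K : (U → ℤˣ) → ℝ),
      0 < ((2 : ℝ) ^ Fintype.card U)⁻¹ * ∑ θ, Real.exp (K θ) := fun K =>
    mul_pos (by positivity) (Finset.sum_pos (fun _ _ => Real.exp_pos _) Finset.univ_nonempty)
  rw [logPartition, logPartition, logPartition, ← Real.log_mul (hpos _).ne' (hpos _).ne', hcard,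
    mul_mul_mul_comm, Finset.sum_mul_sum, ← Fintype.sum_prod_type', ← mul_inv, ← pow_add]
  congr 2
  refine Fintype.sum_equiv e _ _ fun p => ?_
  rw [h, Real.exp_add]

end LogPartition

variable {d : ℕ}

/-! ### All regions coupled through one noise field on the lattice -/

/-- The extension of a spin configuration on `B` by `1`. -/
def extendSpin (B : Finset (Fin d → ℤ)) (θ : B → ℤˣ) (u : Fin d → ℤ) : ℤˣ :=
  if h : u ∈ B then θ ⟨u, h⟩ else 1

theorem extendSpin_coe {B : Finset (Fin d → ℤ)} (θ : B → ℤˣ) (u : B) : extendSpin B θ u = θ u :=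
  dif_pos u.2

/-- The log-partition function of the region `B`, for noise on all of the lattice. -/
def regionLogSum (δ lam : ℝ) (B : Finset (Fin d → ℤ)) (ω : Sym2 (Fin d → ℤ) ⊕ (Fin d → ℤ) → ℝ) : ℝ :=
  logPartition fun θ : B → ℤˣ => latticeField δ lam B ω (extendSpin B θ)

/-- The law of the noise on all of the lattice. -/
def latticeNoise (d : ℕ) (δ : ℝ) : Measure (Sym2 (Fin d → ℤ) ⊕ (Fin d → ℤ) → ℝ) :=
  Measure.infinitePi (noiseLaw (Sym2 (Fin d → ℤ)) (Fin d → ℤ) δ)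

theorem latticeField_congr (δ lam : ℝ) {B : Finset (Fin d → ℤ)}
    (ω : Sym2 (Fin d → ℤ) ⊕ (Fin d → ℤ) → ℝ) {τ τ' : (Fin d → ℤ) → ℤˣ} (h : ∀ u ∈ B, τ u = τ' u) :
    latticeField δ lam B ω τ = latticeField δ lam B ω τ' := by
  unfold latticeField
  congr 1
  · congr 1
    refine Finset.sum_congr rfl fun u hu => Finset.sum_congr rfl fun v hv => ?_
    rw [h u hu, h v (Finset.mem_filter.1 hv).1]
  · exact Finset.sum_congr rfl fun u hu => by rw [h u hu]

theorem sum_translate (a : Fin d → ℤ) (B : Finset (Fin d → ℤ)) (f : (Fin d → ℤ) → ℝ) :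
    ∑ u ∈ translate a B, f u = ∑ u ∈ B, f (u + a) := Finset.sum_map _ _ _

/-- The noise of a region, as part of the noise on the lattice. -/
def noiseIndex (B : Finset (Fin d → ℤ)) :
    (regionGraph B).edgeSet ⊕ B → Sym2 (Fin d → ℤ) ⊕ (Fin d → ℤ) :=
  Sum.map (fun e => Sym2.map Subtype.val e.1) Subtype.val

theorem noiseIndex_injective (B : Finset (Fin d → ℤ)) : Function.Injective (noiseIndex B) :=
  ((Sym2.map.injective Subtype.val_injective).comp Subtype.val_injective).sumMap
    Subtype.val_injective

/-- All regions read their noise from one field, so their log-partition functions can be compared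
realisation by realisation; this identifies them with the regional model. -/
theorem regionLogSum_eq (δ : ℝ) {lam : ℝ} (hlam : 0 ≤ lam) (B : Finset (Fin d → ℤ))
    (ω : Sym2 (Fin d → ℤ) ⊕ (Fin d → ℤ) → ℝ) :
    regionLogSum δ lam B ω = logPartition (spinField (obsSpin (regionGraph B) siteSpin)
      fun i => obsGain (regionGraph B).edgeSet δ (fun _ => √lam) i * ω (noiseIndex B i)
        + obsMean (regionGraph B).edgeSet (fun _ => √lam) i) := by
  unfold regionLogSum
  congr 1
  ext θ
  have h := spinField_obs (regionGraph B) δ siteSpin (fun _ : B => √lam)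
    (fun e => ω (.inl (Sym2.map Subtype.val e.1))) (fun u => ω (.inr u)) θ
  have hω : (Sum.elim (fun e : (regionGraph B).edgeSet => ω (.inl (Sym2.map Subtype.val e.1)))
      fun u : B => ω (.inr u)) = fun i => ω (noiseIndex B i) := by
    ext i; rcases i with e | i <;> rfl
  rw [hω] at h
  rw [h, latticeField]
  congr 1
  · have h2 := two_mul_sum_edgeSet (regionGraph B) fun e =>
      ω (.inl (Sym2.map Subtype.val e)) * pairSpin θ e
    have h3 := sum_regionGraph B fun u v => ω (.inl s(u, v)) *
      (((extendSpin B θ u : ℤ) : ℝ) * ((extendSpin B θ v : ℤ) : ℝ))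
    simp only [extendSpin_coe] at h3
    simp only [Sym2.map_mk, pairSpin_mk] at h2
    rw [← h3, ← h2]
    simp only [mul_assoc, ← Finset.mul_sum]
    ring
  · rw [← Finset.sum_coe_sort B]
    refine Finset.sum_congr rfl fun u _ => ?_
    rw [extendSpin_coe, Real.sq_sqrt hlam]
    rfl

section Expectation

variable {δ lam : ℝ}

theorem map_noiseIndex (h0 : 0 ≤ δ) (h1 : δ < 1) (B : Finset (Fin d → ℤ)) :
    (latticeNoise d δ).map (fun ω i => ω (noiseIndex B i))
      = Measure.pi (noiseLaw (regionGraph B).edgeSet B δ) := by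
  have hp := isProbabilityMeasure_noiseLaw (Sym2 (Fin d → ℤ)) (Fin d → ℤ) h0 h1
  have e : (fun i => noiseLaw (Sym2 (Fin d → ℤ)) (Fin d → ℤ) δ (noiseIndex B i))
      = noiseLaw (regionGraph B).edgeSet B δ := by
    ext1 i; rcases i with e | i <;> rfl
  have hp' := isProbabilityMeasure_noiseLaw (regionGraph B).edgeSet B h0 h1
  rw [latticeNoise, infinitePi_map_comp _ (noiseIndex_injective B), e, Measure.infinitePi_eq_pi]

theorem integrable_regionLogSum (h0 : 0 ≤ δ) (h1 : δ < 1) (hlam : 0 ≤ lam) (B : Finset (Fin d → ℤ)) :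
    Integrable (regionLogSum δ lam B) (latticeNoise d δ) := by
  have h := integrable_logPartition (regionGraph B) h0 h1 lam
  rw [← map_noiseIndex h0 h1 B] at h
  have h2 := h.comp_measurable (by fun_prop)
  refine h2.congr (ae_of_all _ fun ω => ?_)
  rw [regionLogSum_eq δ hlam]
  rfl

theorem scalarEnergy_eq_integral (h0 : 0 ≤ δ) (h1 : δ < 1) (hlam : 0 ≤ lam)
    (B : Finset (Fin d → ℤ)) :
    scalarEnergy (regionGraph B) δ lam (uniformWeight B)
      = ∫ ω, regionLogSum δ lam B ω ∂latticeNoise d δ - B.card * (lam / 2) := by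
  have h := (integrable_logPartition (regionGraph B) h0 h1 lam).1
  rw [← map_noiseIndex h0 h1 B] at h
  rw [scalarEnergy_eq_integral_logPartition _ _ hlam, ← map_noiseIndex h0 h1 B,
    integral_map (Measurable.aemeasurable (by fun_prop)) h]
  simp only [regionLogSum_eq δ hlam, Fintype.card_coe]

/-- Translating the lattice permutes noise coordinates of equal law and so preserves the noise; the
spins are relabelled accordingly. -/
theorem integral_regionLogSum_translate (h0 : 0 ≤ δ) (h1 : δ < 1) (a : Fin d → ℤ)
    (hlam : 0 ≤ lam) (B : Finset (Fin d → ℤ)) :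
    ∫ ω, regionLogSum δ lam (translate a B) ω ∂latticeNoise d δ
      = ∫ ω, regionLogSum δ lam B ω ∂latticeNoise d δ := by
  have hp := isProbabilityMeasure_noiseLaw (Sym2 (Fin d → ℤ)) (Fin d → ℤ) h0 h1
  set g : Sym2 (Fin d → ℤ) ⊕ (Fin d → ℤ) → Sym2 (Fin d → ℤ) ⊕ (Fin d → ℤ) :=
    Sum.map (Sym2.map fun u => u + a) (fun u => u + a) with hg
  have hgi : Function.Injective g :=
    (Sym2.map.injective (add_left_injective a)).sumMap (add_left_injective a)
  have hmap : (latticeNoise d δ).map (fun ω i => ω (g i)) = latticeNoise d δ := by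
    rw [latticeNoise, infinitePi_map_comp _ hgi]
    congr 1
    ext1 i; rcases i with e | i <;> rfl
  have hint := (integrable_regionLogSum h0 h1 hlam B).1
  rw [← hmap] at hint
  conv_rhs => rw [← hmap]
  rw [integral_map (Measurable.aemeasurable (by fun_prop)) hint]
  congr 1
  ext ω
  let e : B ≃ (translate a B : Finset (Fin d → ℤ)) :=
    (Equiv.addRight a).subtypeEquiv fun u => by simp [mem_translate]
  refine logPartition_equiv e fun θ => ?_
  have hx : ∀ u ∈ B, extendSpin B (fun v => θ (e v)) u
      = extendSpin (translate a B) θ (u + a) := fun u hu => by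
    rw [extendSpin, dif_pos hu, extendSpin, dif_pos (mem_translate.2 (by simpa using hu))]
    rfl
  rw [latticeField, latticeField]
  congr 1
  · congr 1
    rw [sum_translate]
    refine Finset.sum_congr rfl fun u hu => ?_
    rw [Finset.sum_filter, Finset.sum_filter, sum_translate]
    refine Finset.sum_congr rfl fun v hv => ?_
    have hadj : (latticeGraph d).Adj (u + a) (v + a) ↔ (latticeGraph d).Adj u v := by
      rw [← adj_sub_iff (a := a)]; simp
    rw [hx u hu, hx v hv]
    simp only [hadj]
    rfl
  · rw [sum_translate]
    refine Finset.sum_congr rfl fun u hu => ?_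
    rw [hx u hu]
    rfl

end Expectation

theorem integral_abs_latticeNoise_le {δ : ℝ} (h0 : 0 ≤ δ) (h1 : δ < 1)
    (i : Sym2 (Fin d → ℤ) ⊕ (Fin d → ℤ)) :
    Integrable (fun ω => |ω i|) (latticeNoise d δ) ∧ ∫ ω, |ω i| ∂latticeNoise d δ ≤ 1 := by
  have hp := isProbabilityMeasure_noiseLaw (Sym2 (Fin d → ℤ)) (Fin d → ℤ) h0 h1
  have hm := measurePreserving_eval_infinitePi (noiseLaw (Sym2 (Fin d → ℤ)) (Fin d → ℤ) δ) i
  have hi : Integrable (fun y : ℝ => |y|) (noiseLaw (Sym2 (Fin d → ℤ)) (Fin d → ℤ) δ i) :=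
    ((memLp_noiseLaw _ _ δ i).integrable one_le_two).abs
  refine ⟨hm.integrable_comp_of_integrable hi, ?_⟩
  refine le_of_eq_of_le ?_ (integral_abs_noiseLaw_le (Sym2 (Fin d → ℤ)) (Fin d → ℤ) h0 h1 i)
  rw [← hm.map_eq, integral_map hm.measurable.aemeasurable (by fun_prop)]
  rfl

/-- The double sum over the union holds both inner sums and twice the cross sum, which the prefactor
`β/2` turns into one. Spins have modulus 1, so only the noise on cut pairs remains. -/
theorem abs_latticeField_union_le (δ lam : ℝ) {B B' : Finset (Fin d → ℤ)} (h : Disjoint B B')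
    (ω : Sym2 (Fin d → ℤ) ⊕ (Fin d → ℤ) → ℝ) (τ : (Fin d → ℤ) → ℤˣ) :
    |latticeField δ lam (B ∪ B') ω τ - (latticeField δ lam B ω τ + latticeField δ lam B' ω τ)|
      ≤ |invTemp δ| * ∑ p ∈ crossPairs B B', |ω (.inl s(p.1, p.2))| := by
  set f : (Fin d → ℤ) → (Fin d → ℤ) → ℝ := fun u v => if (latticeGraph d).Adj u v then
    ω (.inl s(u, v)) * (((τ u : ℤ) : ℝ) * ((τ v : ℤ) : ℝ)) else 0 with hf
  have hsymm : ∑ u ∈ B', ∑ v ∈ B, f u v = ∑ u ∈ B, ∑ v ∈ B', f u v := by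
    rw [Finset.sum_comm]
    refine Finset.sum_congr rfl fun u _ => Finset.sum_congr rfl fun v _ => ?_
    simp only [hf, (latticeGraph d).adj_comm u v, Sym2.eq_swap (a := u) (b := v)]
    split_ifs
    · ring
    · rfl
  have hcross : ∑ u ∈ B, ∑ v ∈ B', f u v
      = ∑ p ∈ crossPairs B B', ω (.inl s(p.1, p.2)) * (((τ p.1 : ℤ) : ℝ) * ((τ p.2 : ℤ) : ℝ)) := by
    rw [crossPairs, Finset.sum_filter, Finset.sum_product]
  have hbound : |∑ u ∈ B, ∑ v ∈ B', f u v| ≤ ∑ p ∈ crossPairs B B', |ω (.inl s(p.1, p.2))| := by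
    rw [hcross]
    refine (Finset.abs_sum_le_sum_abs _ _).trans (Finset.sum_le_sum fun p _ => ?_)
    rw [abs_mul, abs_mul, abs_eq_one_of_sq_eq_one (intUnit_sq _),
      abs_eq_one_of_sq_eq_one (intUnit_sq _), mul_one, mul_one]
  have key : latticeField δ lam (B ∪ B') ω τ - (latticeField δ lam B ω τ + latticeField δ lam B' ω τ)
      = invTemp δ * ∑ u ∈ B, ∑ v ∈ B', f u v := by
    simp only [latticeField, Finset.sum_filter, Finset.sum_union h]
    change invTemp δ / 2 * (∑ u ∈ B, (∑ v ∈ B, f u v + ∑ v ∈ B', f u v)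
      + ∑ u ∈ B', (∑ v ∈ B, f u v + ∑ v ∈ B', f u v)) + _ -
      (invTemp δ / 2 * ∑ u ∈ B, ∑ v ∈ B, f u v + _ + (invTemp δ / 2 * ∑ u ∈ B', ∑ v ∈ B', f u v + _)) = _
    rw [Finset.sum_add_distrib, Finset.sum_add_distrib, hsymm]
    ring
  rw [key, abs_mul]
  exact mul_le_mul_of_nonneg_left hbound (abs_nonneg _)

/-- Without the cross terms the log-partition function of the union splits into a sum; restoring
them changes the Hamiltonian by a bound that is uniform in the configuration. -/
theorem abs_regionLogSum_union_le (δ lam : ℝ) {B B' : Finset (Fin d → ℤ)} (h : Disjoint B B')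
    (ω : Sym2 (Fin d → ℤ) ⊕ (Fin d → ℤ) → ℝ) :
    |regionLogSum δ lam (B ∪ B') ω - regionLogSum δ lam B ω - regionLogSum δ lam B' ω|
      ≤ |invTemp δ| * ∑ p ∈ crossPairs B B', |ω (.inl s(p.1, p.2))| := by
  set τ := extendSpin (B ∪ B')
  have hsplit : regionLogSum δ lam B ω + regionLogSum δ lam B' ω
      = logPartition fun θ => latticeField δ lam B ω (τ θ) + latticeField δ lam B' ω (τ θ) := by
    refine logPartition_add_logPartition (Equiv.piFinsetUnion (fun _ => ℤˣ) h)
      (by simp only [Fintype.card_coe, Finset.card_union_of_disjoint h]) fun p => ?_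
    have e1 : latticeField δ lam B ω (τ (Equiv.piFinsetUnion (fun _ => ℤˣ) h p))
        = latticeField δ lam B ω (extendSpin B p.1) :=
      latticeField_congr δ lam ω fun u hu => by
        simp only [τ, extendSpin, dif_pos hu, dif_pos (Finset.mem_union_left B' hu)]
        exact Equiv.piFinsetUnion_left _ h hu _
    have e2 : latticeField δ lam B' ω (τ (Equiv.piFinsetUnion (fun _ => ℤˣ) h p))
        = latticeField δ lam B' ω (extendSpin B' p.2) :=
      latticeField_congr δ lam ω fun u hu => by
        simp only [τ, extendSpin, dif_pos hu, dif_pos (Finset.mem_union_right B hu)]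
        exact Equiv.piFinsetUnion_right _ h hu _
    rw [e1, e2]
  rw [sub_sub, hsplit]
  exact abs_logPartition_sub_le fun θ =>
    abs_latticeField_union_le δ lam h ω (τ θ)

/-- The expectation of the pathwise bound: `E|ω| ≤ 1` leaves `|β|` per cut pair, and the terms `lam
/ 2` per site are additive. -/
theorem almostAdditive_scalarEnergy {δ lam : ℝ} (h0 : 0 ≤ δ) (h1 : δ < 1) (hlam : 0 ≤ lam) :
    AlmostAdditive (fun B : Finset (Fin d → ℤ) =>
      scalarEnergy (regionGraph B) δ lam (uniformWeight B)) |invTemp δ| where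
  translate a B := by
    rw [scalarEnergy_eq_integral h0 h1 hlam, scalarEnergy_eq_integral h0 h1 hlam,
      integral_regionLogSum_translate h0 h1 a hlam, card_translate]
  union B B' h := by
    have hi := fun B => integrable_regionLogSum (d := d) h0 h1 hlam B
    have hn := fun i => integral_abs_latticeNoise_le (d := d) h0 h1 i
    simp only [scalarEnergy_eq_integral h0 h1 hlam]
    rw [Finset.card_union_of_disjoint h]
    have e : ∫ ω, regionLogSum δ lam (B ∪ B') ω ∂latticeNoise d δ
          - ((B.card + B'.card : ℕ) : ℝ) * (lam / 2)
          - (∫ ω, regionLogSum δ lam B ω ∂latticeNoise d δ - B.card * (lam / 2))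
          - (∫ ω, regionLogSum δ lam B' ω ∂latticeNoise d δ - B'.card * (lam / 2))
        = ∫ ω, (regionLogSum δ lam (B ∪ B') ω - regionLogSum δ lam B ω - regionLogSum δ lam B' ω)
          ∂latticeNoise d δ := by
      have hi2 : Integrable (fun ω => regionLogSum δ lam (B ∪ B') ω - regionLogSum δ lam B ω)
          (latticeNoise d δ) := (hi _).sub (hi _)
      rw [integral_sub hi2 (hi _), integral_sub (hi _) (hi _)]
      push_cast
      ring
    rw [e]
    refine (abs_integral_le_integral_abs).trans ?_
    have hs : Integrable (fun ω => ∑ p ∈ crossPairs B B', |ω (.inl s(p.1, p.2))|)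
        (latticeNoise d δ) := integrable_finsetSum _ fun p _ => (hn _).1
    refine (integral_mono (((hi _).sub (hi _)).sub (hi _)).abs (hs.const_mul _)
      fun ω => abs_regionLogSum_union_le δ lam h ω).trans ?_
    rw [integral_const_mul, integral_finsetSum _ fun p _ => (hn _).1]
    refine mul_le_mul_of_nonneg_left ?_ (abs_nonneg _)
    refine (Finset.sum_le_sum fun p _ => (hn _).2).trans (le_of_eq ?_)
    simp

end LatticeSync
end

noncomputable section

namespace LatticeSync

open Classical

variable {d : ℕ}

/-! ### The thermodynamic limit -/

/-- A site with maximal first coordinate has a neighbour outside; the existence of that coordinate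
is where `d ≥ 1` enters. -/
theorem boundary_nonempty (hd : 1 ≤ d) {B : Finset (Fin d → ℤ)} (hB : B.Nonempty) :
    (boundary B).Nonempty := by
  obtain ⟨u, hu, hmax⟩ := B.exists_max_image (fun u => u ⟨0, hd⟩) hB
  refine ⟨u, Finset.mem_filter.2 ⟨hu, _, adj_update u ⟨0, hd⟩ (t := u ⟨0, hd⟩ + 1) (by ring), ?_⟩⟩
  intro h
  have := hmax _ h
  simp at this

/-- A sequence of non-empty regions with vanishing isoperimetry. -/
structure IsFolner (B : ℕ → Finset (Fin d → ℤ)) : Prop where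
  nonempty : ∀ᶠ n in atTop, (B n).Nonempty
  isoperimetry : Tendsto (fun n => ((boundary (B n)).card : ℝ) / ((B n).card : ℝ)) atTop (𝓝 0)

theorem IsVanHove.isFolner {B : ℕ → Finset (Fin d → ℤ)} (hB : IsVanHove B) : IsFolner B where
  nonempty := Eventually.of_forall fun n => by
    obtain ⟨u⟩ := (hB.connected n).nonempty
    exact ⟨u, u.2⟩
  isoperimetry := hB.isoperimetry

/-- For `d ≥ 1` the boxes `[0, L)^d` do not exhaust the lattice, which is why the limits are taken
along this weaker class of sequences. -/
theorem isFolner_box (d : ℕ) : IsFolner (box d) where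
  nonempty := by
    filter_upwards [eventually_gt_atTop 0] with L hL
    rw [← Finset.card_pos, card_box]
    exact pow_pos hL d
  isoperimetry := by simpa [card_box] using tendsto_boundary_box d

/-- There is at least one boundary site, so `1/|B|` is at most the isoperimetric ratio. This removes
the errors of order `1/n` and `1/√n`. -/
theorem IsFolner.tendsto_inv_card (hd : 1 ≤ d) {B : ℕ → Finset (Fin d → ℤ)} (hB : IsFolner B) :
    Tendsto (fun n => ((B n).card : ℝ)⁻¹) atTop (𝓝 0) := by
  refine squeeze_zero' (Eventually.of_forall fun n => by positivity) ?_ hB.isoperimetry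
  filter_upwards [hB.nonempty] with n hn
  rw [inv_eq_one_div]
  have : (1 : ℝ) ≤ (boundary (B n)).card := by
    exact_mod_cast Finset.card_pos.2 (boundary_nonempty hd hn)
  gcongr

theorem exists_tendsto_scalarFreeEnergy (d : ℕ) {δ lam : ℝ} (h0 : 0 ≤ δ) (h1 : δ < 1)
    (hlam : 0 ≤ lam) : ∃ l, ∀ B : ℕ → Finset (Fin d → ℤ), IsFolner B →
      Tendsto (fun n => scalarFreeEnergy δ lam (B n)) atTop (𝓝 l) := by
  obtain ⟨l, hl⟩ := (almostAdditive_scalarEnergy (d := d) h0 h1 hlam).exists_tendsto (abs_nonneg _)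
  refine ⟨l, fun B hB => ?_⟩
  simp only [scalarFreeEnergy_eq _ h0 h1 hlam]
  exact hl B hB.nonempty hB.isoperimetry

theorem scalarFreeEnergy_sub_le_goeFreeEnergy {B : Finset (Fin d → ℤ)} (hB : B.Nonempty)
    {δ η q : ℝ} (h0 : 0 ≤ δ) (h1 : δ < 1) (hη : 0 ≤ η) (hq : 0 ≤ q) :
    scalarFreeEnergy δ (η * q) B - η * q ^ 2 / 4 - η / 4 * (B.card : ℝ)⁻¹ ≤ goeFreeEnergy δ η B := by
  have : Nonempty B := hB.to_subtype
  have h := scalarEnergy_le (regionGraph B) h0 h1 hη hq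
  have hn : (0 : ℝ) < B.card := by exact_mod_cast hB.card_pos
  rw [Fintype.card_coe] at h
  rw [scalarFreeEnergy_eq B h0 h1 (mul_nonneg hη hq), goeFreeEnergy_eq B h0 h1 hη, le_div_iff₀ hn]
  refine le_of_eq_of_le ?_ h
  field_simp

theorem goeFreeEnergy_le {B : Finset (Fin d → ℤ)} (hB : B.Nonempty) {δ η : ℝ} (h0 : 0 ≤ δ)
    (h1 : δ < 1) (hη : 0 ≤ η) {K : ℕ} (hK : 0 < K) {U : ℝ}
    (hU : ∀ k ∈ Finset.range (K + 1),
      scalarFreeEnergy δ (η * ((k : ℝ) / K)) B - η * ((k : ℝ) / K) ^ 2 / 4 ≤ U) :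
    goeFreeEnergy δ η B ≤ Real.log (2 * (K + 1)) * (B.card : ℝ)⁻¹ + U + η / (2 * (K : ℝ) ^ 2)
      + (K + 1) * (√(4 * (invTemp δ ^ 2 * 3 ^ d + η)) * √((B.card : ℝ)⁻¹)) := by
  have : Nonempty B := hB.to_subtype
  have hn : (0 : ℝ) < B.card := by exact_mod_cast hB.card_pos
  have h := goeEnergy_uniform_le (regionGraph B) h0 h1 hη hK (a := U * B.card) fun k hk => by
    have h := hU k hk
    rw [scalarFreeEnergy_eq B h0 h1 (by positivity), sub_le_iff_le_add, div_le_iff₀ hn] at h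
    rw [Fintype.card_coe]
    linarith
  rw [Fintype.card_coe] at h
  rw [goeFreeEnergy_eq B h0 h1 hη, div_le_iff₀ hn]
  have hs : √(4 * (invTemp δ ^ 2 * Fintype.card (regionGraph B).edgeSet + η * B.card))
      ≤ √(4 * (invTemp δ ^ 2 * 3 ^ d + η)) * √((B.card : ℝ)⁻¹) * B.card := by
    have e : √((B.card : ℝ)⁻¹) * B.card = √(B.card : ℝ) := by
      rw [Real.sqrt_inv, inv_mul_eq_div, Real.div_sqrt]
    rw [mul_assoc, e, ← Real.sqrt_mul (by positivity)]
    refine Real.sqrt_le_sqrt ?_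
    have := mul_le_mul_of_nonneg_left (card_edgeSet_regionGraph_le B) (sq_nonneg (invTemp δ))
    linarith
  have hs' := mul_le_mul_of_nonneg_left hs (show (0 : ℝ) ≤ K + 1 by positivity)
  have e2 : Real.log (2 * (K + 1)) * (B.card : ℝ)⁻¹ * B.card = Real.log (2 * (K + 1)) := by
    field_simp
  have e3 : η / (2 * (K : ℝ) ^ 2) * B.card = η * B.card / (2 * (K : ℝ) ^ 2) := by ring
  refine (h.trans (add_le_add_right hs' _)).trans (le_of_eq ?_)
  linear_combination (-1 : ℝ) * e2 - e3

section Limit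

variable {δ η : ℝ} {f : ℝ → ℝ}

theorem eventually_lt_goeFreeEnergy (hd : 1 ≤ d) (h0 : 0 ≤ δ) (h1 : δ < 1) (hη : 0 ≤ η)
    {B : ℕ → Finset (Fin d → ℤ)} (hB : IsFolner B)
    (hf : ∀ lam, 0 ≤ lam → Tendsto (fun n => scalarFreeEnergy δ lam (B n)) atTop (𝓝 (f lam)))
    {q : ℝ} (hq : 0 ≤ q) {a : ℝ} (ha : a < f (η * q) - η * q ^ 2 / 4) :
    ∀ᶠ n in atTop, a < goeFreeEnergy δ η (B n) := by
  have ht := ((hf (η * q) (mul_nonneg hη hq)).sub_const (η * q ^ 2 / 4)).sub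
    ((hB.tendsto_inv_card hd).const_mul (η / 4))
  rw [mul_zero, sub_zero] at ht
  filter_upwards [ht.eventually_const_lt ha, hB.nonempty] with n h hn
  exact h.trans_le (scalarFreeEnergy_sub_le_goeFreeEnergy hn h0 h1 hη hq)

/-- Only finitely many values `q = k/K` occur, so the scalar free energies are controlled
simultaneously; the one error that survives the limit is `η/(2K²)`. -/
theorem eventually_goeFreeEnergy_lt (hd : 1 ≤ d) (h0 : 0 ≤ δ) (h1 : δ < 1) (hη : 0 ≤ η)
    {B : ℕ → Finset (Fin d → ℤ)} (hB : IsFolner B)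
    (hf : ∀ lam, 0 ≤ lam → Tendsto (fun n => scalarFreeEnergy δ lam (B n)) atTop (𝓝 (f lam)))
    {K : ℕ} (hK : 0 < K) {U b : ℝ}
    (hU : ∀ k ∈ Finset.range (K + 1), f (η * ((k : ℝ) / K)) - η * ((k : ℝ) / K) ^ 2 / 4 ≤ U)
    (hb : U + η / (2 * (K : ℝ) ^ 2) < b) :
    ∀ᶠ n in atTop, goeFreeEnergy δ η (B n) < b := by
  set ε := (b - (U + η / (2 * (K : ℝ) ^ 2))) / 2 with hε
  have hε0 : 0 < ε := by rw [hε]; linarith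
  have hk : ∀ᶠ n in atTop, ∀ k ∈ Finset.range (K + 1),
      scalarFreeEnergy δ (η * ((k : ℝ) / K)) (B n) - η * ((k : ℝ) / K) ^ 2 / 4 ≤ U + ε := by
    rw [Finset.eventually_all]
    intro k hk
    have ht := (hf (η * ((k : ℝ) / K)) (by positivity)).sub_const (η * ((k : ℝ) / K) ^ 2 / 4)
    filter_upwards [ht.eventually_lt_const (lt_of_le_of_lt (hU k hk) (lt_add_of_pos_right U hε0))]
      with n h using h.le
  have hi := hB.tendsto_inv_card hd
  have ht : Tendsto (fun n => Real.log (2 * (K + 1)) * ((B n).card : ℝ)⁻¹ + (U + ε)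
      + η / (2 * (K : ℝ) ^ 2) + (K + 1) * (√(4 * (invTemp δ ^ 2 * 3 ^ d + η))
        * √(((B n).card : ℝ)⁻¹))) atTop (𝓝 (Real.log (2 * (K + 1)) * 0 + (U + ε)
      + η / (2 * (K : ℝ) ^ 2) + (K + 1) * (√(4 * (invTemp δ ^ 2 * 3 ^ d + η)) * √0))) :=
    (((hi.const_mul _).add_const _).add_const _).add ((hi.sqrt.const_mul _).const_mul _)
  have hlt : Real.log (2 * (K + 1)) * 0 + (U + ε) + η / (2 * (K : ℝ) ^ 2)
      + (K + 1) * (√(4 * (invTemp δ ^ 2 * 3 ^ d + η)) * √0) < b := by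
    rw [Real.sqrt_zero]
    linarith
  filter_upwards [hk, ht.eventually_lt_const hlt, hB.nonempty] with n h h' hn
  exact (goeFreeEnergy_le hn h0 h1 hη hK h).trans_lt h'

/-- Both bounds are compared along the boxes: every value of the functional is an asymptotic lower
bound, while the grid with `K = 1` gives a finite upper bound. No growth estimate on `f` is needed.
-/
theorem bddAbove_variational (hd : 1 ≤ d) (h0 : 0 ≤ δ) (h1 : δ < 1) (hη : 0 ≤ η)
    (hf : ∀ B : ℕ → Finset (Fin d → ℤ), IsFolner B → ∀ lam, 0 ≤ lam →
      Tendsto (fun n => scalarFreeEnergy δ lam (B n)) atTop (𝓝 (f lam))) :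
    BddAbove ((fun q : ℝ => f (η * q) - η * q ^ 2 / 4) '' Set.Ici 0) := by
  obtain ⟨U, hU⟩ := ((Finset.range 2).image fun k : ℕ =>
    f (η * ((k : ℝ) / (1 : ℕ))) - η * ((k : ℝ) / (1 : ℕ)) ^ 2 / 4).bddAbove
  have hB := isFolner_box d
  refine ⟨U + η / (2 * ((1 : ℕ) : ℝ) ^ 2) + 1, ?_⟩
  rintro _ ⟨q, hq, rfl⟩
  refine le_of_forall_lt fun a ha => ?_
  have hup := eventually_goeFreeEnergy_lt hd h0 h1 hη hB (hf _ hB) one_pos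
    (fun k hk => hU (Finset.mem_coe.2 (Finset.mem_image_of_mem _ hk))) (lt_add_one _)
  obtain ⟨n, hn, hn'⟩ := ((eventually_lt_goeFreeEnergy hd h0 h1 hη hB (hf _ hB) hq ha).and hup).exists
  exact hn.trans hn'

/-- From below, take `q` nearly optimal. From above, the values on the grid are at most `U`, and `K`
is chosen so large that `η/(2K²)` is negligible. -/
theorem tendsto_goeFreeEnergy (hd : 1 ≤ d) (h0 : 0 ≤ δ) (h1 : δ < 1) (hη : 0 ≤ η)
    (hf : ∀ B : ℕ → Finset (Fin d → ℤ), IsFolner B → ∀ lam, 0 ≤ lam →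
      Tendsto (fun n => scalarFreeEnergy δ lam (B n)) atTop (𝓝 (f lam)))
    {B : ℕ → Finset (Fin d → ℤ)} (hB : IsFolner B) {U : ℝ}
    (hU : IsLUB ((fun q : ℝ => f (η * q) - η * q ^ 2 / 4) '' Set.Ici 0) U) :
    Tendsto (fun n => goeFreeEnergy δ η (B n)) atTop (𝓝 U) := by
  refine tendsto_order.2 ⟨fun a ha => ?_, fun b hb => ?_⟩
  · obtain ⟨_, ⟨q, hq, rfl⟩, h⟩ := (lt_isLUB_iff hU).1 ha
    exact eventually_lt_goeFreeEnergy hd h0 h1 hη hB (hf B hB) hq h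
  · have ht : Tendsto (fun K : ℕ => U + η / (2 * (K : ℝ) ^ 2)) atTop (𝓝 (U + 0)) := by
      refine tendsto_const_nhds.add (tendsto_const_nhds.div_atTop ?_)
      exact ((tendsto_pow_atTop two_ne_zero).comp tendsto_natCast_atTop_atTop).const_mul_atTop
        two_pos
    rw [add_zero] at ht
    obtain ⟨K, hK, hK0⟩ := ((ht.eventually_lt_const hb).and (eventually_gt_atTop 0)).exists
    refine eventually_goeFreeEnergy_lt hd h0 h1 hη hB (hf B hB) hK0 (fun k _ => ?_) hK
    exact hU.1 ⟨(k : ℝ) / K, Set.mem_Ici.2 (by positivity), rfl⟩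

end Limit

end LatticeSync
end

theorem mainTheorem9 (d : ℕ) (hd : 1 ≤ d) :
    ∃ fsc φ : ℝ → ℝ → ℝ, ∀ δ : ℝ, 0 ≤ δ → δ < 1 →
      (∀ lam : ℝ, 0 ≤ lam →
        LatticeSync.VanHoveLimit (d := d) (LatticeSync.scalarFreeEnergy δ lam) (fsc δ lam)) ∧
      ∀ η : ℝ, 0 ≤ η →
        LatticeSync.VanHoveLimit (d := d) (LatticeSync.goeFreeEnergy δ η) (φ δ η) ∧
        IsLUB ((fun q : ℝ => fsc δ (η * q) - η * q ^ 2 / 4) '' Set.Ici 0) (φ δ η) := by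
  -- The hypotheses are moved inside the existential to make the choice of `fsc` total; outside the
  -- admissible range the value 0 is arbitrary.
  have hex : ∀ δ lam : ℝ, ∃ l, 0 ≤ δ → δ < 1 → 0 ≤ lam → ∀ B : ℕ → Finset (Fin d → ℤ),
      LatticeSync.IsFolner B →
        Tendsto (fun n => LatticeSync.scalarFreeEnergy δ lam (B n)) atTop (𝓝 l) := by
    intro δ lam
    by_cases h : 0 ≤ δ ∧ δ < 1 ∧ 0 ≤ lam
    · obtain ⟨l, hl⟩ := LatticeSync.exists_tendsto_scalarFreeEnergy d h.1 h.2.1 h.2.2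
      exact ⟨l, fun _ _ _ => hl⟩
    · exact ⟨0, fun h0 h1 hlam => absurd ⟨h0, h1, hlam⟩ h⟩
  choose fsc hfsc using hex
  refine ⟨fsc, fun δ η => sSup ((fun q : ℝ => fsc δ (η * q) - η * q ^ 2 / 4) '' Set.Ici 0),
    fun δ h0 h1 => ⟨fun lam hlam B hB => hfsc δ lam h0 h1 hlam B hB.isFolner, fun η hη => ?_⟩⟩
  have hf := fun (B : ℕ → Finset (Fin d → ℤ)) (hB : LatticeSync.IsFolner B) lam hlam =>
    hfsc δ lam h0 h1 hlam B hB
  have hlub := isLUB_csSup (Set.nonempty_Ici.image _)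
    (LatticeSync.bddAbove_variational hd h0 h1 hη hf)
  exact ⟨fun B hB => LatticeSync.tendsto_goeFreeEnergy hd h0 h1 hη hf hB.isFolner hlub, hlub⟩
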